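/- **Setting.** Let $T>0$, let $U\subset\mathbb R^p$ and $V\subset\mathbb R^q$ be nonempty compact sets, and let $\ell:\mathbb R^N\times[0,T]\times U\times V\to\mathbb R$ be continuous, bounded, and Lipschitz in $(x,t)$ uniformly in $(u,v)$. Let $\Pi_2$ be the set of Borel probability measures $m$ on $\mathbb R^N$ with $\int|x|^2\,dm(x)<\infty$. Put $$H(t,m)=\inf_{u\in U}\sup_{v\in V}\int_{\mathbb R^N}\ell(x,t,u,v)\,dm(x)$$ and assume Isaacs' condition $$H(t,m)=\sup_{v\in V}\inf_{u\in U}\int_{\mathbb R^N}\ell(x,t,u,v)\,dm(x)\qquad\text{for all }(t,m)\in[0,T]\times\Pi_2.$$ **The game.** Fix $t_0\in[0,T]$. Let $\mathcal U(t_0)$ and $\mathcal V(t_0)$ be the sets of measurable maps from $[t_0,T]$ to $U$ and to $V$, modulo equality a.e., with the $L^1$ distance and its Borel $\sigma$-algebra. For a subdivision $\Delta: t_0<t_1<\dots<t_n=T$ (with $n=0$ if $t_0=T$), let $\mathcal A_\Delta(t_0)$ be the set of Borel maps $\alpha:\mathcal V(t_0)\to\mathcal U(t_0)$ such that, for $0\le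 i<n$, $v_1=v_2$ a.e. on $[t_0,t_i]$ implies $\alpha(v_1)=\alpha(v_2)$ a.e. on $[t_0,t_{i+1}]$. Let $\mathcal B(t_0)$ be the set of nonanticipative Borel maps $\beta:\mathcal U(t_0)\to\mathcal V(t_0)$ such that for all $t\in[t_0,T]$ and $u_1,u_2\in\mathcal U(t_0)$ there is $\delta>0$ such that, if $u_1=u_2$ a.e. on $[t_0,t]$, then $\beta(u_1)=\beta(u_2)$ a.e. on $[t_0,t+\delta]\cap[t_0,T]$. (Nonanticipative: $u_1=u_2$ a.e. on $[t_0,t]$ implies $\beta(u_1)=\beta(u_2)$ a.e. on $[t_0,t]$.) Both sets of strategies carry the distance of uniform convergence, e.g. $d(\alpha_1,\alpha_2)=\sup_v\|\alpha_1(v)-\alpha_2(v)\|_{L^1}$. For such $\alpha,\beta$ there is exactly one pair $\Phi(\alpha,\beta)=(u,v)$ with $\alpha(v)=u$ and $\beta(u)=v$. Let $(\Omega_1,\mathcal F_1,P_1)$, $(\Omega_2,\mathcal F_2,P_2)$ and $(\Omega,\mathcal F,P)$ be probability spaces such that $(\Omega_1,P_1)$ and $(\Omega,P)$ are sufficiently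 large, i.e. each of these two carries a random variable uniformly distributed on $[0,1]$. A strategy of the informed Player I, who minimizes, is a strongly measurable map $\alpha:\mathbb R^N\times\Omega_1\to\mathcal A_\Delta(t_0)$ for some $\Delta$; a strategy of Player II, who maximizes, is a strongly measurable map $\beta:\Omega_2\to\mathcal B(t_0)$ (strongly measurable: Borel measurable with separable range). The upper value of the game is $$V^+(t_0,m)=\inf_\alpha\sup_\beta\int_{\mathbb R^N\times\Omega_1\times\Omega_2}\int_{t_0}^T\ell\bigl(x,s,\Phi(\alpha(x,\omega_1),\beta(\omega_2))(s)\bigr)\,ds\;d(m\otimes P_1\otimes P_2)(x,\omega_1,\omega_2).$$ **Martingale measures.** Let $\mathcal M(t_0,m)$ be the set of processes $(M_t)_{t\in[t_0,T]}$ on $(\Omega,\mathcal F,P)$ whose values are Borel measures on $\mathbb R^N$, such that 1. for every bounded Borel $f:\mathbb R^N\to\mathbb R$, the map $t\mapsto\int f\,dM_t$ is $P$-a.s. càdlàg on $[t_0,T]$; 2. there is a random variable $X$ of law $m$ on $(\Omega,\mathcal F,P)$ such that, for every $t\in[t_0,T]$ and every bounded Borel $f$, $\int f\,dM_t=E[f(X)\mid\mathcal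 F^M_t]$ $P$-a.s., where $(\mathcal F^M_t)$ is the right-continuous, completed filtration generated by $(M_t(B))_{t\in[t_0,T]}$, $B$ Borel. **Theorem.** For every $(t_0,m)\in[0,T]\times\Pi_2$, $$V^+(t_0,m)=W(t_0,m):=\inf_{M\in\mathcal M(t_0,m)}E\left[\int_{t_0}^T H(s,M_s)\,ds\right].$$ -/

import Mathlib

open MeasureTheory Set Filter Topology TopologicalSpace

namespace IncompleteInfoGame

noncomputable section

/-! ### Controls -/

/-- Controls on `[t₀, T]` with values in the compact set `K`: measurable maps `[t₀, T] → K` modulo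
equality almost everywhere, realised as elements of `L¹([t₀, T])` with values in `K`. -/
def Control {d : ℕ} (K : NonemptyCompacts (EuclideanSpace ℝ (Fin d))) (t₀ T : ℝ) : Type :=
  {u : Lp (EuclideanSpace ℝ (Fin d)) 1 (volume.restrict (Icc t₀ T)) //
    ∀ᵐ s ∂(volume.restrict (Icc t₀ T)), u s ∈ K}

section Control

variable {d : ℕ} {K : NonemptyCompacts (EuclideanSpace ℝ (Fin d))} {t₀ T : ℝ}

/-- The distance on controls is the `L¹` distance `∫ |u₁ - u₂|`. -/
instance : MetricSpace (Control K t₀ T) :=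
  inferInstanceAs (MetricSpace {u : Lp (EuclideanSpace ℝ (Fin d)) 1 (volume.restrict (Icc t₀ T)) //
    ∀ᵐ s ∂(volume.restrict (Icc t₀ T)), u s ∈ K})

instance : MeasurableSpace (Control K t₀ T) := borel _

instance : BorelSpace (Control K t₀ T) := ⟨rfl⟩

/-- A control is used as a function of time; only its values at almost every `s ∈ [t₀, T]` have
a meaning. -/
instance : CoeFun (Control K t₀ T) (fun _ => ℝ → EuclideanSpace ℝ (Fin d)) :=
  ⟨fun u => (u.1 : ℝ → EuclideanSpace ℝ (Fin d))⟩

instance : Nonempty (Control K t₀ T) := by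
  obtain ⟨k, hk⟩ := K.nonempty
  refine ⟨⟨Lp.const 1 _ k, ?_⟩⟩
  filter_upwards [Lp.coeFn_const (p := 1) (μ := volume.restrict (Icc t₀ T)) k] with s hs
  rw [hs]
  exact hk

/-- `u₁ ≡ u₂` almost everywhere on `[t₀, t] ∩ [t₀, T]`. -/
def AgreeUpTo (t : ℝ) (u₁ u₂ : Control K t₀ T) : Prop :=
  ∀ᵐ s ∂(volume.restrict (Icc t₀ T)), s ≤ t → u₁ s = u₂ s

theorem agreeUpTo_start (u₁ u₂ : Control K t₀ T) : AgreeUpTo t₀ u₁ u₂ := by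
  unfold AgreeUpTo
  rw [ae_restrict_iff' measurableSet_Icc]
  have h : ∀ᵐ s : ℝ, s ≠ t₀ := by simp [ae_iff]
  filter_upwards [h] with s hs hmem hle
  exact absurd (le_antisymm hle hmem.1) hs

theorem eq_of_agreeUpTo_end {u₁ u₂ : Control K t₀ T} (h : AgreeUpTo T u₁ u₂) : u₁ = u₂ := by
  apply Subtype.ext
  apply Lp.ext
  filter_upwards [h, ae_restrict_mem measurableSet_Icc] with s hs hmem
  exact hs hmem.2

end Control

/-! ### Pure strategies -/

/-- Subdivisions `t₀ < t₁ < ⋯ < tₙ = T` of `[t₀, T]` (with `n = 0` when `t₀ = T`). -/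
structure Subdivision (t₀ T : ℝ) where
  n : ℕ
  time : Fin (n + 1) → ℝ
  strictMono : StrictMono time
  time_zero : time 0 = t₀
  time_last : time (Fin.last n) = T

section Strategies

variable {p q : ℕ} (U : NonemptyCompacts (EuclideanSpace ℝ (Fin p)))
  (V : NonemptyCompacts (EuclideanSpace ℝ (Fin q))) {t₀ T : ℝ}

/-- Pure strategies of Player I which are nonanticipative with delay with respect to the
subdivision `Δ`. -/
structure StrategyI (Δ : Subdivision t₀ T) where
  toFun : Control V t₀ T → Control U t₀ T
  measurable_toFun : Measurable toFun
  delay : ∀ (i : Fin Δ.n) (v₁ v₂ : Control V t₀ T), AgreeUpTo (Δ.time i.castSucc) v₁ v₂ →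
    AgreeUpTo (Δ.time i.succ) (toFun v₁) (toFun v₂)

variable (t₀ T) in
/-- Pure strategies of Player II: nonanticipative Borel maps with a delay that may depend on the
time and on the controls of Player I. -/
structure StrategyII where
  toFun : Control U t₀ T → Control V t₀ T
  measurable_toFun : Measurable toFun
  nonanticipative : ∀ t ∈ Icc t₀ T, ∀ u₁ u₂ : Control U t₀ T, AgreeUpTo t u₁ u₂ →
    AgreeUpTo t (toFun u₁) (toFun u₂)
  delay : ∀ t ∈ Icc t₀ T, ∀ u₁ u₂ : Control U t₀ T, ∃ δ > 0, AgreeUpTo t u₁ u₂ →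
    AgreeUpTo (t + δ) (toFun u₁) (toFun u₂)

variable {U V}

/-- The distance on the strategies of Player I is `d(α₁, α₂) = sup_v ‖α₁(v) - α₂(v)‖_{L¹}`
(the extended distance of uniform convergence, which is finite here since `U` is bounded). -/
instance (Δ : Subdivision t₀ T) : PseudoEMetricSpace (StrategyI U V Δ) :=
  PseudoEMetricSpace.induced (fun α => UniformFun.ofFun α.toFun) inferInstance

/-- The distance on the strategies of Player II is `d(β₁, β₂) = sup_u ‖β₁(u) - β₂(u)‖_{L¹}`. -/
instance : PseudoEMetricSpace (StrategyII U V t₀ T) :=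
  PseudoEMetricSpace.induced (fun β => UniformFun.ofFun β.toFun) inferInstance

/-- Two pure strategies played against each other determine a unique pair of controls. -/
theorem existsUnique_outcome {Δ : Subdivision t₀ T} (α : StrategyI U V Δ)
    (β : StrategyII U V t₀ T) :
    ∃! w : Control U t₀ T × Control V t₀ T, α.toFun w.2 = w.1 ∧ β.toFun w.1 = w.2 := by
  have hmem : ∀ i : Fin (Δ.n + 1), Δ.time i ∈ Icc t₀ T := fun i =>
    ⟨Δ.time_zero.symm.le.trans (Δ.strictMono.monotone (Fin.zero_le i)),
      (Δ.strictMono.monotone (Fin.le_last i)).trans Δ.time_last.le⟩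
  set F : Control U t₀ T → Control U t₀ T := fun u => α.toFun (β.toFun u) with hF
  have key : ∀ i : Fin (Δ.n + 1), ∀ u₁ u₂ : Control U t₀ T,
      AgreeUpTo (Δ.time i) (F^[i] u₁) (F^[i] u₂) := by
    intro i
    induction i using Fin.induction with
    | zero =>
      intro u₁ u₂
      rw [Δ.time_zero]
      exact agreeUpTo_start _ _
    | succ i ih =>
      intro u₁ u₂
      have h := α.delay i _ _ (β.nonanticipative _ (hmem _) _ _ (ih u₁ u₂))
      rw [Fin.val_succ, Function.iterate_succ_apply', Function.iterate_succ_apply']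
      exact h
  have hconst : ∀ u₁ u₂ : Control U t₀ T, F^[Δ.n] u₁ = F^[Δ.n] u₂ := by
    intro u₁ u₂
    have h := key (Fin.last Δ.n) u₁ u₂
    rw [Δ.time_last] at h
    exact eq_of_agreeUpTo_end h
  obtain ⟨u₀⟩ : Nonempty (Control U t₀ T) := inferInstance
  have hfix : F (F^[Δ.n] u₀) = F^[Δ.n] u₀ := by
    rw [← Function.iterate_succ_apply' F, Function.iterate_succ_apply]
    exact hconst _ _
  refine ⟨(F^[Δ.n] u₀, β.toFun (F^[Δ.n] u₀)), ⟨hfix, rfl⟩, ?_⟩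
  rintro ⟨u, v⟩ ⟨h₁, h₂⟩
  have hu : F u = u := by
    change α.toFun (β.toFun u) = u
    rw [h₂, h₁]
  have hu' : u = F^[Δ.n] u₀ := by
    rw [← hconst u u₀]
    exact (Function.iterate_fixed hu _).symm
  subst hu'
  exact Prod.ext rfl h₂.symm

/-- The pair of controls `(u, v)` characterised by `α(v) = u` and `β(u) = v`. -/
def outcome {Δ : Subdivision t₀ T} (α : StrategyI U V Δ) (β : StrategyII U V t₀ T) :
    Control U t₀ T × Control V t₀ T :=
  (existsUnique_outcome α β).choose

theorem outcome_spec {Δ : Subdivision t₀ T} (α : StrategyI U V Δ) (β : StrategyII U V t₀ T) :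
    α.toFun (outcome α β).2 = (outcome α β).1 ∧ β.toFun (outcome α β).1 = (outcome α β).2 :=
  (existsUnique_outcome α β).choose_spec.1

end Strategies

/-! ### Random strategies, payoff and upper value -/

section Game

variable {N p q : ℕ} (U : NonemptyCompacts (EuclideanSpace ℝ (Fin p)))
  (V : NonemptyCompacts (EuclideanSpace ℝ (Fin q))) (t₀ T : ℝ)

/-- Random strategies of the informed Player I: measurable maps `ℝᴺ × Ω₁ → 𝓐_Δ`, for some
subdivision `Δ`. The metric space `𝓐_Δ` is not separable; random variables with values in it are
limits of simple ones, that is Borel measurable with separable range (the second part is automatic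
for Borel maps defined on a standard Borel space). -/
structure RandomStrategyI (N : ℕ) (Ω₁ : Type*) [MeasurableSpace Ω₁] where
  Δ : Subdivision t₀ T
  toFun : EuclideanSpace ℝ (Fin N) × Ω₁ → StrategyI U V Δ
  stronglyMeasurable_toFun : StronglyMeasurable toFun

/-- Random strategies of the non-informed Player II. -/
structure RandomStrategyII (Ω₂ : Type*) [MeasurableSpace Ω₂] where
  toFun : Ω₂ → StrategyII U V t₀ T
  stronglyMeasurable_toFun : StronglyMeasurable toFun

variable {U V t₀ T}
variable (ℓ : EuclideanSpace ℝ (Fin N) → ℝ → EuclideanSpace ℝ (Fin p) →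
  EuclideanSpace ℝ (Fin q) → ℝ)
variable {Ω₁ Ω₂ : Type*} [MeasurableSpace Ω₁] [MeasurableSpace Ω₂]

/-- The payoff of a pair of random strategies, when the parameter `x` is drawn from `m`. -/
def payoff (P₁ : Measure Ω₁) (P₂ : Measure Ω₂) (m : Measure (EuclideanSpace ℝ (Fin N)))
    (α : RandomStrategyI U V t₀ T N Ω₁) (β : RandomStrategyII U V t₀ T Ω₂) : ℝ :=
  ∫ z : EuclideanSpace ℝ (Fin N) × Ω₁ × Ω₂,
    (∫ s in t₀..T, ℓ z.1 s ((outcome (α.toFun (z.1, z.2.1)) (β.toFun z.2.2)).1 s)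
      ((outcome (α.toFun (z.1, z.2.1)) (β.toFun z.2.2)).2 s)) ∂(m.prod (P₁.prod P₂))

variable (U V T)

/-- The upper value `V⁺(t₀, m)`. -/
def upperValue (P₁ : Measure Ω₁) (P₂ : Measure Ω₂) (t₀ : ℝ)
    (m : Measure (EuclideanSpace ℝ (Fin N))) : ℝ :=
  ⨅ α : RandomStrategyI U V t₀ T N Ω₁, ⨆ β : RandomStrategyII U V t₀ T Ω₂, payoff ℓ P₁ P₂ m α β

/-- The Hamiltonian `H(t, m) = inf_{u ∈ U} sup_{v ∈ V} ∫ ℓ(x, t, u, v) dm(x)`. -/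
def hamiltonian (t : ℝ) (m : Measure (EuclideanSpace ℝ (Fin N))) : ℝ :=
  ⨅ u : U, ⨆ v : V, ∫ x, ℓ x t u v ∂m

/-- Isaacs' condition at time `t` and measure `m`. -/
def IsaacsAt (t : ℝ) (m : Measure (EuclideanSpace ℝ (Fin N))) : Prop :=
  (⨅ u : U, ⨆ v : V, ∫ x, ℓ x t u v ∂m) = ⨆ v : V, ⨅ u : U, ∫ x, ℓ x t u v ∂m

end Game

/-- Borel probability measures on `ℝᴺ` with a finite second order moment. -/
def Pi2 (N : ℕ) : Set (Measure (EuclideanSpace ℝ (Fin N))) :=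
  {m | IsProbabilityMeasure m ∧ Integrable (fun x => ‖x‖ ^ 2) m}

/-! ### Martingale measures -/

/-- `g` is càdlàg on `[a, b]`: right continuous with left limits. -/
def IsCadlagOn (g : ℝ → ℝ) (a b : ℝ) : Prop :=
  ∀ t ∈ Icc a b, ContinuousWithinAt g (Icc t b) t ∧ ∃ l : ℝ, Tendsto g (𝓝[Ico a t] t) (𝓝 l)

section MartingaleMeasure

variable {N : ℕ} {Ω : Type*} [mΩ : MeasurableSpace Ω]

/-- The right continuous, completed filtration generated by the measure-valued process
`(M_t)_{t ∈ [t₀, t₁]}`. The σ-algebra on `Measure` is generated by the maps `μ ↦ μ B`,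
`B` Borel. -/
@[reducible] def beliefSigma (P : Measure Ω) (t₀ t₁ : ℝ) (M : ℝ → Ω → Measure (EuclideanSpace ℝ (Fin N)))
    (t : ℝ) : MeasurableSpace Ω :=
  ⨅ s ∈ Ioi t, (MeasurableSpace.generateFrom {A | MeasurableSet A ∧ P A = 0} ⊔
    ⨆ r ∈ Icc t₀ t₁ ∩ Iic s, MeasurableSpace.comap (M r) inferInstance)

/-- The set `𝓜(t₀, t₁, m)` of measure-valued martingales
`M_t = P[X ∈ · | 𝓕ᴹ_t]`, `t ∈ [t₀, t₁]`, with `X` of law `m` and càdlàg trajectories. Only the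
values `M t` with `t ∈ [t₀, t₁]` matter. -/
structure IsMartingaleMeasure (P : Measure Ω) (t₀ t₁ : ℝ)
    (m : Measure (EuclideanSpace ℝ (Fin N)))
    (M : ℝ → Ω → Measure (EuclideanSpace ℝ (Fin N))) : Prop where
  measurable : ∀ t ∈ Icc t₀ t₁, Measurable (M t)
  cadlag : ∀ f : EuclideanSpace ℝ (Fin N) → ℝ, Measurable f → (∃ C, ∀ x, |f x| ≤ C) →
    ∀ᵐ ω ∂P, IsCadlagOn (fun t => ∫ x, f x ∂(M t ω)) t₀ t₁
  condLaw : ∃ X : Ω → EuclideanSpace ℝ (Fin N), Measurable X ∧ P.map X = m ∧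
    ∀ t ∈ Icc t₀ t₁, ∀ f : EuclideanSpace ℝ (Fin N) → ℝ, Measurable f → (∃ C, ∀ x, |f x| ≤ C) →
      (fun ω => ∫ x, f x ∂(M t ω)) =ᵐ[P] P[fun ω => f (X ω) | beliefSigma P t₀ t₁ M t]

/-- `W(t₀, m) = inf_M E[∫_{t₀}^T H(s, M_s) ds]`, the infimum being over `𝓜(t₀, T, m)`. -/
def martingaleValue {p q : ℕ} (U : NonemptyCompacts (EuclideanSpace ℝ (Fin p)))
    (V : NonemptyCompacts (EuclideanSpace ℝ (Fin q)))
    (ℓ : EuclideanSpace ℝ (Fin N) → ℝ → EuclideanSpace ℝ (Fin p) →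
      EuclideanSpace ℝ (Fin q) → ℝ)
    (T : ℝ) (P : Measure Ω) (t₀ : ℝ) (m : Measure (EuclideanSpace ℝ (Fin N))) : ℝ :=
  ⨅ M : {M : ℝ → Ω → Measure (EuclideanSpace ℝ (Fin N)) // IsMartingaleMeasure P t₀ T m M},
    ∫ ω, (∫ s in t₀..T, hamiltonian U V ℓ s (M.1 s ω)) ∂P

/-- A probability space is sufficiently large if it carries a random variable which is uniformly
distributed on `[0, 1]`, that is, if it is atomless. -/
def SufficientlyLarge (P : Measure Ω) : Prop :=
  ∃ ξ : Ω → ℝ, Measurable ξ ∧ P.map ξ = volume.restrict (Icc 0 1)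

end MartingaleMeasure

end

end IncompleteInfoGame

/-!
The theorem is the sum of two inequalities between the value `W` of the optimal control problem over
measure-valued martingales and the upper value `V⁺` of the game. The reason behind both is that the
only thing Player I can achieve by using the information `x` is to steer the belief of Player II,
the conditional law of `x` given the control observed so far. This belief is a measure-valued
martingale, and while it equals `μ` at time `s` the players face the one-stage game with matrix
`∫ ℓ(x, s, u, v) dμ(x)`, whose value is `H(s, μ)`.

**`V⁺ ≤ W`** (`IsMartingaleMeasure.upperValue_le`). Given a martingale measure `M`, Player I
reveals it on a fine grid: knowing `x`, the seed `ω₁` is used to simulate the conditional law of the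
path of minimisers attached to `M`, and on each grid interval the control is frozen at an
`ε`-minimiser of the one-stage game at the belief `M` has at the *right* end point of the interval.
Such a control is open loop, and the reply of Player II on a grid interval is determined by the
control up to the end of that interval, hence by `M` up to that end point. Therefore no reply brings
more than `H` along the grid, up to `ε` and a time modulus (`exists_strategy_payoff_le`). Moreover
`M` is right continuous, so that the Riemann sums with right end points converge to
`E ∫ H(s, M_s) ds` (`tendsto_sum_integral_hamiltonian`). Law-invariance of the payoff
lets `M` live on `Ω` and the seed on `Ω₁`.

**`W ≤ V⁺`** (`IsRegularCost.martingaleValue_le`). Fix a random strategy of Player I. On a fine grid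
Player II plays the `ε`-maximiser (Isaacs' condition makes it good against every `u`) for the belief
which the control of Player I has induced up to the beginning of the current interval. The belief
depends on the strategy of Player II itself, but only on its earlier steps, so this feedback is
built recursively over the grid (`exists_feedback_belief`). The resulting beliefs form a martingale
measure (`isMartingaleMeasure_belief`), so its cost is at least `W`. The error is the change of the
belief during one step, and this is small for fine grids *uniformly in the strategy of Player I*:
increments of a bounded martingale are orthogonal, so their squares sum to at most `C²` and
their absolute values, averaged over `n` steps, are at most of order `C / √n`
(`sum_integral_abs_sub_belief_le`). This concerns a single test function; a finite net, from
tightness of `m` and compactness of `U` and `V`, covers all `ℓ(·, s, u, v)`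
(`IsRegularCost.exists_finset_abs_average_sub_le`).

Both arguments need a cost which is continuous on the whole space, so `ℓ` is first extended by
Tietze's theorem, which changes neither side.
-/

namespace IncompleteInfoGame

noncomputable section

/-! ### Saddle values over compact spaces and dense sequences -/

section CompactGame

variable {A B : Type*} [TopologicalSpace A] [TopologicalSpace B]

theorem iSup_denseSeq_eq [CompactSpace B] [SeparableSpace B] [Nonempty B] {f : B → ℝ}
    (hf : Continuous f) : ⨆ j, f (denseSeq B j) = ⨆ b, f b := by
  have hb : BddAbove (range f) := (isCompact_range hf).bddAbove
  have hb' : BddAbove (range fun j => f (denseSeq B j)) :=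
    hb.mono (range_comp_subset_range (denseSeq B) f)
  apply le_antisymm
  · exact ciSup_le fun j => le_ciSup hb _
  · refine ciSup_le fun b => ?_
    refine (denseRange_denseSeq B).induction_on (p := fun b => f b ≤ ⨆ j, f (denseSeq B j)) b
      (isClosed_le hf continuous_const) fun j => le_ciSup hb' j

theorem iSup_neg_eq {ι : Sort*} (g : ι → ℝ) : ⨆ i, -g i = -⨅ i, g i := by
  rw [iSup, iInf, Real.sInf_def, neg_neg]
  congr 1
  ext x
  simp [neg_eq_iff_eq_neg]

theorem iInf_denseSeq_eq [CompactSpace A] [SeparableSpace A] [Nonempty A] {f : A → ℝ}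
    (hf : Continuous f) : ⨅ i, f (denseSeq A i) = ⨅ a, f a := by
  have h := iSup_denseSeq_eq (f := fun a => -f a) hf.neg
  rw [iSup_neg_eq, iSup_neg_eq] at h
  exact neg_injective h

theorem continuous_iSup_of_continuous_uncurry [CompactSpace B] {a : A → B → ℝ}
    (ha : Continuous (Function.uncurry a)) : Continuous fun x => ⨆ y, a x y := by
  have h := (isCompact_univ (X := B)).continuous_sSup (f := a) ha
  simpa only [image_univ, sSup_range] using h

theorem iInf_iSup_denseSeq_eq [CompactSpace A] [SeparableSpace A] [Nonempty A] [CompactSpace B]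
    [SeparableSpace B] [Nonempty B] {a : A → B → ℝ} (ha : Continuous (Function.uncurry a)) :
    ⨅ i, ⨆ j, a (denseSeq A i) (denseSeq B j) = ⨅ x, ⨆ y, a x y := by
  rw [← iInf_denseSeq_eq (continuous_iSup_of_continuous_uncurry ha)]
  refine iInf_congr fun i => ?_
  exact iSup_denseSeq_eq (ha.comp (Continuous.prodMk_right (denseSeq A i)))

theorem iInf_iSup_le_add [CompactSpace A] [Nonempty A] [CompactSpace B] [Nonempty B]
    {a b : A → B → ℝ} {D : ℝ}
    (ha : Continuous (Function.uncurry a)) (hb : Continuous (Function.uncurry b))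
    (h : ∀ x y, a x y ≤ b x y + D) : ⨅ x, ⨆ y, a x y ≤ (⨅ x, ⨆ y, b x y) + D := by
  rw [← sub_le_iff_le_add]
  refine le_ciInf fun x => ?_
  rw [sub_le_iff_le_add]
  have hbd : BddBelow (range fun x => ⨆ y, a x y) :=
    (isCompact_range (continuous_iSup_of_continuous_uncurry ha)).bddBelow
  refine (ciInf_le hbd x).trans (ciSup_le fun y => (h x y).trans ?_)
  gcongr
  exact le_ciSup (f := fun y => b x y)
    (isCompact_range (hb.comp (Continuous.prodMk_right x))).bddAbove y

end CompactGame

/-- Integration of a fixed Borel function is a measurable function of the measure. -/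
theorem measurable_integral_measure {X : Type*} [MeasurableSpace X] {f : X → ℝ}
    (hf : Measurable f) : Measurable fun μ : Measure X => ∫ x, f x ∂μ := by
  classical
  have h : (fun μ : Measure X => ∫ x, f x ∂μ) = fun μ =>
      if ∫⁻ x, ‖f x‖ₑ ∂μ < ⊤ then
        (∫⁻ x, ENNReal.ofReal (f x) ∂μ).toReal - (∫⁻ x, ENNReal.ofReal (-f x) ∂μ).toReal
      else 0 := by
    funext μ
    split_ifs with h
    · exact integral_eq_lintegral_pos_part_sub_lintegral_neg_part
        ⟨hf.aestronglyMeasurable, h⟩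
    · exact integral_undef fun hi => h hi.2
  rw [h]
  refine Measurable.ite ?_ ?_ measurable_const
  · exact measurableSet_lt (Measure.measurable_lintegral hf.enorm) measurable_const
  · exact (Measure.measurable_lintegral hf.ennreal_ofReal).ennreal_toReal.sub
      (Measure.measurable_lintegral hf.neg.ennreal_ofReal).ennreal_toReal

/-- Measurable choice of an `ε`-minimiser among countably many functions. -/
theorem exists_measurable_index_lt_iInf_add {X : Type*} [MeasurableSpace X] {f : ℕ → X → ℝ}
    (hf : ∀ i, Measurable (f i)) {ε : ℝ} (hε : 0 < ε) :
    ∃ sel : X → ℕ, Measurable sel ∧ ∀ x, f (sel x) x < (⨅ i, f i x) + ε := by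
  classical
  have h : ∀ x, ∃ i, f i x < (⨅ i, f i x) + ε := fun x =>
    exists_lt_of_ciInf_lt (lt_add_of_pos_right _ hε)
  refine ⟨fun x => Nat.find (h x), measurable_find h fun i => ?_, fun x => Nat.find_spec (h x)⟩
  exact measurableSet_lt (hf i) ((Measurable.iInf hf).add_const ε)

/-! ### Costs averaged against a belief -/

section Cost

variable {N p q : ℕ}

/-- A running cost defined for all arguments, continuous, and bounded and Lipschitz in time with
the same constant `C`. -/
structure IsRegularCost (T : ℝ) (U : NonemptyCompacts (EuclideanSpace ℝ (Fin p)))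
    (V : NonemptyCompacts (EuclideanSpace ℝ (Fin q)))
    (ℓ : EuclideanSpace ℝ (Fin N) → ℝ → EuclideanSpace ℝ (Fin p) →
      EuclideanSpace ℝ (Fin q) → ℝ) (C : ℝ) : Prop where
  cont : Continuous (fun z : EuclideanSpace ℝ (Fin N) × ℝ × EuclideanSpace ℝ (Fin p) ×
    EuclideanSpace ℝ (Fin q) => ℓ z.1 z.2.1 z.2.2.1 z.2.2.2)
  bdd : ∀ x t u v, |ℓ x t u v| ≤ C
  lip : ∀ u ∈ U, ∀ v ∈ V, ∀ x, ∀ t ∈ Icc 0 T, ∀ t' ∈ Icc 0 T,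
    |ℓ x t u v - ℓ x t' u v| ≤ C * |t - t'|

/-- The indicator function of the complement of the closed ball of radius `R`. -/
def tail (R : ℝ) : EuclideanSpace ℝ (Fin N) → ℝ :=
  (Metric.closedBall 0 R)ᶜ.indicator fun _ => 1

theorem measurable_tail (R : ℝ) : Measurable (tail R : EuclideanSpace ℝ (Fin N) → ℝ) :=
  measurable_const.indicator Metric.isClosed_closedBall.measurableSet.compl

theorem tail_nonneg (R : ℝ) (x : EuclideanSpace ℝ (Fin N)) : 0 ≤ tail R x :=
  indicator_nonneg (fun _ _ => zero_le_one) x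

theorem abs_tail_le (R : ℝ) (x : EuclideanSpace ℝ (Fin N)) : |tail R x| ≤ 1 := by
  rw [abs_of_nonneg (tail_nonneg R x)]
  exact indicator_le' (fun _ _ => le_rfl) (fun _ _ => zero_le_one) x

theorem integrable_of_abs_le {X : Type*} [MeasurableSpace X] {μ : Measure X} [IsFiniteMeasure μ]
    {f : X → ℝ} (hf : Measurable f) {C : ℝ} (h : ∀ x, |f x| ≤ C) : Integrable f μ :=
  Integrable.of_bound hf.aestronglyMeasurable C (ae_of_all _ h)

theorem abs_integral_le_of_abs_le {X : Type*} [MeasurableSpace X] {μ : Measure X}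
    [IsProbabilityMeasure μ] {f : X → ℝ} {C : ℝ} (h : ∀ᵐ x ∂μ, |f x| ≤ C) :
    |∫ x, f x ∂μ| ≤ C := by
  simpa using norm_integral_le_of_norm_le_const (μ := μ) (f := f) h

theorem tendsto_integral_tail (μ : Measure (EuclideanSpace ℝ (Fin N))) [IsFiniteMeasure μ] :
    Tendsto (fun n : ℕ => ∫ x, tail n x ∂μ) atTop (𝓝 0) := by
  have h : Tendsto (fun n : ℕ => ∫ x, tail n x ∂μ) atTop
      (𝓝 (∫ _ : EuclideanSpace ℝ (Fin N), (0 : ℝ) ∂μ)) := by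
    refine tendsto_integral_of_dominated_convergence (fun _ => 1)
      (fun n => (measurable_tail _).aestronglyMeasurable) (integrable_const _)
      (fun n => ae_of_all _ (abs_tail_le _)) (ae_of_all _ fun x => ?_)
    refine tendsto_const_nhds.congr' ?_
    filter_upwards [eventually_ge_atTop ⌈‖x‖⌉₊] with n hn
    refine (indicator_of_notMem ?_ _).symm
    simpa using Nat.ceil_le.1 hn
  simpa using h

/-- Two integrals of bounded functions which are close on a ball differ by little if the measure
puts little mass outside the ball. -/
theorem abs_integral_sub_integral_le {μ : Measure (EuclideanSpace ℝ (Fin N))}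
    [IsProbabilityMeasure μ] {f g : EuclideanSpace ℝ (Fin N) → ℝ} {C ε R : ℝ}
    (hf : Measurable f) (hg : Measurable g) (hε : 0 ≤ ε) (hfC : ∀ x, |f x| ≤ C)
    (hgC : ∀ x, |g x| ≤ C) (h : ∀ x, ‖x‖ ≤ R → |f x - g x| ≤ ε) :
    |∫ x, f x ∂μ - ∫ x, g x ∂μ| ≤ ε + 2 * C * ∫ x, tail R x ∂μ := by
  have hC : 0 ≤ C := (abs_nonneg _).trans (hfC 0)
  have hif : Integrable f μ := integrable_of_abs_le hf hfC
  have hig : Integrable g μ := integrable_of_abs_le hg hgC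
  have hI : Integrable (tail R) μ := integrable_of_abs_le (measurable_tail R) (abs_tail_le R)
  rw [← integral_sub hif hig, ← integral_const_mul]
  have e : ε = ∫ _, ε ∂μ := by simp
  conv_rhs => rw [e]
  rw [← integral_add (integrable_const _) (hI.const_mul _)]
  refine abs_integral_le_integral_abs.trans (integral_mono (hif.sub hig).abs
    ((integrable_const _).add (hI.const_mul _)) fun x => ?_)
  by_cases hx : ‖x‖ ≤ R
  · have := mul_nonneg (mul_nonneg zero_le_two hC) (tail_nonneg R x)
    have := h x hx
    simp only
    linarith
  · have hx' : x ∈ (Metric.closedBall (0 : EuclideanSpace ℝ (Fin N)) R)ᶜ := by simpa using hx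
    simp only [tail, indicator_of_mem hx']
    have := abs_sub (f x) (g x)
    have := hfC x
    have := hgC x
    linarith

/-- Uniformly on a ball, a family of functions depending continuously on a parameter in a compact
set is approximated by finitely many of its members. -/
theorem exists_finset_forall_abs_sub_le {W : Type*} [TopologicalSpace W]
    {f : EuclideanSpace ℝ (Fin N) → W → ℝ} (hf : Continuous (Function.uncurry f))
    {k : Set W} (hk : IsCompact k) (R : ℝ) {ε : ℝ} (hε : 0 < ε) :
    ∃ J : Finset W, ∀ w ∈ k, ∃ j ∈ J, ∀ x, ‖x‖ ≤ R → |f x w - f x j| ≤ ε := by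
  have hB : IsCompact (Metric.closedBall (0 : EuclideanSpace ℝ (Fin N)) R) :=
    isCompact_closedBall _ _
  have hloc : ∀ j ∈ k, {w | ∀ x ∈ Metric.closedBall (0 : EuclideanSpace ℝ (Fin N)) R,
      |f x w - f x j| ≤ ε} ∈ 𝓝[k] j := by
    intro j _
    refine mem_nhdsWithin_of_mem_nhds (hB.eventually_forall_of_forall_eventually
      (P := fun w x => |f x w - f x j| ≤ ε) fun x _ => ?_)
    have hc : Continuous fun z : W × EuclideanSpace ℝ (Fin N) => |f z.2 z.1 - f z.2 j| :=
      ((hf.comp continuous_swap).sub (hf.comp (continuous_snd.prodMk continuous_const))).abs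
    have := hc.tendsto (j, x)
    simp only [sub_self, abs_zero] at this
    exact this.eventually (eventually_le_nhds hε)
  obtain ⟨J, -, hJ⟩ := hk.elim_nhdsWithin_subcover _ hloc
  refine ⟨J, fun w hw => ?_⟩
  obtain ⟨j, hj, hwj⟩ := mem_iUnion₂.1 (hJ hw)
  exact ⟨j, hj, fun x hx => hwj x (by simpa using hx)⟩

namespace IsRegularCost

variable {T : ℝ} {U : NonemptyCompacts (EuclideanSpace ℝ (Fin p))}
  {V : NonemptyCompacts (EuclideanSpace ℝ (Fin q))}
  {ℓ : EuclideanSpace ℝ (Fin N) → ℝ → EuclideanSpace ℝ (Fin p) →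
      EuclideanSpace ℝ (Fin q) → ℝ} {C : ℝ}

theorem const_nonneg (h : IsRegularCost T U V ℓ C) : 0 ≤ C :=
  (abs_nonneg _).trans (h.bdd 0 0 0 0)

theorem measurable (h : IsRegularCost T U V ℓ C) (t : ℝ) (u : EuclideanSpace ℝ (Fin p))
    (v : EuclideanSpace ℝ (Fin q)) : Measurable fun x => ℓ x t u v :=
  (h.cont.comp (continuous_id.prodMk
    (continuous_const (y := ((t, u, v) : ℝ × _ × _))))).measurable

theorem integrable (h : IsRegularCost T U V ℓ C) (t : ℝ) (u : EuclideanSpace ℝ (Fin p))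
    (v : EuclideanSpace ℝ (Fin q)) (μ : Measure (EuclideanSpace ℝ (Fin N))) [IsFiniteMeasure μ] :
    Integrable (fun x => ℓ x t u v) μ :=
  integrable_of_abs_le (h.measurable t u v) fun x => h.bdd x t u v

theorem continuous_average (h : IsRegularCost T U V ℓ C)
    (μ : Measure (EuclideanSpace ℝ (Fin N))) [IsFiniteMeasure μ] :
    Continuous fun w : ℝ × EuclideanSpace ℝ (Fin p) × EuclideanSpace ℝ (Fin q) =>
      ∫ x, ℓ x w.1 w.2.1 w.2.2 ∂μ :=
  continuous_of_dominated (bound := fun _ => C)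
    (fun _ => (h.measurable _ _ _).aestronglyMeasurable)
    (fun _ => ae_of_all _ fun _ => h.bdd _ _ _ _)
    (integrable_const _)
    (ae_of_all _ fun x => h.cont.comp (Continuous.prodMk_right x))

theorem continuous_average_uncurry (h : IsRegularCost T U V ℓ C) (t : ℝ)
    (μ : Measure (EuclideanSpace ℝ (Fin N))) [IsFiniteMeasure μ] :
    Continuous (Function.uncurry fun (u : U) (v : V) => ∫ x, ℓ x t u v ∂μ) :=
  (h.continuous_average μ).comp (by fun_prop : Continuous fun w : U × V =>
    (t, (w.1 : EuclideanSpace ℝ (Fin p)), (w.2 : EuclideanSpace ℝ (Fin q))))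

theorem abs_average_sub_le (h : IsRegularCost T U V ℓ C) {t t' : ℝ} (ht : t ∈ Icc 0 T)
    (ht' : t' ∈ Icc 0 T) {u : EuclideanSpace ℝ (Fin p)} (hu : u ∈ U)
    {v : EuclideanSpace ℝ (Fin q)} (hv : v ∈ V)
    (μ : Measure (EuclideanSpace ℝ (Fin N))) [IsProbabilityMeasure μ] :
    |∫ x, ℓ x t u v ∂μ - ∫ x, ℓ x t' u v ∂μ| ≤ C * |t - t'| := by
  rw [← integral_sub (h.integrable _ _ _ μ) (h.integrable _ _ _ μ)]
  exact abs_integral_le_of_abs_le (ae_of_all _ fun x => h.lip u hu v hv x t ht t' ht')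

/-- The averages of the cost against two beliefs are uniformly close as soon as finitely many
integrals are. -/
theorem exists_finset_abs_average_sub_le (h : IsRegularCost T U V ℓ C) (R : ℝ) {ε : ℝ}
    (hε : 0 < ε) :
    ∃ J : Finset (ℝ × EuclideanSpace ℝ (Fin p) × EuclideanSpace ℝ (Fin q)),
      ∀ t ∈ Icc 0 T, ∀ u ∈ U, ∀ v ∈ V, ∀ μ ν : Measure (EuclideanSpace ℝ (Fin N)),
        IsProbabilityMeasure μ → IsProbabilityMeasure ν →
        |∫ x, ℓ x t u v ∂μ - ∫ x, ℓ x t u v ∂ν| ≤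
          2 * ε + 2 * C * (∫ x, tail R x ∂μ + ∫ x, tail R x ∂ν) +
            ∑ j ∈ J, |∫ x, ℓ x j.1 j.2.1 j.2.2 ∂μ - ∫ x, ℓ x j.1 j.2.1 j.2.2 ∂ν| := by
  obtain ⟨J, hJ⟩ := exists_finset_forall_abs_sub_le (W := ℝ × EuclideanSpace ℝ (Fin p) ×
    EuclideanSpace ℝ (Fin q)) (f := fun x w => ℓ x w.1 w.2.1 w.2.2) h.cont
    ((isCompact_Icc (a := 0) (b := T)).prod (U.isCompact.prod V.isCompact)) R hε
  refine ⟨J, fun t ht u hu v hv μ ν hμ hν => ?_⟩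
  obtain ⟨j, hj, hjx⟩ := hJ (t, u, v) ⟨ht, hu, hv⟩
  have h1 := abs_integral_sub_integral_le (μ := μ) (h.measurable t u v)
    (h.measurable j.1 j.2.1 j.2.2) hε.le (fun x => h.bdd _ _ _ _) (fun x => h.bdd _ _ _ _) hjx
  have h2 := abs_integral_sub_integral_le (μ := ν) (h.measurable t u v)
    (h.measurable j.1 j.2.1 j.2.2) hε.le (fun x => h.bdd _ _ _ _) (fun x => h.bdd _ _ _ _) hjx
  have h3 := Finset.single_le_sum (f := fun j : ℝ × EuclideanSpace ℝ (Fin p) ×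
    EuclideanSpace ℝ (Fin q) => |∫ x, ℓ x j.1 j.2.1 j.2.2 ∂μ - ∫ x, ℓ x j.1 j.2.1 j.2.2 ∂ν|)
    (fun _ _ => abs_nonneg _) hj
  rw [abs_le] at h1 h2
  have h4 := le_abs_self (∫ x, ℓ x j.1 j.2.1 j.2.2 ∂μ - ∫ x, ℓ x j.1 j.2.1 j.2.2 ∂ν)
  have h5 := neg_abs_le (∫ x, ℓ x j.1 j.2.1 j.2.2 ∂μ - ∫ x, ℓ x j.1 j.2.1 j.2.2 ∂ν)
  rw [abs_le]
  constructor <;> linarith [h1.1, h1.2, h2.1, h2.2]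

theorem hamiltonian_le_add (h : IsRegularCost T U V ℓ C) {t t' D : ℝ}
    {μ ν : Measure (EuclideanSpace ℝ (Fin N))} [IsFiniteMeasure μ] [IsFiniteMeasure ν]
    (hD : ∀ u ∈ U, ∀ v ∈ V, ∫ x, ℓ x t u v ∂μ ≤ ∫ x, ℓ x t' u v ∂ν + D) :
    hamiltonian U V ℓ t μ ≤ hamiltonian U V ℓ t' ν + D :=
  iInf_iSup_le_add (h.continuous_average_uncurry t μ) (h.continuous_average_uncurry t' ν)
    fun u v => hD u u.2 v v.2

theorem hamiltonian_le_add_time (h : IsRegularCost T U V ℓ C) {t t' : ℝ} (ht : t ∈ Icc 0 T)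
    (ht' : t' ∈ Icc 0 T) (μ : Measure (EuclideanSpace ℝ (Fin N))) [IsProbabilityMeasure μ] :
    hamiltonian U V ℓ t μ ≤ hamiltonian U V ℓ t' μ + C * |t - t'| :=
  h.hamiltonian_le_add fun u hu v hv => by
    have := (abs_le.1 (h.abs_average_sub_le ht ht' hu hv μ)).2
    linarith

theorem abs_hamiltonian_le (h : IsRegularCost T U V ℓ C) (t : ℝ)
    (μ : Measure (EuclideanSpace ℝ (Fin N))) [IsProbabilityMeasure μ] :
    |hamiltonian U V ℓ t μ| ≤ C := by
  have hb : ∀ (u : U) (v : V), |∫ x, ℓ x t u v ∂μ| ≤ C := fun u v =>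
    abs_integral_le_of_abs_le (ae_of_all _ fun x => h.bdd x t u v)
  have hs : ∀ u : U, |⨆ v : V, ∫ x, ℓ x t u v ∂μ| ≤ C := fun u => by
    obtain ⟨v⟩ : Nonempty V := inferInstance
    refine abs_le.2 ⟨?_, ciSup_le fun v => (abs_le.1 (hb u v)).2⟩
    exact (abs_le.1 (hb u v)).1.trans
      (le_ciSup (f := fun v : V => ∫ x, ℓ x t u v ∂μ)
        ⟨C, by rintro _ ⟨v, rfl⟩; exact (abs_le.1 (hb u v)).2⟩ v)
  obtain ⟨u⟩ : Nonempty U := inferInstance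
  refine abs_le.2 ⟨le_ciInf fun u => (abs_le.1 (hs u)).1, ?_⟩
  exact (ciInf_le (f := fun u : U => ⨆ v : V, ∫ x, ℓ x t u v ∂μ)
    ⟨-C, by rintro _ ⟨u, rfl⟩; exact (abs_le.1 (hs u)).1⟩ u).trans (abs_le.1 (hs u)).2

/-- The Hamiltonian is a measurable function of the belief, among probability measures. -/
theorem exists_measurable_eq_hamiltonian (h : IsRegularCost T U V ℓ C) (t : ℝ) :
    ∃ g : Measure (EuclideanSpace ℝ (Fin N)) → ℝ, Measurable g ∧
      ∀ μ, IsProbabilityMeasure μ → g μ = hamiltonian U V ℓ t μ :=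
  ⟨fun μ => ⨅ i, ⨆ j, ∫ x, ℓ x t (denseSeq U i) (denseSeq V j) ∂μ,
    Measurable.iInf fun _ => Measurable.iSup fun _ => measurable_integral_measure
      (h.measurable _ _ _),
    fun μ _ => iInf_iSup_denseSeq_eq (h.continuous_average_uncurry t μ)⟩

/-- Measurable `ε`-optimal answers of the minimising player. -/
theorem exists_measurable_minimizer (h : IsRegularCost T U V ℓ C) (t : ℝ) {ε : ℝ} (hε : 0 < ε) :
    ∃ sel : Measure (EuclideanSpace ℝ (Fin N)) → ℕ, Measurable sel ∧
      ∀ μ, IsProbabilityMeasure μ → ∀ v ∈ V,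
        ∫ x, ℓ x t (denseSeq U (sel μ)) v ∂μ ≤ hamiltonian U V ℓ t μ + ε := by
  obtain ⟨sel, hsel, hlt⟩ := exists_measurable_index_lt_iInf_add
    (f := fun i (μ : Measure (EuclideanSpace ℝ (Fin N))) =>
      ⨆ j, ∫ x, ℓ x t (denseSeq U i) (denseSeq V j) ∂μ)
    (fun i => Measurable.iSup fun _ => measurable_integral_measure (h.measurable _ _ _)) hε
  refine ⟨sel, hsel, fun μ hμ v hv => ?_⟩
  have hlt := hlt μ
  rw [iInf_iSup_denseSeq_eq (h.continuous_average_uncurry t μ)] at hlt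
  have hc : Continuous fun v : V => ∫ x, ℓ x t (denseSeq U (sel μ)) v ∂μ :=
    (h.continuous_average_uncurry t μ).comp (Continuous.prodMk_right (denseSeq U (sel μ)))
  rw [iSup_denseSeq_eq hc] at hlt
  exact (le_ciSup (isCompact_range hc).bddAbove (⟨v, hv⟩ : V)).trans hlt.le

/-- Measurable `ε`-optimal answers of the maximising player, where Isaacs' condition holds. -/
theorem exists_measurable_maximizer (h : IsRegularCost T U V ℓ C) (t : ℝ) {ε : ℝ} (hε : 0 < ε) :
    ∃ sel : Measure (EuclideanSpace ℝ (Fin N)) → ℕ, Measurable sel ∧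
      ∀ μ, IsProbabilityMeasure μ → IsaacsAt U V ℓ t μ → ∀ u ∈ U,
        hamiltonian U V ℓ t μ - ε ≤ ∫ x, ℓ x t u (denseSeq V (sel μ)) ∂μ := by
  obtain ⟨sel, hsel, hlt⟩ := exists_measurable_index_lt_iInf_add
    (f := fun j (μ : Measure (EuclideanSpace ℝ (Fin N))) =>
      ⨆ i, -∫ x, ℓ x t (denseSeq U i) (denseSeq V j) ∂μ)
    (fun i => Measurable.iSup fun _ =>
      (measurable_integral_measure (h.measurable _ _ _)).neg) hε
  refine ⟨sel, hsel, fun μ hμ hI u hu => ?_⟩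
  have hlt := hlt μ
  have hc := ((h.continuous_average_uncurry t μ).comp continuous_swap).neg
  rw [iInf_iSup_denseSeq_eq (a := fun (v : V) (u : U) => -∫ x, ℓ x t u v ∂μ) hc] at hlt
  have hc' : Continuous fun u : U => -∫ x, ℓ x t u (denseSeq V (sel μ)) ∂μ :=
    hc.comp (Continuous.prodMk_right (denseSeq V (sel μ)))
  rw [iSup_denseSeq_eq hc'] at hlt
  have hle := (le_ciSup (isCompact_range hc').bddAbove (⟨u, hu⟩ : U)).trans hlt.le
  have hH : hamiltonian U V ℓ t μ = -⨅ v : V, ⨆ u : U, -∫ x, ℓ x t u v ∂μ := by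
    rw [← iSup_neg_eq]
    exact hI.trans (iSup_congr fun v => by rw [iSup_neg_eq, neg_neg])
  linarith

end IsRegularCost

end Cost

/-! ### The space of controls -/

section ControlSpace

variable {d : ℕ} {K : NonemptyCompacts (EuclideanSpace ℝ (Fin d))} {t₀ T : ℝ}

theorem Control.exists_subseq_ae_tendsto {u : ℕ → Control K t₀ T} {w : Control K t₀ T}
    (h : Tendsto u atTop (𝓝 w)) : ∃ φ : ℕ → ℕ, StrictMono φ ∧
      ∀ᵐ s ∂(volume.restrict (Icc t₀ T)), Tendsto (fun n => u (φ n) s) atTop (𝓝 (w s)) :=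
  (tendstoInMeasure_of_tendsto_Lp
    ((continuous_subtype_val.tendsto _).comp h)).exists_seq_tendsto_ae

instance : PolishSpace (Control K t₀ T) := by
  have : Fact ((1 : ENNReal) ≠ ⊤) := ⟨ENNReal.one_ne_top⟩
  have : SecondCountableTopology
      (Lp (EuclideanSpace ℝ (Fin d)) 1 (volume.restrict (Icc t₀ T))) := Lp.SecondCountableTopology
  refine IsClosed.polishSpace (s := {u : Lp (EuclideanSpace ℝ (Fin d)) 1
    (volume.restrict (Icc t₀ T)) | ∀ᵐ s ∂(volume.restrict (Icc t₀ T)), u s ∈ K}) ?_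
  refine IsSeqClosed.isClosed fun u w hu hw => ?_
  obtain ⟨φ, -, hφ⟩ := (tendstoInMeasure_of_tendsto_Lp hw).exists_seq_tendsto_ae
  filter_upwards [hφ, ae_all_iff.2 fun n => hu (φ n)] with s hs hK
  exact K.isCompact.isClosed.mem_of_tendsto hs (Eventually.of_forall hK)

theorem memLp_one_of_ae_mem {f : ℝ → EuclideanSpace ℝ (Fin d)} (hf : Measurable f)
    (hK : ∀ᵐ s ∂(volume.restrict (Icc t₀ T)), f s ∈ K) :
    MemLp f 1 (volume.restrict (Icc t₀ T)) := by
  obtain ⟨C, hC⟩ := K.isCompact.isBounded.exists_norm_le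
  exact MemLp.of_bound hf.aestronglyMeasurable C (hK.mono fun s hs => hC _ hs)

/-- A measurable function with values in `K`, seen as a control. -/
def Control.mk (f : ℝ → EuclideanSpace ℝ (Fin d)) (hf : Measurable f)
    (hK : ∀ᵐ s ∂(volume.restrict (Icc t₀ T)), f s ∈ K) : Control K t₀ T :=
  ⟨(memLp_one_of_ae_mem hf hK).toLp f, by
    filter_upwards [(memLp_one_of_ae_mem hf hK).coeFn_toLp, hK] with s hs hsK
    rwa [hs]⟩

theorem Control.coeFn_mk {f : ℝ → EuclideanSpace ℝ (Fin d)} (hf : Measurable f)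
    (hK : ∀ᵐ s ∂(volume.restrict (Icc t₀ T)), f s ∈ K) :
    Control.mk (t₀ := t₀) (T := T) f hf hK =ᵐ[volume.restrict (Icc t₀ T)] f :=
  (memLp_one_of_ae_mem hf hK).coeFn_toLp

theorem Control.measurable_coe (u : Control K t₀ T) : Measurable u :=
  (Lp.stronglyMeasurable u.1).measurable

namespace AgreeUpTo

variable {s t : ℝ} {u v w : Control K t₀ T}

theorem symm (h : AgreeUpTo t u v) : AgreeUpTo t v u :=
  h.mono fun _ h' hs => (h' hs).symm

theorem trans (h : AgreeUpTo t u v) (h' : AgreeUpTo t v w) : AgreeUpTo t u w := by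
  filter_upwards [h, h'] with s hs hs' hst
  rw [hs hst, hs' hst]

theorem mono (h : AgreeUpTo t u v) (hst : s ≤ t) : AgreeUpTo s u v :=
  Eventually.mono h fun _ h' hs => h' (hs.trans hst)

end AgreeUpTo

/-- The control `u` stopped at time `t`: it agrees with `u` up to time `t` and has a fixed value in
`K` afterwards. -/
def Control.trunc (t : ℝ) (u : Control K t₀ T) : Control K t₀ T :=
  Control.mk (fun s => if s ≤ t then u s else denseSeq K 0)
    (Measurable.ite measurableSet_Iic u.measurable_coe measurable_const) (by
      filter_upwards [u.2] with s hs
      split_ifs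
      · exact hs
      · exact (denseSeq K 0).2)

theorem Control.coeFn_trunc (t : ℝ) (u : Control K t₀ T) :
    Control.trunc t u =ᵐ[volume.restrict (Icc t₀ T)]
      fun s => if s ≤ t then u s else denseSeq K 0 :=
  Control.coeFn_mk _ _

theorem Control.agreeUpTo_trunc (t : ℝ) (u : Control K t₀ T) :
    AgreeUpTo t (Control.trunc t u) u := by
  filter_upwards [Control.coeFn_trunc t u] with s hs hst
  rw [hs, if_pos hst]

theorem Control.trunc_eq_trunc {t : ℝ} {u v : Control K t₀ T} (h : AgreeUpTo t u v) :
    Control.trunc t u = Control.trunc t v := by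
  apply Subtype.ext
  apply Lp.ext
  filter_upwards [Control.coeFn_trunc t u, Control.coeFn_trunc t v, h] with s hu hv hs
  rw [hu, hv]
  split_ifs with hst
  · exact hs hst
  · rfl

theorem Control.trunc_trunc {s t : ℝ} (hst : s ≤ t) (u : Control K t₀ T) :
    Control.trunc s (Control.trunc t u) = Control.trunc s u :=
  Control.trunc_eq_trunc ((Control.agreeUpTo_trunc t u).mono hst)

theorem Control.continuous_trunc (t : ℝ) :
    Continuous (Control.trunc t : Control K t₀ T → Control K t₀ T) := by
  refine LipschitzWith.continuous (K := 1) (LipschitzWith.of_dist_le_mul fun u v => ?_)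
  rw [NNReal.coe_one, one_mul]
  change dist (Control.trunc t u).1 (Control.trunc t v).1 ≤ dist u.1 v.1
  rw [dist_eq_norm, dist_eq_norm]
  refine Lp.norm_le_norm_of_ae_le ?_
  filter_upwards [Control.coeFn_trunc t u, Control.coeFn_trunc t v,
    Lp.coeFn_sub (Control.trunc t u).1 (Control.trunc t v).1, Lp.coeFn_sub u.1 v.1]
    with s hu hv h h'
  rw [h, h', Pi.sub_apply, Pi.sub_apply, hu, hv]
  split_ifs
  · exact le_rfl
  · simp

end ControlSpace

/-! ### Uniform time grids and piecewise constant controls -/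

section Grid

variable {t₀ T : ℝ} {n : ℕ}

/-- The points of the uniform grid which cuts `[t₀, T]` into `n + 1` intervals. -/
def gridPoint (t₀ T : ℝ) (n k : ℕ) : ℝ := t₀ + k * ((T - t₀) / (n + 1))

/-- The index of the grid interval `[gridPoint k, gridPoint (k + 1))` containing `s`; the last
interval also contains its right end point `T`. -/
def gridIndex (t₀ T : ℝ) (n : ℕ) (s : ℝ) : Fin (n + 1) :=
  ⟨min ⌊(s - t₀) / ((T - t₀) / (n + 1))⌋₊ n, Nat.lt_succ_of_le (min_le_right _ _)⟩

theorem measurable_gridIndex : Measurable (gridIndex t₀ T n) := by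
  have h : Measurable fun s : ℝ => ⌊(s - t₀) / ((T - t₀) / (n + 1))⌋₊ :=
    Nat.measurable_floor.comp (by fun_prop)
  exact (Measurable.of_discrete (f := fun j : ℕ =>
    (⟨min j n, Nat.lt_succ_of_le (min_le_right _ _)⟩ : Fin (n + 1)))).comp h

theorem gridPoint_zero : gridPoint t₀ T n 0 = t₀ := by simp [gridPoint]

theorem gridPoint_last : gridPoint t₀ T n (n + 1) = T := by
  rw [gridPoint]
  push_cast
  field_simp
  ring

theorem gridPoint_succ (k : ℕ) :
    gridPoint t₀ T n (k + 1) = gridPoint t₀ T n k + (T - t₀) / (n + 1) := by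
  simp only [gridPoint]
  push_cast
  ring

theorem mesh_pos (h : t₀ < T) : 0 < (T - t₀) / (n + 1) :=
  div_pos (sub_pos.2 h) (by positivity)

theorem monotone_gridPoint (h : t₀ < T) : Monotone (gridPoint t₀ T n) :=
  monotone_nat_of_le_succ fun k => by
    rw [gridPoint_succ]
    linarith [mesh_pos (n := n) h]

theorem gridPoint_mem (h : t₀ < T) {k : ℕ} (hk : k ≤ n + 1) :
    gridPoint t₀ T n k ∈ Icc t₀ T :=
  ⟨(gridPoint_zero (T := T) (n := n)).symm.le.trans (monotone_gridPoint h (Nat.zero_le k)),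
    (monotone_gridPoint h hk).trans gridPoint_last.le⟩

theorem le_floor_iff_gridPoint_le (h : t₀ < T) {s : ℝ} (hs : t₀ ≤ s) (k : ℕ) :
    k ≤ ⌊(s - t₀) / ((T - t₀) / (n + 1))⌋₊ ↔ gridPoint t₀ T n k ≤ s := by
  have hm := mesh_pos (n := n) h
  rw [Nat.le_floor_iff (div_nonneg (sub_nonneg.2 hs) hm.le), le_div_iff₀ hm, gridPoint]
  constructor <;> intro h <;> linarith

theorem gridIndex_le_iff (h : t₀ < T) {s : ℝ} (hs : t₀ ≤ s) {k : ℕ} (hk : k < n) :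
    (gridIndex t₀ T n s : ℕ) ≤ k ↔ s < gridPoint t₀ T n (k + 1) := by
  have := le_floor_iff_gridPoint_le (n := n) h hs (k + 1)
  simp only [gridIndex]
  rw [← not_le, ← this]
  omega

theorem le_gridIndex_iff (h : t₀ < T) {s : ℝ} (hs : t₀ ≤ s) {k : ℕ} (hk : k ≤ n) :
    k ≤ (gridIndex t₀ T n s : ℕ) ↔ gridPoint t₀ T n k ≤ s := by
  have := le_floor_iff_gridPoint_le (n := n) h hs k
  simp only [gridIndex]
  rw [← this]
  omega

theorem gridPoint_gridIndex_le (h : t₀ < T) {s : ℝ} (hs : t₀ ≤ s) :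
    gridPoint t₀ T n (gridIndex t₀ T n s) ≤ s :=
  (le_gridIndex_iff h hs (Nat.le_of_lt_succ (gridIndex t₀ T n s).2)).1 le_rfl

theorem le_gridPoint_gridIndex_succ (h : t₀ < T) {s : ℝ} (hs : s ∈ Icc t₀ T) :
    s ≤ gridPoint t₀ T n (gridIndex t₀ T n s + 1) := by
  rcases Nat.lt_or_ge (gridIndex t₀ T n s : ℕ) n with hk | hk
  · exact ((gridIndex_le_iff h hs.1 hk).1 le_rfl).le
  · have : (gridIndex t₀ T n s : ℕ) = n := le_antisymm (Nat.le_of_lt_succ (gridIndex t₀ T n s).2) hk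
    rw [this, gridPoint_last]
    exact hs.2

theorem gridIndex_le_of_lt (h : t₀ < T) {s : ℝ} (hs : t₀ ≤ s) {k : ℕ}
    (hk : s < gridPoint t₀ T n (k + 1)) : (gridIndex t₀ T n s : ℕ) ≤ k := by
  rcases Nat.lt_or_ge k n with hk' | hk'
  · exact (gridIndex_le_iff h hs hk').2 hk
  · exact (Nat.le_of_lt_succ (gridIndex t₀ T n s).2).trans hk'

theorem gridIndex_mono (h : t₀ < T) {s t : ℝ} (hs : t₀ ≤ s) (hst : s ≤ t) :
    (gridIndex t₀ T n s : ℕ) ≤ gridIndex t₀ T n t :=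
  (le_gridIndex_iff h (hs.trans hst) (Nat.le_of_lt_succ (gridIndex t₀ T n s).2)).2
    ((gridPoint_gridIndex_le h hs).trans hst)

/-- Strictly after `t`, the grid index keeps its value for some time. -/
theorem exists_gridIndex_eq_right (h : t₀ < T) {t : ℝ} (ht : t ∈ Icc t₀ T) :
    ∃ δ > 0, ∀ s, t ≤ s → s ≤ T → s ≤ t + δ → gridIndex t₀ T n s = gridIndex t₀ T n t := by
  rcases Nat.lt_or_ge (gridIndex t₀ T n t : ℕ) n with hk | hk
  · have hlt := (gridIndex_le_iff h ht.1 hk).1 le_rfl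
    refine ⟨(gridPoint t₀ T n (gridIndex t₀ T n t + 1) - t) / 2, by linarith, fun s hs _ hs' => ?_⟩
    refine Fin.ext (le_antisymm ?_ (gridIndex_mono h ht.1 hs))
    exact gridIndex_le_of_lt h (ht.1.trans hs) (by linarith)
  · refine ⟨1, one_pos, fun s hs _ _ => Fin.ext ?_⟩
    have h1 := gridIndex_mono (n := n) h ht.1 hs
    have h2 := (gridIndex t₀ T n s).2
    have h3 := (gridIndex t₀ T n t).2
    omega

/-- Strictly before `t`, the grid index is constant for some time. -/
theorem exists_gridIndex_eq_left (h : t₀ < T) {t : ℝ} (ht : t₀ < t) :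
    ∃ k, ∃ r < t, ∀ s, t₀ ≤ s → r < s → s < t → gridIndex t₀ T n s = k := by
  classical
  -- the largest index of a grid point strictly before `t`
  set k := Nat.findGreatest (fun k => gridPoint t₀ T n k < t) n with hk
  have hkn : k ≤ n := Nat.findGreatest_le n
  have hkt : gridPoint t₀ T n k < t :=
    Nat.findGreatest_spec (P := fun k => gridPoint t₀ T n k < t) (Nat.zero_le n)
      (by simpa only [gridPoint_zero] using ht)
  refine ⟨⟨k, Nat.lt_succ_of_le hkn⟩, gridPoint t₀ T n k, hkt, fun s hs hks hst => Fin.ext ?_⟩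
  refine le_antisymm ?_ ((le_gridIndex_iff h hs hkn).2 hks.le)
  rcases Nat.lt_or_ge k n with hlt | hge
  · refine gridIndex_le_of_lt h hs (hst.trans_le (not_lt.1 ?_))
    exact Nat.findGreatest_is_greatest (P := fun k => gridPoint t₀ T n k < t)
      (Nat.lt_succ_self _) hlt
  · exact (Nat.le_of_lt_succ (gridIndex t₀ T n s).2).trans hge

/-- The part of the line where the grid index is `k`. -/
def cell (t₀ T : ℝ) (n : ℕ) (k : Fin (n + 1)) : Set ℝ := gridIndex t₀ T n ⁻¹' {k}

theorem measurableSet_cell (k : Fin (n + 1)) : MeasurableSet (cell t₀ T n k) :=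
  measurable_gridIndex (measurableSet_singleton k)

theorem mem_Icc_of_mem_cell (h : t₀ < T) {k : Fin (n + 1)} {s : ℝ} (hs : s ∈ Icc t₀ T)
    (hk : s ∈ cell t₀ T n k) : s ∈ Icc (gridPoint t₀ T n k) (gridPoint t₀ T n (k + 1)) := by
  obtain rfl : gridIndex t₀ T n s = k := hk
  exact ⟨gridPoint_gridIndex_le h hs.1, le_gridPoint_gridIndex_succ h hs⟩

theorem measureReal_cell_le (h : t₀ < T) (k : Fin (n + 1)) :
    (volume.restrict (Icc t₀ T)).real (cell t₀ T n k) ≤ (T - t₀) / (n + 1) := by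
  rw [measureReal_restrict_apply (measurableSet_cell k)]
  calc volume.real (cell t₀ T n k ∩ Icc t₀ T)
      ≤ volume.real (Icc (gridPoint t₀ T n k) (gridPoint t₀ T n (k + 1))) :=
        measureReal_mono (fun s hs => mem_Icc_of_mem_cell h hs.2 hs.1) (by simp)
    _ = (T - t₀) / (n + 1) := by
        rw [Real.volume_real_Icc_of_le (monotone_gridPoint h (Nat.le_succ _)), gridPoint_succ]
        ring

theorem sum_setIntegral_cell {f : ℝ → ℝ} (hf : IntegrableOn f (Icc t₀ T)) :
    ∑ k, ∫ s in cell t₀ T n k, f s ∂(volume.restrict (Icc t₀ T)) = ∫ s in Icc t₀ T, f s := by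
  rw [← integral_iUnion_fintype (fun k => measurableSet_cell k) ?_ fun k => ?_]
  · have : ⋃ k, cell t₀ T n k = univ := by
      ext s; simp [cell]
    rw [this, Measure.restrict_univ]
  · intro i j hij
    exact Disjoint.preimage _ (by simpa using hij)
  · exact Integrable.integrableOn hf

theorem sum_measureReal_cell (ht : t₀ ≤ T) :
    ∑ k : Fin (n + 1), (volume.restrict (Icc t₀ T)).real (cell t₀ T n k) = T - t₀ := by
  have := sum_setIntegral_cell (n := n) (t₀ := t₀) (T := T) (f := fun _ => (1 : ℝ)) (by simp)
  simp only [setIntegral_const, smul_eq_mul, mul_one] at this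
  rw [this, Real.volume_real_Icc_of_le ht]

variable {d : ℕ} (K : NonemptyCompacts (EuclideanSpace ℝ (Fin d)))

/-- The piecewise constant control on the grid with values `denseSeq K (y k)`. -/
def stepControl (t₀ T : ℝ) (y : Fin (n + 1) → ℕ) : Control K t₀ T :=
  Control.mk (fun s => denseSeq K (y (gridIndex t₀ T n s)))
    ((Measurable.of_discrete (f := fun k => (denseSeq K (y k) : EuclideanSpace ℝ (Fin d)))).comp
      measurable_gridIndex)
    (ae_of_all _ fun _ => (denseSeq K _).2)

theorem coeFn_stepControl (y : Fin (n + 1) → ℕ) :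
    stepControl K t₀ T y =ᵐ[volume.restrict (Icc t₀ T)]
      fun s => denseSeq K (y (gridIndex t₀ T n s)) :=
  Control.coeFn_mk _ _

theorem agreeUpTo_stepControl {y y' : Fin (n + 1) → ℕ} {t : ℝ}
    (h : ∀ s ∈ Icc t₀ T, s < t → y (gridIndex t₀ T n s) = y' (gridIndex t₀ T n s)) :
    AgreeUpTo t (stepControl K t₀ T y) (stepControl K t₀ T y') := by
  have ht : ∀ᵐ s ∂(volume.restrict (Icc t₀ T)), s ≠ t :=
    ae_restrict_of_ae (by simp [ae_iff])
  filter_upwards [coeFn_stepControl K y, coeFn_stepControl K y',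
    ae_restrict_mem measurableSet_Icc, ht] with s hs hs' hmem hne hst
  rw [hs, hs', h s hmem (lt_of_le_of_ne hst hne)]

end Grid

/-! ### Strategies and their outcomes -/

section Strategies

variable {p q : ℕ} {U : NonemptyCompacts (EuclideanSpace ℝ (Fin p))}
  {V : NonemptyCompacts (EuclideanSpace ℝ (Fin q))} {t₀ T : ℝ} {Δ : Subdivision t₀ T}

theorem StrategyI.continuous_eval (v : Control V t₀ T) :
    Continuous fun α : StrategyI U V Δ => α.toFun v := by
  refine LipschitzWith.continuous (K := 1) fun α α' => ?_
  rw [ENNReal.coe_one, one_mul]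
  change _ ≤ edist (UniformFun.ofFun α.toFun) (UniformFun.ofFun α'.toFun)
  rw [UniformFun.edist_def]
  exact le_iSup (fun v => edist (α.toFun v) (α'.toFun v)) v

theorem StrategyII.continuous_eval (u : Control U t₀ T) :
    Continuous fun β : StrategyII U V t₀ T => β.toFun u := by
  refine LipschitzWith.continuous (K := 1) fun β β' => ?_
  rw [ENNReal.coe_one, one_mul]
  change _ ≤ edist (UniformFun.ofFun β.toFun) (UniformFun.ofFun β'.toFun)
  rw [UniformFun.edist_def]
  exact le_iSup (fun u => edist (β.toFun u) (β'.toFun u)) u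

variable {Z : Type*} [MeasurableSpace Z]

theorem measurable_strategyI_apply {α : Z → StrategyI U V Δ} (hα : StronglyMeasurable α)
    {v : Z → Control V t₀ T} (hv : Measurable v) : Measurable fun z => (α z).toFun (v z) := by
  refine measurable_of_tendsto_metrizable (f := fun n z => (hα.approx n z).toFun (v z))
    (fun n => ?_) (tendsto_pi_nhds.2 fun z => ?_)
  · exact (hα.approx n).measurable_bind (fun a z => a.toFun (v z))
      fun a => a.measurable_toFun.comp hv
  · exact ((StrategyI.continuous_eval (v z)).tendsto _).comp (hα.tendsto_approx z)

theorem measurable_strategyII_apply {β : Z → StrategyII U V t₀ T} (hβ : StronglyMeasurable β)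
    {u : Z → Control U t₀ T} (hu : Measurable u) : Measurable fun z => (β z).toFun (u z) := by
  refine measurable_of_tendsto_metrizable (f := fun n z => (hβ.approx n z).toFun (u z))
    (fun n => ?_) (tendsto_pi_nhds.2 fun z => ?_)
  · exact (hβ.approx n).measurable_bind (fun a z => a.toFun (u z))
      fun a => a.measurable_toFun.comp hu
  · exact ((StrategyII.continuous_eval (u z)).tendsto _).comp (hβ.tendsto_approx z)

theorem Subdivision.time_mem (Δ : Subdivision t₀ T) (i : Fin (Δ.n + 1)) : Δ.time i ∈ Icc t₀ T :=
  ⟨Δ.time_zero.symm.le.trans (Δ.strictMono.monotone (Fin.zero_le i)),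
    (Δ.strictMono.monotone (Fin.le_last i)).trans Δ.time_last.le⟩

/-- The outcome is reached after finitely many alternating replies. -/
theorem iterate_eq_outcome_fst (α : StrategyI U V Δ) (β : StrategyII U V t₀ T)
    (u : Control U t₀ T) : (fun u => α.toFun (β.toFun u))^[Δ.n] u = (outcome α β).1 := by
  obtain ⟨h₁, h₂⟩ := outcome_spec α β
  have key : ∀ i : Fin (Δ.n + 1), AgreeUpTo (Δ.time i)
      ((fun u => α.toFun (β.toFun u))^[i] u) (outcome α β).1 := by
    intro i
    induction i using Fin.induction with
    | zero => rw [Δ.time_zero]; exact agreeUpTo_start _ _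
    | succ i ih =>
      have h := α.delay i _ _ (β.nonanticipative _ (Δ.time_mem _) _ _ ih)
      rw [h₂, h₁] at h
      rw [Fin.val_succ, Function.iterate_succ_apply']
      exact h
  have h := key (Fin.last Δ.n)
  rw [Δ.time_last] at h
  exact eq_of_agreeUpTo_end h

theorem measurable_outcome_fst {α : Z → StrategyI U V Δ} (hα : StronglyMeasurable α)
    {β : Z → StrategyII U V t₀ T} (hβ : StronglyMeasurable β) :
    Measurable fun z => (outcome (α z) (β z)).1 := by
  obtain ⟨u₀⟩ : Nonempty (Control U t₀ T) := inferInstance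
  have h : ∀ i : ℕ, Measurable fun z => (fun u => (α z).toFun ((β z).toFun u))^[i] u₀ := by
    intro i
    induction i with
    | zero => exact measurable_const
    | succ i ih =>
      simp only [Function.iterate_succ_apply']
      exact measurable_strategyI_apply hα (measurable_strategyII_apply hβ ih)
  simpa only [iterate_eq_outcome_fst] using h Δ.n

theorem measurable_outcome {α : Z → StrategyI U V Δ} (hα : StronglyMeasurable α)
    {β : Z → StrategyII U V t₀ T} (hβ : StronglyMeasurable β) :
    Measurable fun z => outcome (α z) (β z) := by
  have h := measurable_outcome_fst hα hβ
  have h' := measurable_strategyII_apply hβ h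
  simp only [(outcome_spec _ _).2] at h'
  exact h.prodMk h'

/-- Up to time `t`, the outcome depends only on the behaviour of Player II up to time `t`. -/
theorem agreeUpTo_outcome_fst (α : StrategyI U V Δ) {β β' : StrategyII U V t₀ T} {t : ℝ}
    (ht : t ∈ Icc t₀ T) (h : ∀ u, AgreeUpTo t (β.toFun u) (β'.toFun u)) :
    AgreeUpTo t (outcome α β).1 (outcome α β').1 := by
  obtain ⟨h₁, h₂⟩ := outcome_spec α β
  obtain ⟨h₁', h₂'⟩ := outcome_spec α β'
  have key : ∀ i : Fin (Δ.n + 1), AgreeUpTo (min t (Δ.time i))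
      (outcome α β).1 (outcome α β').1 := by
    intro i
    induction i using Fin.induction with
    | zero =>
      rw [Δ.time_zero, min_eq_right ht.1]
      exact agreeUpTo_start _ _
    | succ i ih =>
      rcases le_total t (Δ.time i.castSucc) with hti | hti
      · rw [min_eq_left hti] at ih
        exact ih.mono (min_le_left _ _)
      · rw [min_eq_right hti] at ih
        have hv := (β.nonanticipative _ (Δ.time_mem _) _ _ ih).trans
          ((h (outcome α β').1).mono hti)
        have hu := α.delay i _ _ hv
        rw [h₂, h₁, h₂', h₁'] at hu
        exact hu.mono (min_le_right _ _)
  have := key (Fin.last Δ.n)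
  rwa [Δ.time_last, min_eq_left ht.2] at this

end Strategies

/-! ### The cost of a pair of controls -/

section RunningCost

variable {N p q : ℕ} {T t₀ C : ℝ} {U : NonemptyCompacts (EuclideanSpace ℝ (Fin p))}
  {V : NonemptyCompacts (EuclideanSpace ℝ (Fin q))}

/-- The cost of a pair of controls accumulated over the times in `S ∩ [t₀, T]`. -/
def runningCost (ℓ : EuclideanSpace ℝ (Fin N) → ℝ → EuclideanSpace ℝ (Fin p) →
    EuclideanSpace ℝ (Fin q) → ℝ) (S : Set ℝ) (x : EuclideanSpace ℝ (Fin N))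
    (u : Control U t₀ T) (v : Control V t₀ T) : ℝ :=
  ∫ s in S, ℓ x s (u s) (v s) ∂(volume.restrict (Icc t₀ T))

variable {ℓ : EuclideanSpace ℝ (Fin N) → ℝ → EuclideanSpace ℝ (Fin p) →
    EuclideanSpace ℝ (Fin q) → ℝ}

theorem IsRegularCost.measurable_comp (h : IsRegularCost T U V ℓ C) (u : Control U t₀ T)
    (v : Control V t₀ T) :
    Measurable fun z : EuclideanSpace ℝ (Fin N) × ℝ => ℓ z.1 z.2 (u z.2) (v z.2) :=
  h.cont.measurable.comp (measurable_fst.prodMk (measurable_snd.prodMk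
    ((u.measurable_coe.comp measurable_snd).prodMk (v.measurable_coe.comp measurable_snd))))

theorem IsRegularCost.continuous_runningCost (h : IsRegularCost T U V ℓ C) (S : Set ℝ) :
    Continuous fun z : EuclideanSpace ℝ (Fin N) × Control U t₀ T × Control V t₀ T =>
      runningCost ℓ S z.1 z.2.1 z.2.2 := by
  rw [continuous_iff_seqContinuous]
  intro z w hz
  refine tendsto_of_subseq_tendsto fun ns hns => ?_
  have hz' := hz.comp hns
  obtain ⟨φ, hφ, hu⟩ := Control.exists_subseq_ae_tendsto
    ((continuous_fst.comp continuous_snd).tendsto _ |>.comp hz')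
  obtain ⟨ψ, hψ, hv⟩ := Control.exists_subseq_ae_tendsto
    (((continuous_snd.comp continuous_snd).tendsto _ |>.comp hz').comp hφ.tendsto_atTop)
  refine ⟨φ ∘ ψ, ?_⟩
  refine tendsto_integral_of_dominated_convergence (fun _ => C)
    (fun n => ((h.measurable_comp _ _).comp measurable_prodMk_left).aestronglyMeasurable)
    (integrable_const _) (fun n => ae_of_all _ fun s => h.bdd _ _ _ _) ?_
  filter_upwards [ae_restrict_of_ae hu, ae_restrict_of_ae hv] with s hus hvs
  have hx : Tendsto (fun n => (z (ns ((φ ∘ ψ) n))).1) atTop (𝓝 w.1) :=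
    ((continuous_fst.tendsto _).comp hz').comp (hφ.comp hψ).tendsto_atTop
  have := (h.cont.tendsto (w.1, s, w.2.1 s, w.2.2 s)).comp (hx.prodMk_nhds
    ((tendsto_const_nhds (x := s)).prodMk_nhds
      ((hus.comp hψ.tendsto_atTop).prodMk_nhds hvs)))
  exact this

theorem IsRegularCost.integrable_comp (h : IsRegularCost T U V ℓ C) (x : EuclideanSpace ℝ (Fin N))
    (u : Control U t₀ T) (v : Control V t₀ T) :
    IntegrableOn (fun s => ℓ x s (u s) (v s)) (Icc t₀ T) :=
  integrable_of_abs_le ((h.measurable_comp u v).comp measurable_prodMk_left)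
    fun _ => h.bdd _ _ _ _

theorem IsRegularCost.abs_runningCost_le (h : IsRegularCost T U V ℓ C) (ht : t₀ ≤ T) (S : Set ℝ)
    (x : EuclideanSpace ℝ (Fin N)) (u : Control U t₀ T) (v : Control V t₀ T) :
    |runningCost ℓ S x u v| ≤ C * (T - t₀) := by
  have h1 := norm_integral_le_of_norm_le_const (μ := (volume.restrict (Icc t₀ T)).restrict S)
    (f := fun s => ℓ x s (u s) (v s)) (C := C) (ae_of_all _ fun s => h.bdd _ _ _ _)
  refine h1.trans (mul_le_mul_of_nonneg_left ?_ h.const_nonneg)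
  calc _ ≤ (volume.restrict (Icc t₀ T)).real univ := by
        rw [measureReal_restrict_apply_univ]
        exact measureReal_mono (subset_univ _)
    _ = T - t₀ := by
        rw [measureReal_restrict_apply_univ, Real.volume_real_Icc_of_le ht]

theorem IsRegularCost.sum_runningCost_cell (h : IsRegularCost T U V ℓ C) (n : ℕ)
    (x : EuclideanSpace ℝ (Fin N)) (u : Control U t₀ T) (v : Control V t₀ T) :
    ∑ k, runningCost ℓ (cell t₀ T n k) x u v = runningCost ℓ univ x u v := by
  rw [runningCost, Measure.restrict_univ]
  exact sum_setIntegral_cell (h.integrable_comp x u v)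

theorem IsRegularCost.integral_runningCost (h : IsRegularCost T U V ℓ C) (S : Set ℝ)
    (u : Control U t₀ T) (v : Control V t₀ T) (μ : Measure (EuclideanSpace ℝ (Fin N)))
    [IsFiniteMeasure μ] : ∫ x, runningCost ℓ S x u v ∂μ =
      ∫ s in S, (∫ x, ℓ x s (u s) (v s) ∂μ) ∂(volume.restrict (Icc t₀ T)) :=
  integral_integral_swap (f := fun x s => ℓ x s (u s) (v s))
    (integrable_of_abs_le (h.measurable_comp u v) fun _ => h.bdd _ _ _ _)

end RunningCost

/-! ### Riemann sums of right continuous functions -/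

section RiemannSums

variable {t₀ T : ℝ}

/-- The Riemann sums with right end points of a bounded right continuous function converge to its
integral. -/
theorem tendsto_sum_cell_mul {h : ℝ → ℝ} {C : ℝ} (ht : t₀ < T)
    (hc : ∀ t ∈ Icc t₀ T, ContinuousWithinAt h (Icc t T) t) (hb : ∀ t ∈ Icc t₀ T, |h t| ≤ C) :
    IntegrableOn h (Icc t₀ T) ∧
      Tendsto (fun n : ℕ => ∑ k : Fin (n + 1), (volume.restrict (Icc t₀ T)).real (cell t₀ T n k) *
        h (gridPoint t₀ T n (k + 1))) atTop (𝓝 (∫ s in Icc t₀ T, h s)) := by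
  have hmeas : ∀ n : ℕ, Measurable fun s => h (gridPoint t₀ T n (gridIndex t₀ T n s + 1)) :=
    fun n => (Measurable.of_discrete (f := fun k : Fin (n + 1) =>
      h (gridPoint t₀ T n (k + 1)))).comp measurable_gridIndex
  have hmem : ∀ (n : ℕ) (k : Fin (n + 1)), gridPoint t₀ T n (k + 1) ∈ Icc t₀ T := fun n k =>
    gridPoint_mem ht (Nat.succ_le_of_lt k.2)
  have hmesh : Tendsto (fun n : ℕ => (T - t₀) / (n + 1)) atTop (𝓝 0) :=
    by
    simpa [div_eq_mul_inv] using
      (tendsto_one_div_add_atTop_nhds_zero_nat (𝕜 := ℝ)).const_mul (T - t₀)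
  have hlim : ∀ s ∈ Icc t₀ T, Tendsto (fun n : ℕ =>
      h (gridPoint t₀ T n (gridIndex t₀ T n s + 1))) atTop (𝓝 (h s)) := by
    intro s hs
    refine (hc s hs).tendsto.comp (tendsto_nhdsWithin_iff.2 ⟨?_, Eventually.of_forall fun n =>
      ⟨le_gridPoint_gridIndex_succ ht hs, (hmem n _).2⟩⟩)
    refine tendsto_of_tendsto_of_tendsto_of_le_of_le tendsto_const_nhds
      (by simpa using hmesh.const_add s) (fun n => le_gridPoint_gridIndex_succ ht hs) fun n => ?_
    simp only [gridPoint_succ]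
    linarith [gridPoint_gridIndex_le (n := n) ht hs.1]
  have hae : ∀ᵐ s ∂(volume.restrict (Icc t₀ T)), Tendsto (fun n : ℕ =>
      h (gridPoint t₀ T n (gridIndex t₀ T n s + 1))) atTop (𝓝 (h s)) := by
    filter_upwards [ae_restrict_mem measurableSet_Icc] with s hs using hlim s hs
  have hint : IntegrableOn h (Icc t₀ T) :=
    Integrable.of_bound (aestronglyMeasurable_of_tendsto_ae atTop
      (fun n => (hmeas n).aestronglyMeasurable) hae) C (by
        filter_upwards [ae_restrict_mem measurableSet_Icc] with s hs using hb s hs)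
  refine ⟨hint, ?_⟩
  have hsum : ∀ n : ℕ, ∑ k : Fin (n + 1), (volume.restrict (Icc t₀ T)).real (cell t₀ T n k) *
      h (gridPoint t₀ T n (k + 1)) =
      ∫ s in Icc t₀ T, h (gridPoint t₀ T n (gridIndex t₀ T n s + 1)) := by
    intro n
    rw [← sum_setIntegral_cell (n := n) (Integrable.of_bound (hmeas n).aestronglyMeasurable C
      (ae_of_all _ fun s => hb _ (hmem n _)))]
    refine Finset.sum_congr rfl fun k _ => ?_
    rw [setIntegral_congr_fun (g := fun _ => h (gridPoint t₀ T n (k + 1))) (measurableSet_cell k)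
      fun s hs => by
        obtain rfl : gridIndex t₀ T n s = k := hs
        rfl]
    rw [setIntegral_const, smul_eq_mul]
  simp_rw [hsum]
  exact tendsto_integral_of_dominated_convergence (fun _ => C)
    (fun n => (hmeas n).aestronglyMeasurable) (integrable_const _)
    (fun n => ae_of_all _ fun s => hb _ (hmem n _)) hae

end RiemannSums

/-! ### Measure-valued martingales -/

/-- Conditioning on a countably-valued random variable `Z` measurable for `𝓖`: if `L` is the
conditional law of `X` given `𝓖`, then `g(X, Z)` has the same expectation as `∫ g(x, Z) dL(x)`. -/
theorem integral_comp_eq_of_condLaw {N : ℕ} {Ω : Type*} {𝓖 mΩ : MeasurableSpace Ω}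
    {P : Measure Ω} [IsProbabilityMeasure P] {C : ℝ} {X : Ω → EuclideanSpace ℝ (Fin N)}
    (hX : Measurable X) (h𝓖 : 𝓖 ≤ mΩ)
    {L : Ω → Measure (EuclideanSpace ℝ (Fin N))} (hL : Measurable L)
    (hLp : ∀ᵐ ω ∂P, IsProbabilityMeasure (L ω))
    (hcond : ∀ f : EuclideanSpace ℝ (Fin N) → ℝ, Measurable f → (∃ C, ∀ x, |f x| ≤ C) →
      (fun ω => ∫ x, f x ∂(L ω)) =ᵐ[P] P[fun ω => f (X ω) | 𝓖])
    {ι : Type*} [Countable ι] [MeasurableSpace ι] [DiscreteMeasurableSpace ι] {Z : Ω → ι}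
    (hZ : Measurable[𝓖] Z) {g : EuclideanSpace ℝ (Fin N) → ι → ℝ}
    (hg : ∀ i, Measurable fun x => g x i) (hgC : ∀ x i, |g x i| ≤ C) :
    Integrable (fun ω => ∫ x, g x (Z ω) ∂(L ω)) P ∧
      ∫ ω, g (X ω) (Z ω) ∂P = ∫ ω, (∫ x, g x (Z ω) ∂(L ω)) ∂P := by
  have hZ' : Measurable Z := hZ.mono h𝓖 le_rfl
  have h1 : Integrable (fun ω => g (X ω) (Z ω)) P := by
    refine integrable_of_abs_le ?_ (fun ω => hgC _ _)
    exact (measurable_from_prod_countable_left (f := fun z : EuclideanSpace ℝ (Fin N) × ι =>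
      g z.1 z.2) hg).comp (hX.prodMk hZ')
  have h2 : Integrable (fun ω => ∫ x, g x (Z ω) ∂(L ω)) P := by
    refine Integrable.of_bound (C := C) (Measurable.aestronglyMeasurable ?_) ?_
    · exact (measurable_from_prod_countable_left
        (f := fun z : Measure (EuclideanSpace ℝ (Fin N)) × ι => ∫ x, g x z.2 ∂z.1)
        fun i => measurable_integral_measure (hg i)).comp (hL.prodMk hZ')
    · filter_upwards [hLp] with ω hω
      exact abs_integral_le_of_abs_le (ae_of_all _ fun x => hgC _ _)
  refine ⟨h2, ?_⟩
  have hU : ⋃ i, Z ⁻¹' {i} = univ := by ext; simp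
  have hm : ∀ i, MeasurableSet (Z ⁻¹' {i}) := fun i => hZ' (measurableSet_singleton i)
  have hd : Pairwise (Function.onFun Disjoint fun i => Z ⁻¹' {i}) := fun i j hij =>
    Disjoint.preimage _ (by simpa using hij)
  rw [← setIntegral_univ, ← setIntegral_univ (μ := P) (f := fun ω => ∫ x, g x (Z ω) ∂(L ω)), ← hU,
    integral_iUnion hm hd h1.integrableOn, integral_iUnion hm hd h2.integrableOn]
  refine tsum_congr fun i => ?_
  have e1 : ∫ ω in Z ⁻¹' {i}, g (X ω) (Z ω) ∂P = ∫ ω in Z ⁻¹' {i}, g (X ω) i ∂P :=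
    setIntegral_congr_fun (hm i) fun ω hω => by
      obtain rfl : Z ω = i := hω
      rfl
  have e2 : ∫ ω in Z ⁻¹' {i}, (∫ x, g x (Z ω) ∂(L ω)) ∂P =
      ∫ ω in Z ⁻¹' {i}, (∫ x, g x i ∂(L ω)) ∂P :=
    setIntegral_congr_fun (hm i) fun ω hω => by
      obtain rfl : Z ω = i := hω
      rfl
  rw [e1, e2, ← setIntegral_condExp (f := fun ω => g (X ω) i) h𝓖
    (integrable_of_abs_le ((hg i).comp hX) fun ω => hgC _ _)
    (hZ (measurableSet_singleton i))]
  refine integral_congr_ae (ae_restrict_of_ae ?_)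
  exact (hcond (fun x => g x i) (hg i) ⟨C, fun x => hgC x i⟩).symm

section MartingaleMeasure

variable {N p q : ℕ} {Ω : Type*} [mΩ : MeasurableSpace Ω] {P : Measure Ω} {t₀ T C : ℝ}
  {m : Measure (EuclideanSpace ℝ (Fin N))} {M : ℝ → Ω → Measure (EuclideanSpace ℝ (Fin N))}

theorem beliefSigma_le (h : ∀ t ∈ Icc t₀ T, Measurable (M t)) (t : ℝ) :
    beliefSigma P t₀ T M t ≤ mΩ := by
  refine (iInf₂_le (t + 1) (by simp)).trans (sup_le ?_ (iSup₂_le fun r hr => ?_))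
  · exact MeasurableSpace.generateFrom_le fun A hA => hA.1
  · exact (h r hr.1).comap_le

theorem measurable_beliefSigma {s t : ℝ} (hs : s ∈ Icc t₀ T) (hst : s ≤ t) :
    Measurable[beliefSigma P t₀ T M t] (M s) := by
  rw [measurable_iff_comap_le]
  refine le_iInf₂ fun r hr => le_sup_of_le_right ?_
  exact le_iSup₂ (f := fun r (_ : r ∈ Icc t₀ T ∩ Iic _) =>
    MeasurableSpace.comap (M r) inferInstance) s ⟨hs, hst.trans (le_of_lt hr)⟩

namespace IsMartingaleMeasure

theorem ae_isProbabilityMeasure [IsProbabilityMeasure P] (h : IsMartingaleMeasure P t₀ T m M)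
    {t : ℝ} (ht : t ∈ Icc t₀ T) : ∀ᵐ ω ∂P, IsProbabilityMeasure (M t ω) := by
  obtain ⟨X, -, -, hX⟩ := h.condLaw
  have h1 := hX t ht (fun _ => 1) measurable_const ⟨1, fun _ => by simp⟩
  rw [condExp_const (beliefSigma_le h.measurable t)] at h1
  filter_upwards [h1] with ω hω
  rw [integral_const, smul_eq_mul, mul_one, measureReal_def, ENNReal.toReal_eq_one_iff] at hω
  exact ⟨hω⟩

/-- Almost surely, the process has values in the probability measures at all times. -/
theorem ae_forall_isProbabilityMeasure [IsProbabilityMeasure P] (ht : t₀ < T)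
    (h : IsMartingaleMeasure P t₀ T m M) :
    ∀ᵐ ω ∂P, ∀ t ∈ Icc t₀ T, IsProbabilityMeasure (M t ω) := by
  have h1 : ∀ᵐ ω ∂P, ∀ r : ℚ, (r : ℝ) ∈ Icc t₀ T → IsProbabilityMeasure (M r ω) :=
    ae_all_iff.2 fun r => by
      by_cases hr : (r : ℝ) ∈ Icc t₀ T
      · filter_upwards [h.ae_isProbabilityMeasure hr] with ω hω _ using hω
      · exact ae_of_all _ fun ω hr' => absurd hr' hr
  filter_upwards [h1, h.ae_isProbabilityMeasure (right_mem_Icc.2 ht.le),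
    h.cadlag (fun _ => 1) measurable_const ⟨1, fun _ => by simp⟩] with ω hQ hT hc t htT
  rcases eq_or_lt_of_le htT.2 with rfl | hlt
  · exact hT
  have hone : ∫ _, (1 : ℝ) ∂(M t ω) = 1 := by
    have hcl : ∃ᶠ s in 𝓝[Icc t T] t, ∫ _, (1 : ℝ) ∂(M s ω) = 1 := by
      rw [frequently_nhdsWithin_iff]
      refine Metric.nhds_basis_ball.frequently_iff.2 fun δ hδ => ?_
      obtain ⟨r, hr1, hr2⟩ := exists_rat_btwn (lt_min hlt (lt_add_of_pos_right t hδ))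
      have hrT : (r : ℝ) ∈ Icc t T := ⟨hr1.le, (hr2.trans_le (min_le_left _ _)).le⟩
      have := hQ r ⟨htT.1.trans hrT.1, hrT.2⟩
      refine ⟨r, ?_, by simp, hrT⟩
      rw [Metric.mem_ball, Real.dist_eq, abs_of_pos (sub_pos.2 hr1)]
      linarith [hr2.trans_le (min_le_right _ _)]
    exact isClosed_singleton.mem_of_frequently_of_tendsto hcl (hc t htT).1
  rw [integral_const, smul_eq_mul, mul_one, measureReal_def, ENNReal.toReal_eq_one_iff] at hone
  exact ⟨hone⟩

variable {U : NonemptyCompacts (EuclideanSpace ℝ (Fin p))}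
  {V : NonemptyCompacts (EuclideanSpace ℝ (Fin q))}
  {ℓ : EuclideanSpace ℝ (Fin N) → ℝ → EuclideanSpace ℝ (Fin p) →
      EuclideanSpace ℝ (Fin q) → ℝ}

/-- Almost surely, `s ↦ H(s, M_s)` is right continuous. -/
theorem ae_continuousWithinAt_hamiltonian [IsProbabilityMeasure P] (ht₀ : 0 ≤ t₀) (ht : t₀ < T)
    (hℓ : IsRegularCost T U V ℓ C) (h : IsMartingaleMeasure P t₀ T m M) :
    ∀ᵐ ω ∂P, ∀ t ∈ Icc t₀ T,
      ContinuousWithinAt (fun s => hamiltonian U V ℓ s (M s ω)) (Icc t T) t := by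
  choose J hJ using fun n : ℕ => hℓ.exists_finset_abs_average_sub_le n
    (ε := 1 / ((n : ℝ) + 1)) (by positivity)
  have htail : ∀ᵐ ω ∂P, ∀ n : ℕ, IsCadlagOn (fun t => ∫ x, tail n x ∂(M t ω)) t₀ T :=
    ae_all_iff.2 fun n => h.cadlag _ (measurable_tail _) ⟨1, abs_tail_le _⟩
  have htest : ∀ᵐ ω ∂P, ∀ n : ℕ, ∀ j ∈ J n,
      IsCadlagOn (fun t => ∫ x, ℓ x j.1 j.2.1 j.2.2 ∂(M t ω)) t₀ T := by
    refine ae_all_iff.2 fun n => ?_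
    rw [Finset.eventually_all]
    exact fun j _ => h.cadlag _ (hℓ.measurable _ _ _) ⟨C, fun x => hℓ.bdd _ _ _ _⟩
  filter_upwards [htail, htest, h.ae_forall_isProbabilityMeasure ht] with ω hta hte hp t htT
  have := hp t htT
  -- A bound of `|H(s, M_s) - H(t, M_t)|` by finitely many test integrals.
  set D : ℕ → ℝ → ℝ := fun n s => 2 * (1 / ((n : ℝ) + 1)) +
    2 * C * (∫ x, tail n x ∂(M s ω) + ∫ x, tail n x ∂(M t ω)) +
    ∑ j ∈ J n, |∫ x, ℓ x j.1 j.2.1 j.2.2 ∂(M s ω) - ∫ x, ℓ x j.1 j.2.1 j.2.2 ∂(M t ω)| +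
    C * |s - t| with hD
  have hle : ∀ n, ∀ s ∈ Icc t T,
      |hamiltonian U V ℓ s (M s ω) - hamiltonian U V ℓ t (M t ω)| ≤ D n s := by
    intro n s hs
    have hs' : s ∈ Icc t₀ T := ⟨htT.1.trans hs.1, hs.2⟩
    have hs0 : s ∈ Icc 0 T := ⟨ht₀.trans hs'.1, hs.2⟩
    have ht0 : t ∈ Icc 0 T := ⟨ht₀.trans htT.1, htT.2⟩
    have := hp s hs'
    have key : ∀ u ∈ U, ∀ v ∈ V,
        |∫ x, ℓ x s u v ∂(M s ω) - ∫ x, ℓ x t u v ∂(M t ω)| ≤ D n s := by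
      intro u hu v hv
      have h1 := hJ n s hs0 u hu v hv (M s ω) (M t ω) inferInstance inferInstance
      have h2 := hℓ.abs_average_sub_le hs0 ht0 hu hv (M t ω)
      have h3 := abs_sub_le (∫ x, ℓ x s u v ∂(M s ω)) (∫ x, ℓ x s u v ∂(M t ω))
        (∫ x, ℓ x t u v ∂(M t ω))
      simp only [hD]
      linarith
    have h1 : hamiltonian U V ℓ s (M s ω) ≤ hamiltonian U V ℓ t (M t ω) + D n s :=
      hℓ.hamiltonian_le_add fun u hu v hv => by linarith [(abs_le.1 (key u hu v hv)).2]
    have h2 : hamiltonian U V ℓ t (M t ω) ≤ hamiltonian U V ℓ s (M s ω) + D n s :=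
      hℓ.hamiltonian_le_add fun u hu v hv => by linarith [(abs_le.1 (key u hu v hv)).1]
    rw [abs_le]
    constructor <;> linarith
  have hDlim : ∀ n, Tendsto (D n) (𝓝[Icc t T] t)
      (𝓝 (2 * (1 / ((n : ℝ) + 1)) + 4 * C * ∫ x, tail n x ∂(M t ω))) := by
    intro n
    have h1 := (hta n t htT).1.tendsto
    have h2 : ∀ j ∈ J n, Tendsto (fun s => |∫ x, ℓ x j.1 j.2.1 j.2.2 ∂(M s ω) -
        ∫ x, ℓ x j.1 j.2.1 j.2.2 ∂(M t ω)|) (𝓝[Icc t T] t) (𝓝 0) := by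
      intro j hj
      have := ((hte n j hj t htT).1.tendsto.sub_const
        (∫ x, ℓ x j.1 j.2.1 j.2.2 ∂(M t ω))).abs
      simpa using this
    have h3 := tendsto_finsetSum _ h2
    have h4 : Tendsto (fun s : ℝ => C * |s - t|) (𝓝[Icc t T] t) (𝓝 0) := by
      have : Continuous fun s : ℝ => C * |s - t| := by fun_prop
      simpa using (this.tendsto t).mono_left nhdsWithin_le_nhds
    have h5 := (((h1.add_const (∫ x, tail n x ∂(M t ω))).const_mul (2 * C)).const_add
      (2 * (1 / ((n : ℝ) + 1)))).add h3 |>.add h4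
    refine h5.congr' EventuallyEq.rfl |>.trans (le_of_eq ?_)
    congr 1
    simp
    ring
  have hsmall : Tendsto (fun n : ℕ => 2 * (1 / ((n : ℝ) + 1)) + 4 * C * ∫ x, tail n x ∂(M t ω))
      atTop (𝓝 0) := by
    simpa using (tendsto_one_div_add_atTop_nhds_zero_nat.const_mul 2).add
      ((tendsto_integral_tail (M t ω)).const_mul (4 * C))
  rw [ContinuousWithinAt, Metric.tendsto_nhds]
  intro η hη
  obtain ⟨n, hn⟩ := (hsmall.eventually (gt_mem_nhds hη)).exists
  filter_upwards [(hDlim n).eventually (gt_mem_nhds hn), self_mem_nhdsWithin] with s hs hsT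
  exact (hle n s hsT).trans_lt hs

theorem integrable_hamiltonian [IsProbabilityMeasure P]
    (hℓ : IsRegularCost T U V ℓ C) (h : IsMartingaleMeasure P t₀ T m M) {t : ℝ}
    (ht : t ∈ Icc t₀ T) : Integrable (fun ω => hamiltonian U V ℓ t (M t ω)) P := by
  obtain ⟨g, hg, hgH⟩ := hℓ.exists_measurable_eq_hamiltonian t
  refine Integrable.of_bound (C := C) ⟨fun ω => g (M t ω),
    (hg.comp (h.measurable t ht)).stronglyMeasurable, ?_⟩ ?_
  · filter_upwards [h.ae_isProbabilityMeasure ht] with ω hω using (hgH _ hω).symm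
  · filter_upwards [h.ae_isProbabilityMeasure ht] with ω hω using hℓ.abs_hamiltonian_le _ _

/-- The value of a measure-valued martingale is the limit of its discretisations. -/
theorem tendsto_sum_integral_hamiltonian [IsProbabilityMeasure P] (ht₀ : 0 ≤ t₀) (ht : t₀ < T)
    (hℓ : IsRegularCost T U V ℓ C) (h : IsMartingaleMeasure P t₀ T m M) :
    Integrable (fun ω => ∫ s in Icc t₀ T, hamiltonian U V ℓ s (M s ω)) P ∧
    Tendsto (fun n : ℕ => ∑ k : Fin (n + 1), (volume.restrict (Icc t₀ T)).real (cell t₀ T n k) *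
        ∫ ω, hamiltonian U V ℓ (gridPoint t₀ T n (k + 1)) (M (gridPoint t₀ T n (k + 1)) ω) ∂P)
      atTop (𝓝 (∫ ω, (∫ s in Icc t₀ T, hamiltonian U V ℓ s (M s ω)) ∂P)) := by
  have hmem : ∀ (n : ℕ) (k : Fin (n + 1)), gridPoint t₀ T n (k + 1) ∈ Icc t₀ T := fun n k =>
    gridPoint_mem ht (Nat.succ_le_of_lt k.2)
  set R : ℕ → Ω → ℝ := fun n ω => ∑ k : Fin (n + 1),
    (volume.restrict (Icc t₀ T)).real (cell t₀ T n k) *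
      hamiltonian U V ℓ (gridPoint t₀ T n (k + 1)) (M (gridPoint t₀ T n (k + 1)) ω)
  have hRi : ∀ n, Integrable (R n) P := fun n => integrable_finsetSum _ fun k _ =>
    (h.integrable_hamiltonian hℓ (hmem n k)).const_mul _
  have hlim : ∀ᵐ ω ∂P, Tendsto (fun n => R n ω) atTop
      (𝓝 (∫ s in Icc t₀ T, hamiltonian U V ℓ s (M s ω))) := by
    filter_upwards [h.ae_continuousWithinAt_hamiltonian ht₀ ht hℓ,
      h.ae_forall_isProbabilityMeasure ht] with ω hω hp
    exact (tendsto_sum_cell_mul ht hω fun t htT => by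
      have := hp t htT
      exact hℓ.abs_hamiltonian_le _ _).2
  have hRb : ∀ n, ∀ᵐ ω ∂P, ‖R n ω‖ ≤ C * (T - t₀) := by
    intro n
    filter_upwards [h.ae_forall_isProbabilityMeasure ht] with ω hp
    rw [← sum_measureReal_cell (n := n) ht.le, Finset.mul_sum]
    refine (norm_sum_le _ _).trans (Finset.sum_le_sum fun k _ => ?_)
    have := hp _ (hmem n k)
    rw [norm_mul, Real.norm_of_nonneg measureReal_nonneg, mul_comm]
    exact mul_le_mul_of_nonneg_right (hℓ.abs_hamiltonian_le _ _) measureReal_nonneg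
  have hmeas := aestronglyMeasurable_of_tendsto_ae atTop
    (fun n => (hRi n).aestronglyMeasurable) hlim
  constructor
  · refine Integrable.of_bound hmeas (C * (T - t₀)) ?_
    filter_upwards [hlim, ae_all_iff.2 hRb] with ω hω hb
    exact le_of_tendsto hω.norm (Eventually.of_forall hb)
  · have := tendsto_integral_of_dominated_convergence (fun _ => C * (T - t₀))
      (fun n => (hRi n).aestronglyMeasurable) (integrable_const _) hRb hlim
    refine this.congr fun n => ?_
    rw [integral_finsetSum _ fun k _ => (h.integrable_hamiltonian hℓ (hmem n k)).const_mul _]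
    simp only [integral_const_mul]

end IsMartingaleMeasure

end MartingaleMeasure

/-! ### Random variables on sufficiently large probability spaces -/

section SufficientlyLarge

open ProbabilityTheory

variable {Ω : Type*} [MeasurableSpace Ω] {P : Measure Ω}

theorem SufficientlyLarge.exists_map_eq_volume_unitInterval (hP : SufficientlyLarge P) :
    ∃ ξ : Ω → unitInterval, Measurable ξ ∧ P.map ξ = volume := by
  obtain ⟨ξ, hξ, hlaw⟩ := hP
  have hproj : Measurable (projIcc (0 : ℝ) 1 zero_le_one) := continuous_projIcc.measurable
  refine ⟨fun ω => projIcc 0 1 zero_le_one (ξ ω), hproj.comp hξ, ?_⟩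
  have h1 : P.map (fun ω => projIcc (0 : ℝ) 1 zero_le_one (ξ ω)) =
      (P.map ξ).map (projIcc 0 1 zero_le_one) := (Measure.map_map hproj hξ).symm
  rw [h1, hlaw]
  have h2 : (volume : Measure unitInterval).map Subtype.val = volume.restrict (Icc (0 : ℝ) 1) :=
    map_comap_subtype_coe measurableSet_Icc volume
  rw [← h2, Measure.map_map hproj measurable_subtype_coe]
  have h3 : projIcc (0 : ℝ) 1 zero_le_one ∘ Subtype.val = id := by
    funext x
    exact projIcc_val _ x
  rw [h3, Measure.map_id]

theorem SufficientlyLarge.exists_map_eq (hP : SufficientlyLarge P) {S : Type*} [MeasurableSpace S]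
    [StandardBorelSpace S] [Nonempty S] (Q : Measure S) [IsProbabilityMeasure Q] :
    ∃ ζ : Ω → S, Measurable ζ ∧ P.map ζ = Q := by
  obtain ⟨ξ, hξ, hlaw⟩ := hP.exists_map_eq_volume_unitInterval
  obtain ⟨f, hf, hfQ⟩ := Measure.exists_measurable_map_eq Q
  refine ⟨f ∘ ξ, hf.comp hξ, ?_⟩
  rw [← Measure.map_map hf hξ, hlaw, hfQ]

/-- A player who observes `x` and has an independent uniform random variable at hand can complete
`x` to a pair with prescribed joint law. -/
theorem SufficientlyLarge.exists_map_prodMk_eq [SFinite P] (hP : SufficientlyLarge P) {E S : Type*}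
    [MeasurableSpace E] [MeasurableSpace S] [StandardBorelSpace S] [Nonempty S]
    (R : Measure (E × S)) [IsProbabilityMeasure R] :
    ∃ φ : E × Ω → S, Measurable φ ∧ (R.fst.prod P).map (fun z => (z.1, φ z)) = R := by
  obtain ⟨ξ, hξ, hlaw⟩ := hP.exists_map_eq_volume_unitInterval
  obtain ⟨f, hf, hfκ⟩ := Kernel.exists_measurable_map_eq_unitInterval R.condKernel
  have hφ : Measurable fun z : E × Ω => f z.1 (ξ z.2) :=
    hf.comp (measurable_fst.prodMk (hξ.comp measurable_snd))
  refine ⟨fun z => f z.1 (ξ z.2), hφ, ?_⟩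
  conv_rhs => rw [← R.disintegrate R.condKernel]
  ext A hA
  have hφ' : Measurable fun z : E × Ω => (z.1, f z.1 (ξ z.2)) := measurable_fst.prodMk hφ
  rw [Measure.map_apply hφ' hA, Measure.prod_apply (hφ' hA), Measure.compProd_apply hA]
  refine lintegral_congr fun x => ?_
  have hfx : Measurable (f x) := hf.of_uncurry_left
  rw [← hfκ x, ← hlaw, Measure.map_map hfx hξ,
    Measure.map_apply (hfx.comp hξ) (measurable_prodMk_left hA)]
  rfl

end SufficientlyLarge

/-! ### The payoff of random strategies -/

section Payoff

theorem integral_prod_prod_eq {E Ω₁ Ω₂ : Type*} [MeasurableSpace E] [MeasurableSpace Ω₁]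
    [MeasurableSpace Ω₂] {m : Measure E} {P₁ : Measure Ω₁} {P₂ : Measure Ω₂} [SFinite m]
    [SFinite P₁] [SFinite P₂] {G : E × Ω₁ × Ω₂ → ℝ} (hG : Integrable G (m.prod (P₁.prod P₂))) :
    Integrable (fun ω₂ => ∫ z : E × Ω₁, G (z.1, z.2, ω₂) ∂(m.prod P₁)) P₂ ∧
      ∫ z, G z ∂(m.prod (P₁.prod P₂)) =
        ∫ ω₂, (∫ z : E × Ω₁, G (z.1, z.2, ω₂) ∂(m.prod P₁)) ∂P₂ := by
  have hmp := measurePreserving_prodAssoc m P₁ P₂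
  have hi : Integrable (fun z : (E × Ω₁) × Ω₂ => G (z.1.1, z.1.2, z.2)) ((m.prod P₁).prod P₂) :=
    hmp.integrable_comp_of_integrable hG
  refine ⟨hi.integral_prod_right, ?_⟩
  rw [← hmp.integral_comp' (f := MeasurableEquiv.prodAssoc) G]
  exact integral_prod_symm _ hi

variable {N p q : ℕ} {T t₀ C : ℝ} {U : NonemptyCompacts (EuclideanSpace ℝ (Fin p))}
  {V : NonemptyCompacts (EuclideanSpace ℝ (Fin q))}
  {ℓ : EuclideanSpace ℝ (Fin N) → ℝ → EuclideanSpace ℝ (Fin p) →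
    EuclideanSpace ℝ (Fin q) → ℝ}
  {Ω₁ Ω₂ : Type*} [MeasurableSpace Ω₁] [MeasurableSpace Ω₂]
  {P₁ : Measure Ω₁} {P₂ : Measure Ω₂} [IsProbabilityMeasure P₁] [IsProbabilityMeasure P₂]
  {m : Measure (EuclideanSpace ℝ (Fin N))} [IsProbabilityMeasure m]

theorem integral_eq_runningCost (ht : t₀ ≤ T) (x : EuclideanSpace ℝ (Fin N))
    (u : Control U t₀ T) (v : Control V t₀ T) :
    ∫ s in t₀..T, ℓ x s (u s) (v s) = runningCost ℓ univ x u v := by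
  rw [intervalIntegral.integral_of_le ht, ← integral_Icc_eq_integral_Ioc, runningCost,
    Measure.restrict_univ]

theorem IsRegularCost.payoff_eq (h : IsRegularCost T U V ℓ C) (ht : t₀ ≤ T)
    (α : RandomStrategyI U V t₀ T N Ω₁) (β : RandomStrategyII U V t₀ T Ω₂) :
    Integrable (fun ω₂ => ∫ z, runningCost ℓ univ z.1 (outcome (α.toFun z) (β.toFun ω₂)).1
      (outcome (α.toFun z) (β.toFun ω₂)).2 ∂(m.prod P₁)) P₂ ∧
    payoff ℓ P₁ P₂ m α β = ∫ ω₂, (∫ z, runningCost ℓ univ z.1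
      (outcome (α.toFun z) (β.toFun ω₂)).1 (outcome (α.toFun z) (β.toFun ω₂)).2
      ∂(m.prod P₁)) ∂P₂ := by
  simp only [payoff, integral_eq_runningCost ht]
  refine integral_prod_prod_eq (G := fun z : EuclideanSpace ℝ (Fin N) × Ω₁ × Ω₂ =>
    runningCost ℓ univ z.1 (outcome (α.toFun (z.1, z.2.1)) (β.toFun z.2.2)).1
      (outcome (α.toFun (z.1, z.2.1)) (β.toFun z.2.2)).2) ?_
  refine integrable_of_abs_le ?_ fun z => h.abs_runningCost_le ht _ _ _ _
  refine (h.continuous_runningCost univ).measurable.comp (measurable_fst.prodMk ?_)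
  exact measurable_outcome
    (α.stronglyMeasurable_toFun.comp_measurable
      (measurable_fst.prodMk (measurable_fst.comp measurable_snd)))
    (β.stronglyMeasurable_toFun.comp_measurable (measurable_snd.comp measurable_snd))

theorem IsRegularCost.abs_payoff_le (h : IsRegularCost T U V ℓ C) (ht : t₀ ≤ T)
    (α : RandomStrategyI U V t₀ T N Ω₁) (β : RandomStrategyII U V t₀ T Ω₂) :
    |payoff ℓ P₁ P₂ m α β| ≤ C * (T - t₀) := by
  simp only [payoff, integral_eq_runningCost ht]
  exact abs_integral_le_of_abs_le (ae_of_all _ fun z => h.abs_runningCost_le ht _ _ _ _)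

theorem runningCost_cell_congr (ht : t₀ < T) {n : ℕ} {k : Fin (n + 1)}
    {x : EuclideanSpace ℝ (Fin N)} {u u' : Control U t₀ T} {v v' : Control V t₀ T}
    (hu : AgreeUpTo (gridPoint t₀ T n (k + 1)) u u')
    (hv : AgreeUpTo (gridPoint t₀ T n (k + 1)) v v') :
    runningCost ℓ (cell t₀ T n k) x u v = runningCost ℓ (cell t₀ T n k) x u' v' := by
  refine integral_congr_ae ?_
  filter_upwards [ae_restrict_of_ae hu, ae_restrict_of_ae hv,
    ae_restrict_of_ae (ae_restrict_mem measurableSet_Icc),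
    ae_restrict_mem (measurableSet_cell k)] with s hus hvs hs hk
  have hle := (mem_Icc_of_mem_cell ht hs hk).2
  rw [hus hle, hvs hle]

end Payoff

/-! ### Playing a measure-valued martingale -/

section InformedPlayer

variable {N p q : ℕ} {T t₀ C : ℝ} {U : NonemptyCompacts (EuclideanSpace ℝ (Fin p))}
  {V : NonemptyCompacts (EuclideanSpace ℝ (Fin q))}
  {ℓ : EuclideanSpace ℝ (Fin N) → ℝ → EuclideanSpace ℝ (Fin p) →
    EuclideanSpace ℝ (Fin q) → ℝ}
  {Ω₁ Ω₂ Ω : Type*} [MeasurableSpace Ω₁] [MeasurableSpace Ω₂] [MeasurableSpace Ω]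
  {P₁ : Measure Ω₁} {P₂ : Measure Ω₂} {P : Measure Ω} [IsProbabilityMeasure P₁]
  [IsProbabilityMeasure P₂] [IsProbabilityMeasure P]
  {m : Measure (EuclideanSpace ℝ (Fin N))}

/-- The subdivision of `[t₀, T]` into a single interval. -/
def Subdivision.single (ht : t₀ < T) : Subdivision t₀ T where
  n := 1
  time := ![t₀, T]
  strictMono := by
    rw [Fin.strictMono_iff_lt_succ]
    intro i
    fin_cases i
    simpa using ht
  time_zero := rfl
  time_last := rfl

/-- The strategy of Player I which plays the control `u` whatever Player II does. -/
def StrategyI.const (V : NonemptyCompacts (EuclideanSpace ℝ (Fin q))) (Δ : Subdivision t₀ T)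
    (u : Control U t₀ T) : StrategyI U V Δ where
  toFun _ := u
  measurable_toFun := measurable_const
  delay _ _ _ _ := ae_of_all _ fun _ _ => rfl

theorem outcome_const (Δ : Subdivision t₀ T) (u : Control U t₀ T) (β : StrategyII U V t₀ T) :
    outcome (StrategyI.const V Δ u) β = (u, β.toFun u) := by
  obtain ⟨h₁, h₂⟩ := outcome_spec (StrategyI.const V Δ u) β
  have h : u = (outcome (StrategyI.const V Δ u) β).1 := h₁
  exact Prod.ext h.symm (by rw [← h₂, ← h])

/-- The random open-loop strategy of Player I which plays the piecewise constant control with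
index sequence `φ (x, ω₁)`. -/
def RandomStrategyI.ofIndex (U : NonemptyCompacts (EuclideanSpace ℝ (Fin p)))
    (V : NonemptyCompacts (EuclideanSpace ℝ (Fin q))) (Δ : Subdivision t₀ T) {n : ℕ}
    (φ : EuclideanSpace ℝ (Fin N) × Ω₁ → Fin (n + 1) → ℕ) (hφ : Measurable φ) :
    RandomStrategyI U V t₀ T N Ω₁ where
  Δ := Δ
  toFun z := StrategyI.const V Δ (stepControl U t₀ T (φ z))
  stronglyMeasurable_toFun := (StronglyMeasurable.of_discrete
    (f := fun y : Fin (n + 1) → ℕ => StrategyI.const V Δ (stepControl U t₀ T y))).comp_measurable hφ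

/-- The cost over one grid interval when Player I plays an answer to the belief `M` at the right
end point of the interval, and the reply `v` of Player II is nonanticipative. -/
theorem IsRegularCost.integral_runningCost_cell_le {M : ℝ → Ω → Measure (EuclideanSpace ℝ (Fin N))}
    (hℓ : IsRegularCost T U V ℓ C) (ht₀ : 0 ≤ t₀) (ht : t₀ < T)
    (hM : ∀ t ∈ Icc t₀ T, Measurable (M t))
    (hMp : ∀ t ∈ Icc t₀ T, ∀ᵐ ω ∂P, IsProbabilityMeasure (M t ω))
    {X : Ω → EuclideanSpace ℝ (Fin N)} (hX : Measurable X)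
    (hcond : ∀ t ∈ Icc t₀ T, ∀ f : EuclideanSpace ℝ (Fin N) → ℝ, Measurable f →
      (∃ C, ∀ x, |f x| ≤ C) →
      (fun ω => ∫ x, f x ∂(M t ω)) =ᵐ[P] P[fun ω => f (X ω) | beliefSigma P t₀ T M t])
    {n : ℕ} {sel : ℕ → Measure (EuclideanSpace ℝ (Fin N)) → ℕ} (hsel : ∀ k, Measurable (sel k))
    {ε : ℝ} (hopt : ∀ k, ∀ μ, IsProbabilityMeasure μ → ∀ v ∈ V,
      ∫ x, ℓ x (gridPoint t₀ T n (k + 1)) (denseSeq U (sel k μ)) v ∂μ ≤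
        hamiltonian U V ℓ (gridPoint t₀ T n (k + 1)) μ + ε)
    {v : (Fin (n + 1) → ℕ) → Control V t₀ T} (k : Fin (n + 1))
    (hv : ∀ y y' : Fin (n + 1) → ℕ, (∀ i ≤ k, y i = y' i) →
      AgreeUpTo (gridPoint t₀ T n (k + 1)) (v y) (v y'))
    (hint : Integrable (fun ω => hamiltonian U V ℓ (gridPoint t₀ T n (k + 1))
      (M (gridPoint t₀ T n (k + 1)) ω)) P) :
    ∫ ω, runningCost ℓ (cell t₀ T n k) (X ω)
      (stepControl U t₀ T fun i : Fin (n + 1) => sel i (M (gridPoint t₀ T n (i + 1)) ω))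
      (v fun i => sel i (M (gridPoint t₀ T n (i + 1)) ω)) ∂P ≤
    (volume.restrict (Icc t₀ T)).real (cell t₀ T n k) *
      (∫ ω, hamiltonian U V ℓ (gridPoint t₀ T n (k + 1)) (M (gridPoint t₀ T n (k + 1)) ω) ∂P +
        (ε + C * ((T - t₀) / (n + 1)))) := by
  set t' := gridPoint t₀ T n (k + 1) with ht'
  have hmem : ∀ i : Fin (n + 1), gridPoint t₀ T n (i + 1) ∈ Icc t₀ T := fun i =>
    gridPoint_mem ht (Nat.succ_le_of_lt i.2)
  have ht'm : t' ∈ Icc t₀ T := hmem k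
  -- Only the indices chosen up to step `k` matter on the cell.
  set Z : Ω → Fin (n + 1) → ℕ := fun ω i =>
    if i ≤ k then sel i (M (gridPoint t₀ T n (i + 1)) ω) else 0 with hZ
  have hZm : Measurable[beliefSigma P t₀ T M t'] Z := by
    refine @measurable_pi_lambda _ _ _ (_) _ _ fun i => ?_
    by_cases hi : i ≤ k
    · simp only [hZ, hi, if_true]
      exact (hsel i).comp (measurable_beliefSigma (hmem i)
        (monotone_gridPoint ht (Nat.succ_le_succ hi)))
    · simp only [hZ, hi, if_false]
      exact measurable_const
  have hZeq : ∀ ω, ∀ i ≤ k, sel i (M (gridPoint t₀ T n (i + 1)) ω) = Z ω i := fun ω i hi => by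
    simp only [hZ, hi, if_true]
  have hrw : ∀ ω, runningCost ℓ (cell t₀ T n k) (X ω)
      (stepControl U t₀ T fun i : Fin (n + 1) => sel i (M (gridPoint t₀ T n (i + 1)) ω))
      (v fun i => sel i (M (gridPoint t₀ T n (i + 1)) ω)) =
      runningCost ℓ (cell t₀ T n k) (X ω) (stepControl U t₀ T (Z ω)) (v (Z ω)) := fun ω =>
    runningCost_cell_congr ht
      (agreeUpTo_stepControl U fun s hs hst => hZeq ω _ (gridIndex_le_of_lt ht hs.1 hst))
      (hv _ _ (hZeq ω))
  simp_rw [hrw]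
  obtain ⟨hi, heq⟩ := integral_comp_eq_of_condLaw hX (beliefSigma_le hM t') (hM t' ht'm)
    (hMp t' ht'm) (hcond t' ht'm) hZm
    (g := fun x z => runningCost ℓ (cell t₀ T n k) x (stepControl U t₀ T z) (v z))
    (C := C * (T - t₀))
    (fun z => ((hℓ.continuous_runningCost _).comp
      (Continuous.prodMk_left (stepControl U t₀ T z, v z))).measurable)
    (fun x z => hℓ.abs_runningCost_le ht.le _ _ _ _)
  rw [heq]
  set w := (volume.restrict (Icc t₀ T)).real (cell t₀ T n k)
  have hb : ∫ ω, (∫ x, runningCost ℓ (cell t₀ T n k) x (stepControl U t₀ T (Z ω)) (v (Z ω))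
      ∂(M t' ω)) ∂P ≤
      ∫ ω, w * (hamiltonian U V ℓ t' (M t' ω) + (ε + C * ((T - t₀) / (n + 1)))) ∂P := by
    refine integral_mono_ae hi ((hint.add (integrable_const _)).const_mul _) ?_
    filter_upwards [hMp t' ht'm] with ω hω
    rw [hℓ.integral_runningCost]
    have hconst : w * (hamiltonian U V ℓ t' (M t' ω) + (ε + C * ((T - t₀) / (n + 1)))) =
        ∫ _ in cell t₀ T n k, (hamiltonian U V ℓ t' (M t' ω) + (ε + C * ((T - t₀) / (n + 1))))
          ∂(volume.restrict (Icc t₀ T)) := by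
      rw [setIntegral_const, smul_eq_mul]
    rw [hconst]
    refine integral_mono_ae ?_ (integrable_const _) ?_
    · refine Integrable.integrableOn (integrable_of_abs_le (C := C)
        ((hℓ.continuous_average (M t' ω)).measurable.comp (measurable_id.prodMk
          ((Control.measurable_coe _).prodMk (Control.measurable_coe _)))) fun s => ?_)
      exact abs_integral_le_of_abs_le (ae_of_all _ fun x => hℓ.bdd _ _ _ _)
    · filter_upwards [ae_restrict_of_ae (coeFn_stepControl U (Z ω)),
        ae_restrict_of_ae (v (Z ω)).2, ae_restrict_of_ae (ae_restrict_mem measurableSet_Icc),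
        ae_restrict_mem (measurableSet_cell k)] with s hus hvs hs hk
      obtain rfl : gridIndex t₀ T n s = k := hk
      have hI := mem_Icc_of_mem_cell (k := gridIndex t₀ T n s) (n := n) ht hs rfl
      rw [hus, ← hZeq ω _ le_rfl]
      have h1 := hopt (gridIndex t₀ T n s) (M t' ω) hω _ hvs
      have h2 := (abs_le.1 (hℓ.abs_average_sub_le (t := s) (t' := t') ⟨ht₀.trans hs.1, hs.2⟩
        ⟨ht₀.trans ht'm.1, ht'm.2⟩
        (denseSeq U (sel (gridIndex t₀ T n s) (M t' ω))).2 hvs (M t' ω))).2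
      have h3 : |s - t'| ≤ (T - t₀) / (n + 1) := by
        rw [gridPoint_succ] at ht' hI
        rw [abs_le]
        constructor <;> linarith [hI.1, hI.2]
      have h4 := mul_le_mul_of_nonneg_left h3 hℓ.const_nonneg
      linarith
  refine hb.trans (le_of_eq ?_)
  rw [integral_const_mul, integral_add hint (integrable_const _)]
  simp

/-- Player I can realise a discretised measure-valued martingale. -/
theorem IsMartingaleMeasure.exists_strategy_payoff_le
    {M : ℝ → Ω → Measure (EuclideanSpace ℝ (Fin N))} (hP₁ : SufficientlyLarge P₁)
    (hℓ : IsRegularCost T U V ℓ C) (ht₀ : 0 ≤ t₀) (ht : t₀ < T)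
    (h : IsMartingaleMeasure P t₀ T m M) (n : ℕ) {ε : ℝ} (hε : 0 < ε) :
    ∃ α : RandomStrategyI U V t₀ T N Ω₁, ∀ β : RandomStrategyII U V t₀ T Ω₂,
      payoff ℓ P₁ P₂ m α β ≤
        ∑ k : Fin (n + 1), (volume.restrict (Icc t₀ T)).real (cell t₀ T n k) *
          (∫ ω, hamiltonian U V ℓ (gridPoint t₀ T n (k + 1)) (M (gridPoint t₀ T n (k + 1)) ω) ∂P +
            (ε + C * ((T - t₀) / (n + 1)))) := by
  obtain ⟨X, hX, hXm, hcond⟩ := h.condLaw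
  have : IsProbabilityMeasure m := hXm ▸ Measure.isProbabilityMeasure_map hX.aemeasurable
  have hmem : ∀ i : Fin (n + 1), gridPoint t₀ T n (i + 1) ∈ Icc t₀ T := fun i =>
    gridPoint_mem ht (Nat.succ_le_of_lt i.2)
  choose sel hsel hopt using fun k : ℕ =>
    hℓ.exists_measurable_minimizer (gridPoint t₀ T n (k + 1)) hε
  set Y : Ω → Fin (n + 1) → ℕ := fun ω i => sel i (M (gridPoint t₀ T n (i + 1)) ω) with hY
  have hYm : Measurable Y := measurable_pi_lambda _ fun i =>
    (hsel i).comp (h.measurable _ (hmem i))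
  have hR : IsProbabilityMeasure (P.map fun ω => (X ω, Y ω)) :=
    Measure.isProbabilityMeasure_map (hX.prodMk hYm).aemeasurable
  obtain ⟨φ, hφ, hlaw⟩ := hP₁.exists_map_prodMk_eq (P.map fun ω => (X ω, Y ω))
  rw [Measure.fst_map_prodMk hYm, hXm] at hlaw
  refine ⟨RandomStrategyI.ofIndex U V (Subdivision.single ht) φ hφ, fun β => ?_⟩
  obtain ⟨hint, heq⟩ := hℓ.payoff_eq (P₁ := P₁) (P₂ := P₂) (m := m) ht.le
    (RandomStrategyI.ofIndex U V (Subdivision.single ht) φ hφ) β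
  rw [heq]
  set B := ∑ k : Fin (n + 1), (volume.restrict (Icc t₀ T)).real (cell t₀ T n k) *
          (∫ ω, hamiltonian U V ℓ (gridPoint t₀ T n (k + 1)) (M (gridPoint t₀ T n (k + 1)) ω) ∂P +
            (ε + C * ((T - t₀) / (n + 1)))) with hB
  have key : ∀ ω₂, ∫ z, runningCost ℓ univ z.1 (outcome ((RandomStrategyI.ofIndex U V
      (Subdivision.single ht) φ hφ).toFun z) (β.toFun ω₂)).1 (outcome ((RandomStrategyI.ofIndex U V
      (Subdivision.single ht) φ hφ).toFun z) (β.toFun ω₂)).2 ∂(m.prod P₁) ≤ B := by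
    intro ω₂
    have hcost : ∀ S, Measurable fun z : EuclideanSpace ℝ (Fin N) × (Fin (n + 1) → ℕ) =>
        runningCost ℓ S z.1 (stepControl U t₀ T z.2)
          ((β.toFun ω₂).toFun (stepControl U t₀ T z.2)) := fun S =>
      (hℓ.continuous_runningCost S).measurable.comp (measurable_fst.prodMk
        ((Measurable.of_discrete (f := fun y : Fin (n + 1) → ℕ => (stepControl U t₀ T y,
          (β.toFun ω₂).toFun (stepControl U t₀ T y)))).comp measurable_snd))
    calc _ = ∫ z : EuclideanSpace ℝ (Fin N) × Ω₁, runningCost ℓ univ z.1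
          (stepControl U t₀ T (φ z)) ((β.toFun ω₂).toFun (stepControl U t₀ T (φ z)))
          ∂(m.prod P₁) := by
          refine integral_congr_ae (ae_of_all _ fun z => ?_)
          simp only [RandomStrategyI.ofIndex, outcome_const]
      _ = ∫ z, runningCost ℓ univ z.1 (stepControl U t₀ T z.2)
          ((β.toFun ω₂).toFun (stepControl U t₀ T z.2)) ∂(P.map fun ω => (X ω, Y ω)) := by
          rw [← hlaw, integral_map (measurable_fst.prodMk hφ).aemeasurable
            (hcost univ).aestronglyMeasurable]
      _ = ∫ ω, runningCost ℓ univ (X ω) (stepControl U t₀ T (Y ω))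
          ((β.toFun ω₂).toFun (stepControl U t₀ T (Y ω))) ∂P := by
          rw [integral_map (hX.prodMk hYm).aemeasurable (hcost univ).aestronglyMeasurable]
      _ = ∑ k : Fin (n + 1), ∫ ω, runningCost ℓ (cell t₀ T n k) (X ω) (stepControl U t₀ T (Y ω))
          ((β.toFun ω₂).toFun (stepControl U t₀ T (Y ω))) ∂P := by
          rw [← integral_finsetSum]
          · simp only [hℓ.sum_runningCost_cell]
          · exact fun k _ => integrable_of_abs_le ((hcost _).comp (hX.prodMk hYm))
              fun ω => hℓ.abs_runningCost_le ht.le _ _ _ _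
      _ ≤ B := by
          refine Finset.sum_le_sum fun k _ => ?_
          refine hℓ.integral_runningCost_cell_le ht₀ ht h.measurable
            (fun t ht => h.ae_isProbabilityMeasure ht) hX hcond hsel hopt
            (v := fun y => (β.toFun ω₂).toFun (stepControl U t₀ T y)) k (fun y y' hyy' => ?_)
            (h.integrable_hamiltonian hℓ (hmem k))
          refine (β.toFun ω₂).nonanticipative _ (hmem k) _ _ (agreeUpTo_stepControl U
            fun s hs hst => hyy' _ (gridIndex_le_of_lt ht hs.1 hst))
  exact (integral_mono hint (integrable_const B) key).trans (by simp)

/-- The upper value is at most the value of any measure-valued martingale. -/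
theorem IsMartingaleMeasure.upperValue_le [IsProbabilityMeasure m]
    {M : ℝ → Ω → Measure (EuclideanSpace ℝ (Fin N))} (hP₁ : SufficientlyLarge P₁)
    (hℓ : IsRegularCost T U V ℓ C) (ht₀ : 0 ≤ t₀) (ht : t₀ < T)
    (h : IsMartingaleMeasure P t₀ T m M) :
    upperValue U V T ℓ P₁ P₂ t₀ m ≤
      ∫ ω, (∫ s in Icc t₀ T, hamiltonian U V ℓ s (M s ω)) ∂P := by
  have hβ : Nonempty (RandomStrategyII U V t₀ T Ω₂) := by
    obtain ⟨v⟩ : Nonempty (Control V t₀ T) := inferInstance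
    exact ⟨⟨fun _ => ⟨fun _ => v, measurable_const, fun _ _ _ _ _ => ae_of_all _ fun _ _ => rfl,
      fun _ _ _ _ => ⟨1, one_pos, fun _ => ae_of_all _ fun _ _ => rfl⟩⟩,
      stronglyMeasurable_const⟩⟩
  have hsup : ∀ α : RandomStrategyI U V t₀ T N Ω₁,
      BddAbove (range fun β : RandomStrategyII U V t₀ T Ω₂ => payoff ℓ P₁ P₂ m α β) := fun α =>
    ⟨C * (T - t₀), by rintro _ ⟨β, rfl⟩; exact (abs_le.1 (hℓ.abs_payoff_le ht.le α β)).2⟩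
  have hinf : BddBelow (range fun α : RandomStrategyI U V t₀ T N Ω₁ =>
      ⨆ β : RandomStrategyII U V t₀ T Ω₂, payoff ℓ P₁ P₂ m α β) := by
    refine ⟨-(C * (T - t₀)), ?_⟩
    rintro _ ⟨α, rfl⟩
    exact (abs_le.1 (hℓ.abs_payoff_le ht.le α hβ.some)).1.trans (le_ciSup (hsup α) _)
  have hw : ∀ n : ℕ, ∑ k : Fin (n + 1), (volume.restrict (Icc t₀ T)).real (cell t₀ T n k) =
      T - t₀ := fun n => sum_measureReal_cell ht.le
  have hle : ∀ n : ℕ, upperValue U V T ℓ P₁ P₂ t₀ m ≤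
      ∑ k : Fin (n + 1), (volume.restrict (Icc t₀ T)).real (cell t₀ T n k) *
        ∫ ω, hamiltonian U V ℓ (gridPoint t₀ T n (k + 1)) (M (gridPoint t₀ T n (k + 1)) ω) ∂P +
      (T - t₀) * (1 / ((n : ℝ) + 1) + C * ((T - t₀) * (1 / ((n : ℝ) + 1)))) := by
    intro n
    obtain ⟨α, hα⟩ := h.exists_strategy_payoff_le (P₁ := P₁) (P₂ := P₂) hP₁ hℓ ht₀ ht n
      (ε := 1 / ((n : ℝ) + 1)) (by positivity)
    refine (ciInf_le hinf α).trans (ciSup_le fun β => (hα β).trans (le_of_eq ?_))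
    simp only [mul_add]
    rw [Finset.sum_add_distrib, Finset.sum_add_distrib, ← Finset.sum_mul, ← Finset.sum_mul, hw]
    ring
  have h0 := tendsto_one_div_add_atTop_nhds_zero_nat (𝕜 := ℝ)
  have hlim := (h.tendsto_sum_integral_hamiltonian ht₀ ht hℓ).2.add
    ((h0.add ((h0.const_mul (T - t₀)).const_mul C)).const_mul (T - t₀))
  simp only [mul_zero, add_zero] at hlim
  exact ge_of_tendsto hlim (Eventually.of_forall hle)

end InformedPlayer

/-! ### Beliefs of an observer of the control -/

section Belief

open ProbabilityTheory

variable {N p : ℕ} {U : NonemptyCompacts (EuclideanSpace ℝ (Fin p))} {t₀ T C : ℝ}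
  {Ω : Type*} [mΩ : MeasurableSpace Ω] {P : Measure Ω} [IsProbabilityMeasure P]
  {X : Ω → EuclideanSpace ℝ (Fin N)} {u : Ω → Control U t₀ T} {n : ℕ}

/-- The conditional law of `X`, on the event that the random control `u` coincides with `y` up to
the `k`-th grid point. -/
def belief (P : Measure Ω) [IsProbabilityMeasure P] (X : Ω → EuclideanSpace ℝ (Fin N))
    (u : Ω → Control U t₀ T) (n k : ℕ) (y : Control U t₀ T) :
    Measure (EuclideanSpace ℝ (Fin N)) :=
  condDistrib X (fun ω => Control.trunc (gridPoint t₀ T n k) (u ω)) P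
    (Control.trunc (gridPoint t₀ T n k) y)

instance (k : ℕ) (y : Control U t₀ T) : IsProbabilityMeasure (belief P X u n k y) := by
  rw [belief]; infer_instance

theorem measurable_belief (k : ℕ) : Measurable (belief P X u n k) :=
  (Kernel.measurable _).comp (Control.continuous_trunc _).measurable

theorem belief_trunc (ht : t₀ < T) {j k : ℕ} (hkj : k ≤ j) (y : Control U t₀ T) :
    belief P X u n k (Control.trunc (gridPoint t₀ T n j) y) = belief P X u n k y := by
  rw [belief, belief, Control.trunc_trunc (monotone_gridPoint ht hkj)]

theorem belief_congr_of_trunc_eq {u' : Ω → Control U t₀ T} {k : ℕ}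
    (h : ∀ ω, Control.trunc (gridPoint t₀ T n k) (u ω) =
      Control.trunc (gridPoint t₀ T n k) (u' ω)) : belief P X u n k = belief P X u' n k := by
  funext y
  simp only [belief, h]

theorem belief_congr_of_map_eq {Ω' : Type*} [MeasurableSpace Ω'] {P' : Measure Ω'}
    [IsProbabilityMeasure P'] {X' : Ω' → EuclideanSpace ℝ (Fin N)} {u' : Ω' → Control U t₀ T}
    (hX : Measurable X) (hu : Measurable u) (hX' : Measurable X') (hu' : Measurable u')
    (h : P.map (fun ω => (u ω, X ω)) = P'.map (fun ω => (u' ω, X' ω))) (k : ℕ) :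
    belief P X u n k = belief P' X' u' n k := by
  have hm : Measurable fun z : Control U t₀ T × EuclideanSpace ℝ (Fin N) =>
      (Control.trunc (gridPoint t₀ T n k) z.1, z.2) :=
    ((Control.continuous_trunc _).measurable.comp measurable_fst).prodMk measurable_snd
  have h1 := congrArg (Measure.map fun z : Control U t₀ T × EuclideanSpace ℝ (Fin N) =>
      (Control.trunc (gridPoint t₀ T n k) z.1, z.2)) h
  rw [Measure.map_map hm (hu.prodMk hX), Measure.map_map hm (hu'.prodMk hX')] at h1
  simp only [Function.comp_def] at h1
  funext y
  rw [belief, belief, condDistrib, condDistrib]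
  simp_rw [h1]

/-- Averaging over the belief is conditioning on the stopped control. -/
theorem integral_belief_eq (hX : Measurable X) (hu : Measurable u) (k : ℕ)
    {g : Control U t₀ T × EuclideanSpace ℝ (Fin N) → ℝ} (hg : Measurable g)
    (hgC : ∀ z, |g z| ≤ C) :
    Integrable (fun ω => ∫ x, g (Control.trunc (gridPoint t₀ T n k) (u ω), x)
      ∂(belief P X u n k (u ω))) P ∧
    ∫ ω, g (Control.trunc (gridPoint t₀ T n k) (u ω), X ω) ∂P =
      ∫ ω, (∫ x, g (Control.trunc (gridPoint t₀ T n k) (u ω), x)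
        ∂(belief P X u n k (u ω))) ∂P := by
  have hA : Measurable fun ω => Control.trunc (gridPoint t₀ T n k) (u ω) :=
    (Control.continuous_trunc _).measurable.comp hu
  have h := condExp_prod_ae_eq_integral_condDistrib (μ := P) hA hX.aemeasurable
    hg.stronglyMeasurable (integrable_of_abs_le (hg.comp (hA.prodMk hX)) fun ω => hgC _)
  refine ⟨integrable_condExp.congr h, ?_⟩
  rw [← integral_condExp hA.comap_le]
  exact integral_congr_ae h

theorem measurable_integral_belief (hu : Measurable u) (k : ℕ)
    {f : EuclideanSpace ℝ (Fin N) → ℝ} (hf : Measurable f) :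
    Measurable fun ω => ∫ x, f x ∂(belief P X u n k (u ω)) :=
  (measurable_integral_measure hf).comp ((measurable_belief k).comp hu)

theorem abs_integral_belief_le {f : EuclideanSpace ℝ (Fin N) → ℝ} (hfC : ∀ x, |f x| ≤ C) (k : ℕ)
    (y : Control U t₀ T) : |∫ x, f x ∂(belief P X u n k y)| ≤ C :=
  abs_integral_le_of_abs_le (ae_of_all _ hfC)

theorem integral_integral_belief (hX : Measurable X) (hu : Measurable u) (k : ℕ)
    {f : EuclideanSpace ℝ (Fin N) → ℝ} (hf : Measurable f) (hfC : ∀ x, |f x| ≤ C) :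
    ∫ ω, (∫ x, f x ∂(belief P X u n k (u ω))) ∂P = ∫ ω, f (X ω) ∂P :=
  (integral_belief_eq hX hu k (g := fun z => f z.2) (hf.comp measurable_snd)
    fun z => hfC z.2).2.symm

/-- Beliefs are martingales: the increments of `∫ f` are orthogonal. -/
theorem integral_sq_sub_belief (ht : t₀ < T) (hX : Measurable X) (hu : Measurable u) (k : ℕ)
    {f : EuclideanSpace ℝ (Fin N) → ℝ} (hf : Measurable f) (hfC : ∀ x, |f x| ≤ C) :
    ∫ ω, (∫ x, f x ∂(belief P X u n (k + 1) (u ω)) - ∫ x, f x ∂(belief P X u n k (u ω))) ^ 2 ∂P =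
      ∫ ω, (∫ x, f x ∂(belief P X u n (k + 1) (u ω))) ^ 2 ∂P -
        ∫ ω, (∫ x, f x ∂(belief P X u n k (u ω))) ^ 2 ∂P := by
  set A : ℕ → Ω → ℝ := fun k ω => ∫ x, f x ∂(belief P X u n k (u ω)) with hA
  have hAm : ∀ k, Measurable (A k) := fun k => measurable_integral_belief hu k hf
  have hAb : ∀ k ω, |A k ω| ≤ C := fun k ω => abs_integral_belief_le hfC _ _
  have hC : 0 ≤ C := (abs_nonneg _).trans (hfC 0)
  have hAA : ∀ j k, Integrable (fun ω => A j ω * A k ω) P := fun j k =>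
    integrable_of_abs_le ((hAm j).mul (hAm k)) (C := C * C) fun ω => by
      rw [abs_mul]; exact mul_le_mul (hAb _ _) (hAb _ _) (abs_nonneg _) hC
  -- Both `E[A (k+1) * A k]` and `E[A k ^ 2]` are equal to `E[f(X) * A k]`.
  have hcross : ∀ j, k ≤ j → ∫ ω, A j ω * A k ω ∂P = ∫ ω, f (X ω) * A k ω ∂P := by
    intro j hj
    have h := (integral_belief_eq (P := P) (n := n) hX hu j (C := C * C)
      (g := fun z => f z.2 * ∫ x, f x ∂(belief P X u n k z.1))
      ((hf.comp measurable_snd).mul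
        ((measurable_integral_measure hf).comp ((measurable_belief k).comp measurable_fst)))
      fun z => by
        rw [abs_mul]
        exact mul_le_mul (hfC _) (abs_integral_belief_le hfC _ _) (abs_nonneg _) hC).2
    simp only [belief_trunc ht hj, integral_mul_const] at h
    exact h.symm
  have hexp : ∀ ω, (A (k + 1) ω - A k ω) ^ 2 =
      A (k + 1) ω * A (k + 1) ω - 2 * (A (k + 1) ω * A k ω) + A k ω * A k ω := fun ω => by ring
  change ∫ ω, (A (k + 1) ω - A k ω) ^ 2 ∂P = ∫ ω, A (k + 1) ω ^ 2 ∂P - ∫ ω, A k ω ^ 2 ∂P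
  simp_rw [hexp, pow_two]
  have hsub : Integrable (fun ω => A (k + 1) ω * A (k + 1) ω - 2 * (A (k + 1) ω * A k ω)) P :=
    (hAA _ _).sub ((hAA _ _).const_mul 2)
  rw [integral_add hsub (hAA _ _), integral_sub (hAA _ _) ((hAA _ _).const_mul 2),
    integral_const_mul, hcross _ (Nat.le_succ k),
    hcross _ le_rfl]
  ring

/-- The total variation of the beliefs along a grid grows at most like the square root of the
number of steps; here in a form linearised with a parameter `r > 0`. -/
theorem sum_integral_abs_sub_belief_le (ht : t₀ < T) (hX : Measurable X) (hu : Measurable u)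
    {f : EuclideanSpace ℝ (Fin N) → ℝ} (hf : Measurable f) (hfC : ∀ x, |f x| ≤ C) {r : ℝ}
    (hr : 0 < r) :
    ∑ k : Fin (n + 1), ∫ ω, |∫ x, f x ∂(belief P X u n (k + 1) (u ω)) -
        ∫ x, f x ∂(belief P X u n k (u ω))| ∂P ≤ (n + 1) * r + C ^ 2 / r := by
  set A : ℕ → Ω → ℝ := fun k ω => ∫ x, f x ∂(belief P X u n k (u ω)) with hA
  have hAm : ∀ k, Measurable (A k) := fun k => measurable_integral_belief hu k hf
  have hAb : ∀ k ω, |A k ω| ≤ C := fun k ω => abs_integral_belief_le hfC _ _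
  have hdb : ∀ k ω, |A (k + 1) ω - A k ω| ≤ 2 * C := fun k ω =>
    (abs_sub _ _).trans (by linarith [hAb k ω, hAb (k + 1) ω])
  have hC : 0 ≤ C := (abs_nonneg _).trans (hfC 0)
  have hsq : ∀ k, Integrable (fun ω => (A (k + 1) ω - A k ω) ^ 2) P := fun k =>
    integrable_of_abs_le (((hAm _).sub (hAm _)).pow_const 2) (C := (2 * C) ^ 2) fun ω => by
      rw [abs_pow]; exact pow_le_pow_left₀ (abs_nonneg _) (hdb k ω) 2
  have hstep : ∀ k, ∫ ω, |A (k + 1) ω - A k ω| ∂P ≤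
      r + (∫ ω, A (k + 1) ω ^ 2 ∂P - ∫ ω, A k ω ^ 2 ∂P) / r := by
    intro k
    rw [← integral_sq_sub_belief ht hX hu k hf hfC, ← integral_div]
    have : r = ∫ _, r ∂P := by simp
    conv_rhs => rw [this]
    rw [← integral_add (integrable_const _) (by simpa using (hsq k).div_const _)]
    refine integral_mono (integrable_of_abs_le ((hAm _).sub (hAm _)).abs
      fun ω => by rw [abs_abs]; exact hdb k ω)
        ((integrable_const _).add (by simpa using (hsq k).div_const _))
      fun ω => ?_
    simp only [integral_const, probReal_univ, smul_eq_mul, one_mul]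
    -- `2 r |a| ≤ r² + a²`
    have h := sq_nonneg (r - |A (k + 1) ω - A k ω|)
    have h' := abs_nonneg (A (k + 1) ω - A k ω)
    have h2 : r + (A (k + 1) ω - A k ω) ^ 2 / r = (r ^ 2 + |A (k + 1) ω - A k ω| ^ 2) / r := by
      rw [sq_abs]; field_simp
    change |A (k + 1) ω - A k ω| ≤ r + (A (k + 1) ω - A k ω) ^ 2 / r
    rw [h2, le_div_iff₀ hr]
    nlinarith
  calc _ ≤ ∑ k : Fin (n + 1), (r + (∫ ω, A (k + 1) ω ^ 2 ∂P - ∫ ω, A k ω ^ 2 ∂P) / r) :=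
        Finset.sum_le_sum fun k _ => hstep k
    _ = (n + 1) * r + (∫ ω, A (n + 1) ω ^ 2 ∂P - ∫ ω, A 0 ω ^ 2 ∂P) / r := by
        rw [Finset.sum_add_distrib, ← Finset.sum_div,
          Fin.sum_univ_eq_sum_range (fun k => ∫ ω, A (k + 1) ω ^ 2 ∂P - ∫ ω, A k ω ^ 2 ∂P),
          Finset.sum_range_sub (fun k => ∫ ω, A k ω ^ 2 ∂P)]
        simp
    _ ≤ (n + 1) * r + C ^ 2 / r := by
        have h1 : ∫ ω, A (n + 1) ω ^ 2 ∂P ≤ C ^ 2 := by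
          refine (le_abs_self _).trans (abs_integral_le_of_abs_le (ae_of_all _ fun ω => ?_))
          rw [abs_pow]; exact pow_le_pow_left₀ (abs_nonneg _) (hAb _ ω) 2
        have h2 : 0 ≤ ∫ ω, A 0 ω ^ 2 ∂P := integral_nonneg fun ω => sq_nonneg _
        gcongr
        linarith

/-- The beliefs have finite second moments if the prior has. -/
theorem ae_belief_mem_Pi2 (hX : Measurable X) (hu : Measurable u) (hm : P.map X ∈ Pi2 N) (k : ℕ) :
    ∀ᵐ ω ∂P, belief P X u n k (u ω) ∈ Pi2 N := by
  have hA : Measurable fun ω => Control.trunc (gridPoint t₀ T n k) (u ω) :=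
    (Control.continuous_trunc _).measurable.comp hu
  have hi : Integrable (fun z : Control U t₀ T × EuclideanSpace ℝ (Fin N) => ‖z.2‖ ^ 2)
      (P.map fun ω => (Control.trunc (gridPoint t₀ T n k) (u ω), X ω)) := by
    rw [integrable_map_measure (by fun_prop) (hA.prodMk hX).aemeasurable]
    exact (integrable_map_measure (by fun_prop) hX.aemeasurable).1 hm.2
  filter_upwards [hi.condDistrib_ae hA.aemeasurable hX.aemeasurable] with ω hω
  exact ⟨inferInstance, hω⟩

theorem setIntegral_belief (hX : Measurable X) (hu : Measurable u) (k : ℕ)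
    {f : EuclideanSpace ℝ (Fin N) → ℝ} (hf : Measurable f) (hfC : ∀ x, |f x| ≤ C) {B : Set Ω}
    (hB : MeasurableSet[MeasurableSpace.comap
      (fun ω => Control.trunc (gridPoint t₀ T n k) (u ω)) inferInstance] B) :
    ∫ ω in B, (∫ x, f x ∂(belief P X u n k (u ω))) ∂P = ∫ ω in B, f (X ω) ∂P := by
  have hA : Measurable fun ω => Control.trunc (gridPoint t₀ T n k) (u ω) :=
    (Control.continuous_trunc _).measurable.comp hu
  have hfX : Integrable (fun ω => f (X ω)) P := integrable_of_abs_le (hf.comp hX) fun ω => hfC _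
  rw [← setIntegral_condExp hA.comap_le hfX hB]
  exact integral_congr_ae (ae_restrict_of_ae (condExp_ae_eq_integral_condDistrib hA hX.aemeasurable
    hf.stronglyMeasurable hfX).symm)

/-- The beliefs at the grid points, extended to be constant on the grid intervals, form a
measure-valued martingale. -/
theorem isMartingaleMeasure_belief (ht : t₀ < T) (hX : Measurable X) (hu : Measurable u) :
    IsMartingaleMeasure P t₀ T (P.map X)
      fun t ω => belief P X u n (gridIndex t₀ T n t) (u ω) where
  measurable t _ := (measurable_belief _).comp hu
  cadlag f _ _ := ae_of_all _ fun ω t htT => by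
    constructor
    · obtain ⟨δ, hδ, h⟩ := exists_gridIndex_eq_right (n := n) ht htT
      refine ContinuousWithinAt.congr_of_eventuallyEq (f := fun _ => ∫ x, f x
        ∂(belief P X u n (gridIndex t₀ T n t) (u ω))) continuousWithinAt_const ?_ rfl
      filter_upwards [self_mem_nhdsWithin, mem_nhdsWithin_of_mem_nhds
        (Iic_mem_nhds (lt_add_of_pos_right t hδ))] with s hs hs'
      rw [h s hs.1 hs.2 hs']
    · rcases eq_or_lt_of_le htT.1 with rfl | hlt
      · exact ⟨0, by simp⟩
      · obtain ⟨k, r, hr, h⟩ := exists_gridIndex_eq_left (T := T) (n := n) ht hlt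
        refine ⟨∫ x, f x ∂(belief P X u n k (u ω)), tendsto_const_nhds.congr' ?_⟩
        filter_upwards [self_mem_nhdsWithin, mem_nhdsWithin_of_mem_nhds (Ioi_mem_nhds hr)]
          with s hs hs'
        rw [h s hs.1 hs' hs.2]
  condLaw := by
    refine ⟨X, hX, rfl, fun t htT f hf ⟨C, hfC⟩ => ?_⟩
    set M : ℝ → Ω → Measure (EuclideanSpace ℝ (Fin N)) :=
      fun t ω => belief P X u n (gridIndex t₀ T n t) (u ω) with hM
    have hMm : ∀ t ∈ Icc t₀ T, Measurable (M t) := fun t _ => (measurable_belief _).comp hu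
    have hle := beliefSigma_le (P := P) hMm t
    set k : ℕ := (gridIndex t₀ T n t : ℕ) with hk
    have hA : Measurable fun ω => Control.trunc (gridPoint t₀ T n k) (u ω) :=
      (Control.continuous_trunc _).measurable.comp hu
    -- Up to null sets, the history of `M` until `t` is known from the control until the last
    -- grid point before `t`.
    have hsub : beliefSigma P t₀ T M t ≤ eventuallyMeasurableSpace (MeasurableSpace.comap
        (fun ω => Control.trunc (gridPoint t₀ T n k) (u ω)) inferInstance) (ae P) := by
      obtain ⟨δ, hδ, h⟩ := exists_gridIndex_eq_right (n := n) ht htT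
      refine (iInf₂_le (t + δ) (by simpa using hδ)).trans (sup_le ?_ (iSup₂_le fun r hr => ?_))
      · refine MeasurableSpace.generateFrom_le fun B hB => ?_
        exact ⟨∅, @MeasurableSet.empty _ (MeasurableSpace.comap _ _), ae_eq_empty.2 hB.2⟩
      · have hrk : (gridIndex t₀ T n r : ℕ) ≤ k := by
          rcases le_total t r with htr | hrt
          · rw [h r htr hr.1.2 hr.2]
          · exact gridIndex_mono ht hr.1.1 hrt
        have hMr : M r = belief P X u n (gridIndex t₀ T n r) ∘
            fun ω => Control.trunc (gridPoint t₀ T n k) (u ω) := by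
          funext ω
          exact (belief_trunc ht hrk (u ω)).symm
        rw [hMr, ← MeasurableSpace.comap_comp]
        exact (MeasurableSpace.comap_mono (measurable_belief _).comap_le).trans
          le_eventuallyMeasurableSpace
    have hi : Integrable (fun ω => ∫ x, f x ∂(M t ω)) P :=
      integrable_of_abs_le (measurable_integral_belief hu k hf)
        fun ω => abs_integral_belief_le hfC _ _
    refine ae_eq_condExp_of_forall_setIntegral_eq hle
      (integrable_of_abs_le (hf.comp hX) fun ω => hfC _) (fun _ _ _ => hi.integrableOn)
      (fun B hB _ => ?_) ?_
    · obtain ⟨B', hB', hBB'⟩ := hsub B hB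
      rw [setIntegral_congr_set hBB', setIntegral_congr_set hBB']
      exact setIntegral_belief hX hu k hf hfC hB'
    · exact ((measurable_integral_measure hf).comp
        (measurable_beliefSigma htT le_rfl)).stronglyMeasurable.aestronglyMeasurable

end Belief

/-! ### Feedback strategies of Player II -/

section Feedback

variable {N p q : ℕ} {U : NonemptyCompacts (EuclideanSpace ℝ (Fin p))}
  {V : NonemptyCompacts (EuclideanSpace ℝ (Fin q))} {t₀ T C : ℝ} {n : ℕ}

theorem measurable_feedback {b : ℕ → Control U t₀ T → ℕ} (hb : ∀ k, Measurable (b k)) :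
    Measurable fun u : Control U t₀ T => stepControl V t₀ T fun k : Fin (n + 1) =>
      b k (Control.trunc (gridPoint t₀ T n k) u) := by
  have h : Measurable fun (u : Control U t₀ T) (k : Fin (n + 1)) =>
      b k (Control.trunc (gridPoint t₀ T n k) u) := measurable_pi_lambda _ fun k =>
    (hb k).comp (Control.continuous_trunc _).measurable
  exact (Measurable.of_discrete (f := stepControl (n := n) V t₀ T)).comp h

/-- If two controls agree up to `t`, so do the replies at all times whose grid interval starts
before `t`. -/
theorem agreeUpTo_feedback_of_le {b : ℕ → Control U t₀ T → ℕ} {s t : ℝ}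
    {u₁ u₂ : Control U t₀ T} (h : AgreeUpTo t u₁ u₂)
    (hs : ∀ r ∈ Icc t₀ T, r < s → gridPoint t₀ T n (gridIndex t₀ T n r) ≤ t) :
    AgreeUpTo s
      (stepControl V t₀ T fun k : Fin (n + 1) => b k (Control.trunc (gridPoint t₀ T n k) u₁))
      (stepControl V t₀ T fun k : Fin (n + 1) => b k (Control.trunc (gridPoint t₀ T n k) u₂)) :=
  agreeUpTo_stepControl V fun r hr hrs =>
    congrArg (b (gridIndex t₀ T n r)) (Control.trunc_eq_trunc (h.mono (hs r hr hrs)))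

/-- The strategy of Player II which plays on each grid interval a constant action, whose index
depends on the control of Player I up to the beginning of the interval. -/
def StrategyII.feedback (V : NonemptyCompacts (EuclideanSpace ℝ (Fin q))) (ht : t₀ < T) (n : ℕ)
    (b : ℕ → Control U t₀ T → ℕ) (hb : ∀ k, Measurable (b k)) : StrategyII U V t₀ T where
  toFun u := stepControl V t₀ T fun k : Fin (n + 1) =>
    b k (Control.trunc (gridPoint t₀ T n k) u)
  measurable_toFun := measurable_feedback hb
  nonanticipative _ _ _ _ h := agreeUpTo_feedback_of_le h fun _ hr hrt =>
    (gridPoint_gridIndex_le ht hr.1).trans hrt.le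
  delay t htT u₁ u₂ := by
    obtain ⟨δ, hδ, hidx⟩ := exists_gridIndex_eq_right (n := n) ht htT
    refine ⟨δ, hδ, fun h => agreeUpTo_feedback_of_le h fun s hs hst => ?_⟩
    rcases le_total t s with hts | hst'
    · rw [hidx s hts hs.2 hst.le]
      exact gridPoint_gridIndex_le ht htT.1
    · exact (gridPoint_gridIndex_le ht hs.1).trans hst'

theorem agreeUpTo_feedback (ht : t₀ < T) {b b' : ℕ → Control U t₀ T → ℕ}
    (hb : ∀ k, Measurable (b k)) (hb' : ∀ k, Measurable (b' k)) {k : ℕ}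
    (h : ∀ j < k, b j = b' j) (u : Control U t₀ T) :
    AgreeUpTo (gridPoint t₀ T n k) ((StrategyII.feedback V ht n b hb).toFun u)
      ((StrategyII.feedback V ht n b' hb').toFun u) := by
  refine agreeUpTo_stepControl V fun s hs hst => ?_
  rw [h]
  obtain _ | k := k
  · rw [gridPoint_zero] at hst
    exact absurd hst (not_lt.2 hs.1)
  · exact Nat.lt_succ_of_le (gridIndex_le_of_lt ht hs.1 hst)

/-- Player II can play, on each grid interval, the answer `sel k` to the belief induced by the
outcome of this very play at the beginning of the interval. -/
theorem exists_feedback_belief {Ω : Type*} [MeasurableSpace Ω] (P : Measure Ω)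
    [IsProbabilityMeasure P] (X : Ω → EuclideanSpace ℝ (Fin N)) (ht : t₀ < T)
    {Δ : Subdivision t₀ T} (α : Ω → StrategyI U V Δ)
    {sel : ℕ → Measure (EuclideanSpace ℝ (Fin N)) → ℕ} (hsel : ∀ k, Measurable (sel k)) (n : ℕ) :
    ∃ (b : ℕ → Control U t₀ T → ℕ) (hb : ∀ k, Measurable (b k)), ∀ k ≤ n, ∀ y,
      b k y = sel k (belief P X
        (fun ω => (outcome (α ω) (StrategyII.feedback V ht n b hb)).1) n k y) := by
  suffices h : ∀ j ≤ n + 1, ∃ (b : ℕ → Control U t₀ T → ℕ) (hb : ∀ k, Measurable (b k)),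
      ∀ k < j, ∀ y, b k y = sel k (belief P X
        (fun ω => (outcome (α ω) (StrategyII.feedback V ht n b hb)).1) n k y) by
    obtain ⟨b, hb, h⟩ := h (n + 1) le_rfl
    exact ⟨b, hb, fun k hk => h k (Nat.lt_succ_of_le hk)⟩
  intro j hj
  induction j with
  | zero => exact ⟨fun _ _ => 0, fun _ => measurable_const, fun k hk => absurd hk (by simp)⟩
  | succ j ih =>
    obtain ⟨b, hb, h⟩ := ih (by omega)
    set a : Control U t₀ T → ℕ := fun y => sel j (belief P X
        (fun ω => (outcome (α ω) (StrategyII.feedback V ht n b hb)).1) n j y) with ha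
    have ham : Measurable a := (hsel j).comp (measurable_belief j)
    have hb' : ∀ k, Measurable (Function.update b j a k) := fun k => by
      rcases eq_or_ne k j with rfl | hk
      · simpa using ham
      · simpa [hk] using hb k
    refine ⟨Function.update b j a, hb', fun k hk y => ?_⟩
    -- The belief at step `k ≤ j` is not affected by the change of the `j`-th action.
    have hbel : belief P X
        (fun ω => (outcome (α ω) (StrategyII.feedback V ht n b hb)).1) n k =
        belief P X (fun ω => (outcome (α ω)
          (StrategyII.feedback V ht n (Function.update b j a) hb')).1) n k :=
      belief_congr_of_trunc_eq fun ω => Control.trunc_eq_trunc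
        (agreeUpTo_outcome_fst (α ω) (gridPoint_mem ht (by omega)) fun u =>
          agreeUpTo_feedback ht hb hb' (fun i hi => by
            rw [Function.update_of_ne (by omega)]) u)
    rw [← hbel]
    rcases eq_or_ne k j with rfl | hkj
    · rw [Function.update_self]
    · rw [Function.update_of_ne hkj]
      exact h k (by omega) y

end Feedback

/-! ### Answering to the current belief -/

theorem martingaleValue_eq {N p q : ℕ} {U : NonemptyCompacts (EuclideanSpace ℝ (Fin p))}
    {V : NonemptyCompacts (EuclideanSpace ℝ (Fin q))} {t₀ T : ℝ}
    {ℓ : EuclideanSpace ℝ (Fin N) → ℝ → EuclideanSpace ℝ (Fin p) →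
      EuclideanSpace ℝ (Fin q) → ℝ}
    {Ω : Type*} [MeasurableSpace Ω] {P : Measure Ω} {m : Measure (EuclideanSpace ℝ (Fin N))}
    (ht : t₀ ≤ T) : martingaleValue U V ℓ T P t₀ m =
    ⨅ M : {M : ℝ → Ω → Measure (EuclideanSpace ℝ (Fin N)) // IsMartingaleMeasure P t₀ T m M},
      ∫ ω, (∫ s in Icc t₀ T, hamiltonian U V ℓ s (M.1 s ω)) ∂P := by
  simp only [martingaleValue, intervalIntegral.integral_of_le ht, integral_Icc_eq_integral_Ioc]

section UninformedPlayer

variable {N p q : ℕ} {U : NonemptyCompacts (EuclideanSpace ℝ (Fin p))}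
  {V : NonemptyCompacts (EuclideanSpace ℝ (Fin q))} {t₀ T C : ℝ} {n : ℕ}
  {ℓ : EuclideanSpace ℝ (Fin N) → ℝ → EuclideanSpace ℝ (Fin p) →
    EuclideanSpace ℝ (Fin q) → ℝ}
  {Ω : Type*} [MeasurableSpace Ω] {P : Measure Ω} [IsProbabilityMeasure P]
  {X : Ω → EuclideanSpace ℝ (Fin N)} {u : Ω → Control U t₀ T}

theorem integrable_hamiltonian_belief (hℓ : IsRegularCost T U V ℓ C) (hu : Measurable u) (t : ℝ)
    (k : ℕ) : Integrable (fun ω => hamiltonian U V ℓ t (belief P X u n k (u ω))) P := by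
  obtain ⟨g, hg, hgH⟩ := hℓ.exists_measurable_eq_hamiltonian t
  have h : (fun ω => hamiltonian U V ℓ t (belief P X u n k (u ω))) =
      fun ω => g (belief P X u n k (u ω)) := funext fun ω => (hgH _ inferInstance).symm
  refine integrable_of_abs_le ?_ fun ω => hℓ.abs_hamiltonian_le t _
  rw [h]
  exact hg.comp ((measurable_belief k).comp hu)

/-- The cost over one grid interval when Player II plays an answer to the belief at the left end
point of the interval. The control of Player I on the interval is known only at its right end
point, so that the belief there enters; `D` bounds the effect of the change of belief. -/
theorem IsRegularCost.le_integral_runningCost_cell (hℓ : IsRegularCost T U V ℓ C) (ht₀ : 0 ≤ t₀)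
    (ht : t₀ < T) (hX : Measurable X) (hu : Measurable u)
    (hIsaacs : ∀ t ∈ Icc 0 T, ∀ m ∈ Pi2 N, IsaacsAt U V ℓ t m) (hm : P.map X ∈ Pi2 N)
    {sel : ℕ → Measure (EuclideanSpace ℝ (Fin N)) → ℕ} {ε : ℝ}
    (hopt : ∀ k μ, IsProbabilityMeasure μ → IsaacsAt U V ℓ (gridPoint t₀ T n k) μ → ∀ a ∈ U,
      hamiltonian U V ℓ (gridPoint t₀ T n k) μ - ε ≤
        ∫ x, ℓ x (gridPoint t₀ T n k) a (denseSeq V (sel k μ)) ∂μ)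
    {b : ℕ → Control U t₀ T → ℕ} (hb : ∀ k, Measurable (b k))
    (hbsel : ∀ k ≤ n, ∀ y, b k y = sel k (belief P X u n k y)) (k : Fin (n + 1)) {D : Ω → ℝ}
    (hDi : Integrable D P) (hD : ∀ ω, ∀ a ∈ U, ∀ c ∈ V,
      |∫ x, ℓ x (gridPoint t₀ T n k) a c ∂(belief P X u n (k + 1) (u ω)) -
        ∫ x, ℓ x (gridPoint t₀ T n k) a c ∂(belief P X u n k (u ω))| ≤ D ω) :
    (volume.restrict (Icc t₀ T)).real (cell t₀ T n k) *
      (∫ ω, hamiltonian U V ℓ (gridPoint t₀ T n k) (belief P X u n k (u ω)) ∂P -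
        (ε + C * ((T - t₀) / (n + 1)) + ∫ ω, D ω ∂P)) ≤
    ∫ ω, runningCost ℓ (cell t₀ T n k) (X ω) (u ω)
      ((StrategyII.feedback V ht n b hb).toFun (u ω)) ∂P := by
  set β := StrategyII.feedback V ht n b hb with hβ
  set w := (volume.restrict (Icc t₀ T)).real (cell t₀ T n k) with hw
  have hk1 : gridPoint t₀ T n (k + 1) ∈ Icc t₀ T := gridPoint_mem ht (Nat.succ_le_of_lt k.2)
  have hk0 : gridPoint t₀ T n k ∈ Icc t₀ T := gridPoint_mem ht k.2.le
  have hk0' : gridPoint t₀ T n k ∈ Icc 0 T := ⟨ht₀.trans hk0.1, hk0.2⟩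
  have hrw : ∀ ω, runningCost ℓ (cell t₀ T n k) (X ω) (u ω) (β.toFun (u ω)) =
      runningCost ℓ (cell t₀ T n k) (X ω) (Control.trunc (gridPoint t₀ T n (k + 1)) (u ω))
        (β.toFun (Control.trunc (gridPoint t₀ T n (k + 1)) (u ω))) := fun ω => by
    have h := (Control.agreeUpTo_trunc (gridPoint t₀ T n (k + 1)) (u ω)).symm
    exact runningCost_cell_congr ht h (β.nonanticipative _ hk1 _ _ h)
  simp_rw [hrw]
  obtain ⟨hi, heq⟩ := integral_belief_eq (P := P) (n := n) hX hu (k + 1) (C := C * (T - t₀))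
    (g := fun z => runningCost ℓ (cell t₀ T n k) z.2 z.1 (β.toFun z.1))
    ((hℓ.continuous_runningCost _).measurable.comp (measurable_snd.prodMk
      (measurable_fst.prodMk (β.measurable_toFun.comp measurable_fst))))
    (fun z => hℓ.abs_runningCost_le ht.le _ _ _ _)
  have hHi := integrable_hamiltonian_belief (P := P) (X := X) (n := n) hℓ hu
    (gridPoint t₀ T n k) k
  have hci : Integrable (fun ω => ε + C * ((T - t₀) / (n + 1)) + D ω) P :=
    (integrable_const _).add hDi
  calc _ = ∫ ω, w * (hamiltonian U V ℓ (gridPoint t₀ T n k) (belief P X u n k (u ω)) -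
        (ε + C * ((T - t₀) / (n + 1)) + D ω)) ∂P := by
        rw [integral_const_mul, integral_sub hHi hci, integral_add (integrable_const _) hDi]
        simp
    _ ≤ _ := by
        rw [heq]
        refine integral_mono_ae ((hHi.sub hci).const_mul _) hi ?_
        filter_upwards [ae_belief_mem_Pi2 (n := n) hX hu hm k] with ω hω
        have hI := hIsaacs _ hk0' _ hω
        rw [hℓ.integral_runningCost]
        set y := Control.trunc (gridPoint t₀ T n (k + 1)) (u ω) with hy
        have hconst : w * (hamiltonian U V ℓ (gridPoint t₀ T n k) (belief P X u n k (u ω)) -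
            (ε + C * ((T - t₀) / (n + 1)) + D ω)) = ∫ _ in cell t₀ T n k,
            (hamiltonian U V ℓ (gridPoint t₀ T n k) (belief P X u n k (u ω)) -
              (ε + C * ((T - t₀) / (n + 1)) + D ω)) ∂(volume.restrict (Icc t₀ T)) := by
          rw [setIntegral_const, smul_eq_mul]
        rw [hconst]
        refine integral_mono_ae (integrable_const _) ?_ ?_
        · refine Integrable.integrableOn (integrable_of_abs_le (C := C)
            ((hℓ.continuous_average (belief P X u n (k + 1) (u ω))).measurable.comp
              (measurable_id.prodMk ((Control.measurable_coe _).prodMk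
                (Control.measurable_coe _)))) fun s => ?_)
          exact abs_integral_le_of_abs_le (ae_of_all _ fun x => hℓ.bdd _ _ _ _)
        · filter_upwards [ae_restrict_of_ae (coeFn_stepControl V fun i : Fin (n + 1) =>
              b i (Control.trunc (gridPoint t₀ T n i) y)), ae_restrict_of_ae y.2,
            ae_restrict_of_ae (ae_restrict_mem measurableSet_Icc),
            ae_restrict_mem (measurableSet_cell k)] with s hvs hys hs hsk
          have hIs := mem_Icc_of_mem_cell ht hs hsk
          have hsk' : gridIndex t₀ T n s = k := hsk
          have hv : β.toFun y s = denseSeq V (sel k (belief P X u n k (u ω))) := by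
            refine hvs.trans ?_
            rw [hsk', hbsel k (Nat.le_of_lt_succ k.2), hy,
              Control.trunc_trunc (monotone_gridPoint ht (Nat.le_succ _)), belief_trunc ht le_rfl]
          rw [hv]
          have h1 := hopt k _ inferInstance hI _ hys
          have h2 := (abs_le.1 (hD ω _ hys _
            (denseSeq V (sel k (belief P X u n k (u ω)))).2)).1
          have h3 := (abs_le.1 (hℓ.abs_average_sub_le (t := s) (t' := gridPoint t₀ T n k)
            ⟨ht₀.trans hs.1, hs.2⟩ hk0' hys (denseSeq V (sel k (belief P X u n k (u ω)))).2
            (belief P X u n (k + 1) (u ω)))).1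
          have h4 : |s - gridPoint t₀ T n k| ≤ (T - t₀) / (n + 1) := by
            rw [gridPoint_succ] at hIs
            rw [abs_le]
            constructor <;> linarith [hIs.1, hIs.2, mesh_pos (n := n) ht]
          have h5 := mul_le_mul_of_nonneg_left h4 hℓ.const_nonneg
          linarith

/-- The value of the martingale of beliefs is controlled by the Hamiltonian at the left end points
of the grid intervals. -/
theorem IsRegularCost.integral_hamiltonian_belief_le (hℓ : IsRegularCost T U V ℓ C) (ht₀ : 0 ≤ t₀)
    (ht : t₀ < T) (hX : Measurable X) (hu : Measurable u) :
    ∫ ω, (∫ s in Icc t₀ T,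
      hamiltonian U V ℓ s (belief P X u n (gridIndex t₀ T n s) (u ω))) ∂P ≤
    ∑ k : Fin (n + 1), (volume.restrict (Icc t₀ T)).real (cell t₀ T n k) *
      (∫ ω, hamiltonian U V ℓ (gridPoint t₀ T n k) (belief P X u n k (u ω)) ∂P +
        C * ((T - t₀) / (n + 1))) := by
  have hM := isMartingaleMeasure_belief (P := P) (n := n) ht hX hu
  have hHi := fun k : ℕ => integrable_hamiltonian_belief (P := P) (X := X) (n := n) hℓ hu
    (gridPoint t₀ T n k) k
  have hHC : ∀ k : ℕ, Integrable (fun ω => hamiltonian U V ℓ (gridPoint t₀ T n k)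
      (belief P X u n k (u ω)) + C * ((T - t₀) / (n + 1))) P := fun k =>
    (hHi k).add (integrable_const _)
  have hsum : ∑ k : Fin (n + 1), (volume.restrict (Icc t₀ T)).real (cell t₀ T n k) *
      (∫ ω, hamiltonian U V ℓ (gridPoint t₀ T n k) (belief P X u n k (u ω)) ∂P +
        C * ((T - t₀) / (n + 1))) =
      ∫ ω, ∑ k : Fin (n + 1), (volume.restrict (Icc t₀ T)).real (cell t₀ T n k) *
        (hamiltonian U V ℓ (gridPoint t₀ T n k) (belief P X u n k (u ω)) +
          C * ((T - t₀) / (n + 1))) ∂P := by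
    rw [integral_finsetSum _ fun (k : Fin (n + 1)) _ => (hHC k).const_mul _]
    refine Finset.sum_congr rfl fun k _ => ?_
    rw [integral_const_mul, integral_add (hHi k) (integrable_const _)]
    simp
  rw [hsum]
  refine integral_mono_ae (hM.tendsto_sum_integral_hamiltonian ht₀ ht hℓ).1
    (integrable_finsetSum _ fun (k : Fin (n + 1)) _ => (hHC k).const_mul _) ?_
  filter_upwards [hM.ae_continuousWithinAt_hamiltonian ht₀ ht hℓ] with ω hω
  have hint := (tendsto_sum_cell_mul ht hω fun t _ => hℓ.abs_hamiltonian_le _ _).1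
  rw [← sum_setIntegral_cell (n := n) hint]
  refine Finset.sum_le_sum fun k _ => ?_
  have hconst : (volume.restrict (Icc t₀ T)).real (cell t₀ T n k) *
      (hamiltonian U V ℓ (gridPoint t₀ T n k) (belief P X u n k (u ω)) +
        C * ((T - t₀) / (n + 1))) = ∫ _ in cell t₀ T n k,
      (hamiltonian U V ℓ (gridPoint t₀ T n k) (belief P X u n k (u ω)) +
        C * ((T - t₀) / (n + 1))) ∂(volume.restrict (Icc t₀ T)) := by
    rw [setIntegral_const, smul_eq_mul]
  rw [hconst]
  refine integral_mono_ae (Integrable.integrableOn hint) (integrable_const _) ?_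
  filter_upwards [ae_restrict_of_ae (ae_restrict_mem measurableSet_Icc),
    ae_restrict_mem (measurableSet_cell k)] with s hs hsk
  have hIs := mem_Icc_of_mem_cell ht hs hsk
  obtain rfl : gridIndex t₀ T n s = k := hsk
  have hk0 : gridPoint t₀ T n (gridIndex t₀ T n s) ∈ Icc t₀ T :=
    gridPoint_mem ht (gridIndex t₀ T n s).2.le
  have h1 := hℓ.hamiltonian_le_add_time (t := s) (t' := gridPoint t₀ T n (gridIndex t₀ T n s))
    ⟨ht₀.trans hs.1, hs.2⟩ ⟨ht₀.trans hk0.1, hk0.2⟩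
    (belief P X u n (gridIndex t₀ T n s) (u ω))
  have h4 : |s - gridPoint t₀ T n (gridIndex t₀ T n s)| ≤ (T - t₀) / (n + 1) := by
    rw [gridPoint_succ] at hIs
    rw [abs_le]
    constructor <;> linarith [hIs.1, hIs.2, mesh_pos (n := n) ht]
  have h5 := mul_le_mul_of_nonneg_left h4 hℓ.const_nonneg
  linarith

/-- A lower bound of the total cost of a play in which Player II answers to his beliefs, with
explicit error terms: `h` is the mesh of the grid, `R` and `J` come from the approximation of the
costs by finitely many test functions, and `r` is a free parameter. -/
theorem IsRegularCost.integral_hamiltonian_belief_le_cost_add (hℓ : IsRegularCost T U V ℓ C)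
    (ht₀ : 0 ≤ t₀) (ht : t₀ < T) (hX : Measurable X) (hu : Measurable u)
    (hIsaacs : ∀ t ∈ Icc 0 T, ∀ m ∈ Pi2 N, IsaacsAt U V ℓ t m) (hm : P.map X ∈ Pi2 N)
    {sel : ℕ → Measure (EuclideanSpace ℝ (Fin N)) → ℕ} {ε : ℝ}
    (hopt : ∀ k μ, IsProbabilityMeasure μ → IsaacsAt U V ℓ (gridPoint t₀ T n k) μ → ∀ a ∈ U,
      hamiltonian U V ℓ (gridPoint t₀ T n k) μ - ε ≤
        ∫ x, ℓ x (gridPoint t₀ T n k) a (denseSeq V (sel k μ)) ∂μ)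
    {b : ℕ → Control U t₀ T → ℕ} (hb : ∀ k, Measurable (b k))
    (hbsel : ∀ k ≤ n, ∀ y, b k y = sel k (belief P X u n k y))
    {R : ℝ} {J : Finset (ℝ × EuclideanSpace ℝ (Fin p) × EuclideanSpace ℝ (Fin q))}
    (hJ : ∀ t ∈ Icc 0 T, ∀ a ∈ U, ∀ c ∈ V, ∀ μ ν : Measure (EuclideanSpace ℝ (Fin N)),
        IsProbabilityMeasure μ → IsProbabilityMeasure ν →
        |∫ x, ℓ x t a c ∂μ - ∫ x, ℓ x t a c ∂ν| ≤
          2 * ε + 2 * C * (∫ x, tail R x ∂μ + ∫ x, tail R x ∂ν) +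
            ∑ j ∈ J, |∫ x, ℓ x j.1 j.2.1 j.2.2 ∂μ - ∫ x, ℓ x j.1 j.2.1 j.2.2 ∂ν|)
    {r : ℝ} (hr : 0 < r) :
    ∫ ω, (∫ s in Icc t₀ T,
      hamiltonian U V ℓ s (belief P X u n (gridIndex t₀ T n s) (u ω))) ∂P ≤
    ∫ ω, runningCost ℓ univ (X ω) (u ω) ((StrategyII.feedback V ht n b hb).toFun (u ω)) ∂P +
      ((T - t₀) * (2 * C * ((T - t₀) * (1 / (n + 1))) + 3 * ε + 4 * C * ∫ ω, tail R (X ω) ∂P) +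
        J.card * ((T - t₀) * r + C ^ 2 / r * ((T - t₀) * (1 / (n + 1))))) := by
  set h : ℝ := (T - t₀) / (n + 1) with hh
  have hpos : 0 < h := mesh_pos ht
  have hh' : (T - t₀) * (1 / ((n : ℝ) + 1)) = h := by rw [hh]; ring
  have hhn : (n + 1) * h = T - t₀ := by rw [hh]; field_simp
  rw [hh']
  set w : Fin (n + 1) → ℝ := fun k => (volume.restrict (Icc t₀ T)).real (cell t₀ T n k) with hw
  have hwsum : ∑ k, w k = T - t₀ := sum_measureReal_cell ht.le
  set β := StrategyII.feedback V ht n b hb with hβ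
  -- `G k` is the change of the test integrals at step `k`
  set G : ℕ → (ℝ × EuclideanSpace ℝ (Fin p) × EuclideanSpace ℝ (Fin q)) → Ω → ℝ := fun k j ω =>
    |∫ x, ℓ x j.1 j.2.1 j.2.2 ∂(belief P X u n (k + 1) (u ω)) -
      ∫ x, ℓ x j.1 j.2.1 j.2.2 ∂(belief P X u n k (u ω))| with hG
  have hGi : ∀ k j, Integrable (G k j) P := fun k j =>
    integrable_of_abs_le (C := C + C) ((measurable_integral_belief hu (k + 1)
      (hℓ.measurable j.1 j.2.1 j.2.2)).sub (measurable_integral_belief hu k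
        (hℓ.measurable j.1 j.2.1 j.2.2))).abs fun ω => by
        rw [abs_abs]
        exact (abs_sub _ _).trans (add_le_add
          (abs_integral_belief_le (fun x => hℓ.bdd _ _ _ _) _ _)
          (abs_integral_belief_le (fun x => hℓ.bdd _ _ _ _) _ _))
  have hti : ∀ k, Integrable (fun ω => ∫ x, tail R x ∂(belief P X u n k (u ω))) P := fun k =>
    integrable_of_abs_le (measurable_integral_belief hu k (measurable_tail R)) fun ω =>
      abs_integral_belief_le (abs_tail_le R) _ _
  set D : ℕ → Ω → ℝ := fun k ω => 2 * ε + 2 * C * (∫ x, tail R x ∂(belief P X u n (k + 1) (u ω)) +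
    ∫ x, tail R x ∂(belief P X u n k (u ω))) + ∑ j ∈ J, G k j ω with hD
  have htt : ∀ k, Integrable (fun ω => ∫ x, tail R x ∂(belief P X u n (k + 1) (u ω)) +
        ∫ x, tail R x ∂(belief P X u n k (u ω))) P := fun k => (hti _).add (hti _)
  have hD1 : ∀ k, Integrable (fun ω => 2 * ε + 2 * C *
      (∫ x, tail R x ∂(belief P X u n (k + 1) (u ω)) +
        ∫ x, tail R x ∂(belief P X u n k (u ω)))) P := fun k =>
    (integrable_const _).add ((htt k).const_mul _)
  have hDi : ∀ k, Integrable (D k) P := fun k =>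
    (hD1 k).add (integrable_finsetSum _ fun j _ => hGi k j)
  have hDint : ∀ k, ∫ ω, D k ω ∂P =
      2 * ε + 4 * C * ∫ ω, tail R (X ω) ∂P + ∑ j ∈ J, ∫ ω, G k j ω ∂P := by
    intro k
    rw [integral_add (hD1 k) (integrable_finsetSum _ fun j _ => hGi k j),
      integral_add (integrable_const _) ((htt k).const_mul _), integral_const, integral_const_mul,
      integral_add (hti _) (hti _), integral_finsetSum _ fun j _ => hGi k j,
      integral_integral_belief hX hu _ (measurable_tail R) (abs_tail_le R),
      integral_integral_belief hX hu _ (measurable_tail R) (abs_tail_le R)]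
    simp
    ring
  have hcell := fun k : Fin (n + 1) => hℓ.le_integral_runningCost_cell ht₀ ht hX hu hIsaacs hm hopt
    hb hbsel k (hDi k) fun ω a ha c hc => by
      have hk0 := gridPoint_mem (n := n) ht k.2.le
      exact hJ _ ⟨ht₀.trans hk0.1, hk0.2⟩ a ha c hc _ _ inferInstance inferInstance
  have hcost : ∑ k, ∫ ω, runningCost ℓ (cell t₀ T n k) (X ω) (u ω) (β.toFun (u ω)) ∂P =
      ∫ ω, runningCost ℓ univ (X ω) (u ω) (β.toFun (u ω)) ∂P := by
    rw [← integral_finsetSum]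
    · simp only [hℓ.sum_runningCost_cell]
    · exact fun k _ => integrable_of_abs_le ((hℓ.continuous_runningCost _).measurable.comp
        (hX.prodMk (hu.prodMk (β.measurable_toFun.comp hu))))
          fun ω => hℓ.abs_runningCost_le ht.le _ _ _ _
  have hGsum : ∑ k : Fin (n + 1), w k * ∑ j ∈ J, ∫ ω, G k j ω ∂P ≤
      J.card * ((T - t₀) * r + C ^ 2 / r * h) := by
    calc _ ≤ ∑ k : Fin (n + 1), h * ∑ j ∈ J, ∫ ω, G k j ω ∂P :=
          Finset.sum_le_sum fun k _ => mul_le_mul_of_nonneg_right (measureReal_cell_le ht k)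
            (Finset.sum_nonneg fun j _ => integral_nonneg fun ω => abs_nonneg _)
      _ = ∑ j ∈ J, h * ∑ k : Fin (n + 1), ∫ ω, G k j ω ∂P := by
          rw [← Finset.mul_sum, Finset.sum_comm, Finset.mul_sum]
      _ ≤ ∑ j ∈ J, h * ((n + 1) * r + C ^ 2 / r) :=
          Finset.sum_le_sum fun j _ => mul_le_mul_of_nonneg_left
            (sum_integral_abs_sub_belief_le ht hX hu (hℓ.measurable j.1 j.2.1 j.2.2)
              (fun x => hℓ.bdd _ _ _ _) hr) hpos.le
      _ = _ := by
          rw [Finset.sum_const, nsmul_eq_mul, ← hhn]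
          ring
  refine (hℓ.integral_hamiltonian_belief_le ht₀ ht hX hu).trans ?_
  rw [← hcost]
  have hsum : ∑ k : Fin (n + 1), w k *
      (∫ ω, hamiltonian U V ℓ (gridPoint t₀ T n k) (belief P X u n k (u ω)) ∂P + C * h) ≤
      ∑ k, ∫ ω, runningCost ℓ (cell t₀ T n k) (X ω) (u ω) (β.toFun (u ω)) ∂P +
      ∑ k : Fin (n + 1), (w k * (2 * C * h + 3 * ε + 4 * C * ∫ ω, tail R (X ω) ∂P) +
        w k * ∑ j ∈ J, ∫ ω, G k j ω ∂P) := by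
    rw [← Finset.sum_add_distrib]
    refine Finset.sum_le_sum fun k _ => ?_
    have := hcell k
    rw [hDint] at this
    linarith
  rw [Finset.sum_add_distrib (f := fun k => w k * _), ← Finset.sum_mul, hwsum] at hsum
  linarith

variable {Ω₁ Ω₂ : Type*} [MeasurableSpace Ω₁] [MeasurableSpace Ω₂] {P₁ : Measure Ω₁}
  {P₂ : Measure Ω₂} [IsProbabilityMeasure P₁] [IsProbabilityMeasure P₂]
  {m : Measure (EuclideanSpace ℝ (Fin N))}

theorem IsMartingaleMeasure.abs_integral_hamiltonian_le (hℓ : IsRegularCost T U V ℓ C)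
    (ht : t₀ < T) {M : ℝ → Ω → Measure (EuclideanSpace ℝ (Fin N))}
    (h : IsMartingaleMeasure P t₀ T m M) :
    |∫ ω, (∫ s in Icc t₀ T, hamiltonian U V ℓ s (M s ω)) ∂P| ≤ C * (T - t₀) := by
  refine abs_integral_le_of_abs_le ?_
  filter_upwards [h.ae_forall_isProbabilityMeasure ht] with ω hω
  have h1 := norm_setIntegral_le_of_norm_le_const (μ := volume) (s := Icc t₀ T) (C := C)
    (f := fun s => hamiltonian U V ℓ s (M s ω)) (by simp) fun s hs => by
      have := hω s hs
      exact hℓ.abs_hamiltonian_le _ _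
  rwa [Real.volume_real_Icc_of_le ht.le] at h1

/-- Against any strategy of Player I, Player II has replies which are nearly as good as the value
of the martingale of the beliefs they induce. -/
theorem IsRegularCost.martingaleValue_le (hℓ : IsRegularCost T U V ℓ C) (ht₀ : 0 ≤ t₀)
    (ht : t₀ < T) (hIsaacs : ∀ t ∈ Icc 0 T, ∀ m ∈ Pi2 N, IsaacsAt U V ℓ t m) (hm : m ∈ Pi2 N)
    (hP : SufficientlyLarge P) (α : RandomStrategyI U V t₀ T N Ω₁) {S : ℝ}
    (hS : ∀ β : RandomStrategyII U V t₀ T Ω₂, payoff ℓ P₁ P₂ m α β ≤ S) :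
    martingaleValue U V ℓ T P t₀ m ≤ S := by
  have hmp : IsProbabilityMeasure m := hm.1
  have hbdd : BddBelow (range fun M : {M : ℝ → Ω → Measure (EuclideanSpace ℝ (Fin N)) //
      IsMartingaleMeasure P t₀ T m M} =>
        ∫ ω, (∫ s in Icc t₀ T, hamiltonian U V ℓ s (M.1 s ω)) ∂P) := by
    refine ⟨-(C * (T - t₀)), ?_⟩
    rintro _ ⟨M, rfl⟩
    exact (abs_le.1 (M.2.abs_integral_hamiltonian_le hℓ ht)).1
  have hcard : ∀ (R : ℕ), ∃ J : ℝ, ∀ (r : ℝ), 0 < r → ∀ n : ℕ,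
      martingaleValue U V ℓ T P t₀ m ≤ S +
      ((T - t₀) * (2 * C * ((T - t₀) * (1 / (n + 1))) + 3 * (1 / (R + 1)) +
        4 * C * ∫ x, tail R x ∂m) +
          J * ((T - t₀) * r + C ^ 2 / r * ((T - t₀) * (1 / (n + 1))))) := by
    intro R
    have hε : (0 : ℝ) < 1 / (R + 1) := by positivity
    obtain ⟨J, hJ⟩ := hℓ.exists_finset_abs_average_sub_le R hε
    refine ⟨J.card, fun r hr n => ?_⟩
    choose sel hsel hopt using fun k : ℕ =>
      hℓ.exists_measurable_maximizer (gridPoint t₀ T n k) hε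
    obtain ⟨b, hb, hbsel⟩ := exists_feedback_belief (m.prod P₁) Prod.fst ht α.toFun hsel n
    set β := StrategyII.feedback V ht n b hb with hβ
    set u₁ : EuclideanSpace ℝ (Fin N) × Ω₁ → Control U t₀ T :=
      fun z => (outcome (α.toFun z) β).1 with hu₁
    have hu₁m : Measurable u₁ :=
      measurable_outcome_fst α.stronglyMeasurable_toFun stronglyMeasurable_const
    -- a copy on `Ω` of the pair made of the control played and the parameter
    have hQ : IsProbabilityMeasure ((m.prod P₁).map fun z => (u₁ z, z.1)) :=
      Measure.isProbabilityMeasure_map (hu₁m.prodMk measurable_fst).aemeasurable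
    obtain ⟨ζ, hζ, hlaw⟩ := hP.exists_map_eq ((m.prod P₁).map fun z => (u₁ z, z.1))
    have hu : Measurable fun ω => (ζ ω).1 := measurable_fst.comp hζ
    have hX : Measurable fun ω => (ζ ω).2 := measurable_snd.comp hζ
    have hXm : P.map (fun ω => (ζ ω).2) = m := by
      have h1 : P.map (fun ω => (ζ ω).2) = (P.map ζ).map Prod.snd :=
        (Measure.map_map measurable_snd hζ).symm
      rw [h1, hlaw, Measure.map_map measurable_snd (hu₁m.prodMk measurable_fst)]
      exact Measure.fst_prod
    have hbsel' : ∀ k ≤ n, ∀ y, b k y =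
        sel k (belief P (fun ω => (ζ ω).2) (fun ω => (ζ ω).1) n k y) := by
      intro k hk y
      rw [hbsel k hk y, belief_congr_of_map_eq hX hu measurable_fst hu₁m hlaw]
    have hmain := hℓ.integral_hamiltonian_belief_le_cost_add (P := P) ht₀ ht hX hu hIsaacs
      (by rw [hXm]; exact hm) hopt hb hbsel' hJ hr
    have hM := isMartingaleMeasure_belief (P := P) (n := n) ht hX hu
    rw [hXm] at hM
    have hcostm : Measurable fun z : Control U t₀ T × EuclideanSpace ℝ (Fin N) =>
        runningCost ℓ univ z.2 z.1 (β.toFun z.1) :=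
      (hℓ.continuous_runningCost univ).measurable.comp (measurable_snd.prodMk
        (measurable_fst.prodMk (β.measurable_toFun.comp measurable_fst)))
    have hpay : ∫ ω, runningCost ℓ univ (ζ ω).2 (ζ ω).1 (β.toFun (ζ ω).1) ∂P ≤ S := by
      have h1 : ∫ ω, runningCost ℓ univ (ζ ω).2 (ζ ω).1 (β.toFun (ζ ω).1) ∂P =
          ∫ z, runningCost ℓ univ z.1 (u₁ z) (β.toFun (u₁ z)) ∂(m.prod P₁) := by
        rw [← integral_map (φ := ζ) (f := fun z => runningCost ℓ univ z.2 z.1 (β.toFun z.1))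
          hζ.aemeasurable hcostm.aestronglyMeasurable, hlaw,
          integral_map (hu₁m.prodMk measurable_fst).aemeasurable hcostm.aestronglyMeasurable]
      have h2 := hS ⟨fun _ => β, stronglyMeasurable_const⟩
      rw [(hℓ.payoff_eq ht.le α _).2] at h2
      simp only [integral_const, probReal_univ, smul_eq_mul, one_mul] at h2
      rw [h1]
      refine le_trans (le_of_eq (integral_congr_ae (ae_of_all _ fun z => ?_))) h2
      simp only [hu₁, (outcome_spec _ _).2]
    have htail : ∫ ω, tail R (ζ ω).2 ∂P = ∫ x, tail R x ∂m := by
      rw [← hXm, integral_map hX.aemeasurable (measurable_tail _).aestronglyMeasurable]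
    rw [htail] at hmain
    rw [martingaleValue_eq ht.le]
    refine (ciInf_le hbdd ⟨_, hM⟩).trans (hmain.trans ?_)
    gcongr
  have h0 := tendsto_one_div_add_atTop_nhds_zero_nat (𝕜 := ℝ)
  -- let the mesh tend to zero, then `r`, then the radius to infinity
  have hlim1 : ∀ R : ℕ, ∃ J : ℝ, ∀ r : ℝ, 0 < r → martingaleValue U V ℓ T P t₀ m ≤ S +
      ((T - t₀) * (3 * (1 / (R + 1)) + 4 * C * ∫ x, tail R x ∂m) + J * ((T - t₀) * r)) := by
    intro R
    obtain ⟨J, hJ⟩ := hcard R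
    refine ⟨J, fun r hr => ?_⟩
    have h1 := h0.const_mul (T - t₀)
    have := ((((((h1.const_mul (2 * C)).add_const (3 * (1 / ((R : ℝ) + 1)))).add_const
      (4 * C * ∫ x, tail R x ∂m)).const_mul (T - t₀)).add
        (((h1.const_mul (C ^ 2 / r)).const_add ((T - t₀) * r)).const_mul J))).const_add S
    simp only [mul_zero, add_zero, zero_add] at this
    exact ge_of_tendsto this (Eventually.of_forall (hJ r hr))
  have hlim2 : ∀ R : ℕ, martingaleValue U V ℓ T P t₀ m ≤ S +
      (T - t₀) * (3 * (1 / (R + 1)) + 4 * C * ∫ x, tail R x ∂m) := by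
    intro R
    obtain ⟨J, hJ⟩ := hlim1 R
    have hc : Continuous fun r : ℝ => S + ((T - t₀) * (3 * (1 / ((R : ℝ) + 1)) +
      4 * C * ∫ x, tail R x ∂m) + J * ((T - t₀) * r)) := by fun_prop
    have := (hc.tendsto 0).mono_left (nhdsWithin_le_nhds (s := Ioi 0))
    simp only [mul_zero, add_zero] at this
    refine ge_of_tendsto this ?_
    filter_upwards [self_mem_nhdsWithin] with r hr using hJ r hr
  have h3 := (((h0.const_mul 3).add ((tendsto_integral_tail m).const_mul (4 * C))).const_mul
    (T - t₀)).const_add S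
  simp only [mul_zero, add_zero] at h3
  exact ge_of_tendsto h3 (Eventually.of_forall hlim2)

end UninformedPlayer

/-! ### Extension of the cost and conclusion -/

section Extension

variable {N p q : ℕ} {U : NonemptyCompacts (EuclideanSpace ℝ (Fin p))}
  {V : NonemptyCompacts (EuclideanSpace ℝ (Fin q))} {T : ℝ}
  {ℓ L : EuclideanSpace ℝ (Fin N) → ℝ → EuclideanSpace ℝ (Fin p) →
    EuclideanSpace ℝ (Fin q) → ℝ}

/-- By Tietze's theorem, the cost is the restriction of a cost which is continuous and bounded
on the whole space. -/
theorem exists_isRegularCost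
    (hcont : ContinuousOn
      (fun z : EuclideanSpace ℝ (Fin N) × ℝ × EuclideanSpace ℝ (Fin p) ×
        EuclideanSpace ℝ (Fin q) => ℓ z.1 z.2.1 z.2.2.1 z.2.2.2)
      (univ ×ˢ Icc 0 T ×ˢ (U : Set (EuclideanSpace ℝ (Fin p))) ×ˢ
        (V : Set (EuclideanSpace ℝ (Fin q)))))
    (hlip : ∃ C : ℝ, ∀ u ∈ U, ∀ v ∈ V, ∀ x x', ∀ t ∈ Icc 0 T, ∀ t' ∈ Icc 0 T,
      |ℓ x t u v - ℓ x' t' u v| ≤ C * (‖x - x'‖ + |t - t'|))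
    (hbdd : ∃ C : ℝ, ∀ x, ∀ t ∈ Icc 0 T, ∀ u ∈ U, ∀ v ∈ V, |ℓ x t u v| ≤ C) :
    ∃ L : EuclideanSpace ℝ (Fin N) → ℝ → EuclideanSpace ℝ (Fin p) →
      EuclideanSpace ℝ (Fin q) → ℝ, (∃ C, IsRegularCost T U V L C) ∧
      ∀ x, ∀ t ∈ Icc 0 T, ∀ u ∈ U, ∀ v ∈ V, L x t u v = ℓ x t u v := by
  obtain ⟨C₁, h₁⟩ := hlip
  obtain ⟨C₂, h₂⟩ := hbdd
  set S : Set (EuclideanSpace ℝ (Fin N) × ℝ × EuclideanSpace ℝ (Fin p) ×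
    EuclideanSpace ℝ (Fin q)) := univ ×ˢ Icc 0 T ×ˢ (U : Set (EuclideanSpace ℝ (Fin p))) ×ˢ
        (V : Set (EuclideanSpace ℝ (Fin q))) with hS
  have hclosed : IsClosed S := isClosed_univ.prod (isClosed_Icc.prod
    (U.isCompact.isClosed.prod V.isCompact.isClosed))
  set C := max (max C₁ C₂) 0
  have hC₁ : C₁ ≤ C := (le_max_left _ _).trans (le_max_left _ _)
  have hC₂ : C₂ ≤ C := (le_max_right _ _).trans (le_max_left _ _)
  have hbound : ∀ z : S, ‖ℓ z.1.1 z.1.2.1 z.1.2.2.1 z.1.2.2.2‖ ≤ C := fun z =>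
    (h₂ _ _ z.2.2.1 _ z.2.2.2.1 _ z.2.2.2.2).trans hC₂
  set f : BoundedContinuousFunction S ℝ := BoundedContinuousFunction.ofNormedAddCommGroup
    (fun z : S => ℓ z.1.1 z.1.2.1 z.1.2.2.1 z.1.2.2.2)
    (continuousOn_iff_continuous_domRestrict.1 hcont) C hbound with hf
  obtain ⟨g, hg, hgf⟩ := f.exists_norm_eq_domRestrict_eq_of_closed hclosed
  have hgC : ‖g‖ ≤ C := by
    rw [hg]
    exact BoundedContinuousFunction.norm_ofNormedAddCommGroup_le _ (le_max_right _ _) hbound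
  have hag : ∀ x, ∀ t ∈ Icc 0 T, ∀ u ∈ U, ∀ v ∈ V, g (x, t, u, v) = ℓ x t u v :=
    fun x t ht u hu v hv =>
      congrArg (fun f : BoundedContinuousFunction S ℝ =>
        f ⟨(x, t, u, v), ⟨mem_univ _, ht, hu, hv⟩⟩) hgf
  refine ⟨fun x t u v => g (x, t, u, v), ⟨C, g.continuous, fun x t u v =>
    (g.norm_coe_le_norm _).trans hgC, fun u hu v hv x t ht t' ht' => ?_⟩, hag⟩
  rw [hag x t ht u hu v hv, hag x t' ht' u hu v hv]
  refine (h₁ u hu v hv x x t ht t' ht').trans ?_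
  rw [sub_self, norm_zero, zero_add]
  exact mul_le_mul_of_nonneg_right hC₁ (abs_nonneg _)

theorem hamiltonian_congr {t : ℝ} (h : ∀ x, ∀ u ∈ U, ∀ v ∈ V, L x t u v = ℓ x t u v)
    (μ : Measure (EuclideanSpace ℝ (Fin N))) :
    hamiltonian U V L t μ = hamiltonian U V ℓ t μ :=
  iInf_congr fun u => iSup_congr fun v =>
    integral_congr_ae (ae_of_all _ fun x => h x u u.2 v v.2)

theorem isaacsAt_congr {t : ℝ} (h : ∀ x, ∀ u ∈ U, ∀ v ∈ V, L x t u v = ℓ x t u v)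
    {μ : Measure (EuclideanSpace ℝ (Fin N))} (hI : IsaacsAt U V ℓ t μ) : IsaacsAt U V L t μ := by
  have h' : ∀ (u : U) (v : V), ∫ x, L x t u v ∂μ = ∫ x, ℓ x t u v ∂μ := fun u v =>
    integral_congr_ae (ae_of_all _ fun x => h x u u.2 v v.2)
  simpa only [IsaacsAt, h'] using hI

theorem payoff_congr {Ω₁ Ω₂ : Type*} [MeasurableSpace Ω₁] [MeasurableSpace Ω₂] {P₁ : Measure Ω₁}
    {P₂ : Measure Ω₂} {m : Measure (EuclideanSpace ℝ (Fin N))} {t₀ : ℝ} (ht₀ : t₀ ∈ Icc 0 T)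
    (h : ∀ x, ∀ t ∈ Icc 0 T, ∀ u ∈ U, ∀ v ∈ V, L x t u v = ℓ x t u v)
    (α : RandomStrategyI U V t₀ T N Ω₁) (β : RandomStrategyII U V t₀ T Ω₂) :
    payoff L P₁ P₂ m α β = payoff ℓ P₁ P₂ m α β := by
  refine integral_congr_ae (ae_of_all _ fun z => ?_)
  simp only [integral_eq_runningCost ht₀.2, runningCost, Measure.restrict_univ]
  refine integral_congr_ae ?_
  filter_upwards [(outcome (α.toFun (z.1, z.2.1)) (β.toFun z.2.2)).1.2,
    (outcome (α.toFun (z.1, z.2.1)) (β.toFun z.2.2)).2.2, ae_restrict_mem measurableSet_Icc]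
    with s hu hv hs
  exact h _ _ ⟨ht₀.1.trans hs.1, hs.2⟩ _ hu _ hv

theorem martingaleValue_congr {Ω : Type*} [MeasurableSpace Ω] {P : Measure Ω}
    {m : Measure (EuclideanSpace ℝ (Fin N))} {t₀ : ℝ} (ht₀ : t₀ ∈ Icc 0 T)
    (h : ∀ x, ∀ t ∈ Icc 0 T, ∀ u ∈ U, ∀ v ∈ V, L x t u v = ℓ x t u v) :
    martingaleValue U V L T P t₀ m = martingaleValue U V ℓ T P t₀ m := by
  refine iInf_congr fun M => integral_congr_ae (ae_of_all _ fun ω => ?_)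
  refine intervalIntegral.integral_congr fun s hs => ?_
  rw [uIcc_of_le ht₀.2] at hs
  exact hamiltonian_congr (fun x => h x s ⟨ht₀.1.trans hs.1, hs.2⟩) _

/-- The value of the game for a regular cost, on a nondegenerate time interval. -/
theorem IsRegularCost.martingaleValue_eq_upperValue {C : ℝ} (hL : IsRegularCost T U V L C)
    (hIsaacs : ∀ t ∈ Icc 0 T, ∀ m ∈ Pi2 N, IsaacsAt U V L t m)
    {Ω₁ Ω₂ Ω : Type*} [MeasurableSpace Ω₁] [MeasurableSpace Ω₂] [MeasurableSpace Ω]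
    {P₁ : Measure Ω₁} {P₂ : Measure Ω₂} {P : Measure Ω} [IsProbabilityMeasure P₁]
    [IsProbabilityMeasure P₂] [IsProbabilityMeasure P] (hP₁ : SufficientlyLarge P₁)
    (hP : SufficientlyLarge P) {t₀ : ℝ} (ht₀ : 0 ≤ t₀) (ht : t₀ < T)
    {m : Measure (EuclideanSpace ℝ (Fin N))} (hm : m ∈ Pi2 N) :
    martingaleValue U V L T P t₀ m = upperValue U V T L P₁ P₂ t₀ m := by
  have hmp : IsProbabilityMeasure m := hm.1
  obtain ⟨u⟩ : Nonempty (Control U t₀ T) := inferInstance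
  apply le_antisymm
  · have : Nonempty (RandomStrategyI U V t₀ T N Ω₁) :=
      ⟨⟨Subdivision.single ht, fun _ => StrategyI.const V _ u, stronglyMeasurable_const⟩⟩
    refine le_ciInf fun α => hL.martingaleValue_le (P₁ := P₁) (P₂ := P₂) ht₀ ht hIsaacs hm hP α
      fun β => ?_
    refine le_ciSup (f := fun β : RandomStrategyII U V t₀ T Ω₂ => payoff L P₁ P₂ m α β)
      ⟨C * (T - t₀), ?_⟩ β
    rintro _ ⟨β, rfl⟩
    exact (abs_le.1 (hL.abs_payoff_le ht.le α β)).2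
  · obtain ⟨X, hX, hXm⟩ := hP.exists_map_eq m
    have hM := isMartingaleMeasure_belief (P := P) (n := 0) ht hX
      (measurable_const (a := u))
    rw [hXm] at hM
    have : Nonempty {M : ℝ → Ω → Measure (EuclideanSpace ℝ (Fin N)) //
      IsMartingaleMeasure P t₀ T m M} := ⟨⟨_, hM⟩⟩
    rw [martingaleValue_eq ht.le]
    exact le_ciInf fun M => M.2.upperValue_le hP₁ hL ht₀ ht

end Extension

end

end IncompleteInfoGame

theorem theorem3p1 {N p q : ℕ} {T : ℝ} (hT : 0 < T)
    (U : TopologicalSpace.NonemptyCompacts (EuclideanSpace ℝ (Fin p)))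
    (V : TopologicalSpace.NonemptyCompacts (EuclideanSpace ℝ (Fin q)))
    (ℓ : EuclideanSpace ℝ (Fin N) → ℝ → EuclideanSpace ℝ (Fin p) →
      EuclideanSpace ℝ (Fin q) → ℝ)
    (hℓ_cont : ContinuousOn
      (fun z : EuclideanSpace ℝ (Fin N) × ℝ × EuclideanSpace ℝ (Fin p) ×
        EuclideanSpace ℝ (Fin q) => ℓ z.1 z.2.1 z.2.2.1 z.2.2.2)
      (Set.univ ×ˢ Set.Icc 0 T ×ˢ (U : Set (EuclideanSpace ℝ (Fin p))) ×ˢ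
        (V : Set (EuclideanSpace ℝ (Fin q)))))
    (hℓ_lip : ∃ C : ℝ, ∀ u ∈ U, ∀ v ∈ V, ∀ x x', ∀ t ∈ Set.Icc 0 T, ∀ t' ∈ Set.Icc 0 T,
      |ℓ x t u v - ℓ x' t' u v| ≤ C * (‖x - x'‖ + |t - t'|))
    (hℓ_bdd : ∃ C : ℝ, ∀ x, ∀ t ∈ Set.Icc 0 T, ∀ u ∈ U, ∀ v ∈ V, |ℓ x t u v| ≤ C)
    (hIsaacs : ∀ t ∈ Set.Icc 0 T, ∀ m ∈ IncompleteInfoGame.Pi2 N,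
      IncompleteInfoGame.IsaacsAt U V ℓ t m)
    {Ω₁ Ω₂ Ω : Type*} [MeasurableSpace Ω₁] [MeasurableSpace Ω₂] [MeasurableSpace Ω]
    (P₁ : MeasureTheory.Measure Ω₁) (P₂ : MeasureTheory.Measure Ω₂)
    (P : MeasureTheory.Measure Ω) [MeasureTheory.IsProbabilityMeasure P₁]
    [MeasureTheory.IsProbabilityMeasure P₂] [MeasureTheory.IsProbabilityMeasure P]
    (hP₁ : IncompleteInfoGame.SufficientlyLarge P₁)
    (hP : IncompleteInfoGame.SufficientlyLarge P)
    (t₀ : ℝ) (ht₀ : t₀ ∈ Set.Icc 0 T)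
    (m : MeasureTheory.Measure (EuclideanSpace ℝ (Fin N)))
    (hm : m ∈ IncompleteInfoGame.Pi2 N) :
    IncompleteInfoGame.martingaleValue U V ℓ T P t₀ m =
      IncompleteInfoGame.upperValue U V T ℓ P₁ P₂ t₀ m := by
  obtain rfl | ht := eq_or_lt_of_le ht₀.2
  · -- the game is over: all payoffs vanish
    simp [IncompleteInfoGame.martingaleValue, IncompleteInfoGame.upperValue,
      IncompleteInfoGame.payoff]
  obtain ⟨L, ⟨C, hL⟩, hLℓ⟩ := IncompleteInfoGame.exists_isRegularCost hℓ_cont hℓ_lip hℓ_bdd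
  have h := hL.martingaleValue_eq_upperValue
    (fun t ht m hm => IncompleteInfoGame.isaacsAt_congr (fun x => hLℓ x t ht) (hIsaacs t ht m hm))
    (P₂ := P₂) hP₁ hP ht₀.1 ht hm
  rw [IncompleteInfoGame.martingaleValue_congr ht₀ hLℓ] at h
  rw [h]
  simp only [IncompleteInfoGame.upperValue, IncompleteInfoGame.payoff_congr ht₀ hLℓ]
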